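/- Let $M(x,y,z)=x^2+y^2+z^2-xyz$ and write $e_m(t)=\exp(2\pi i t/m)$. For $a\in\mathbb{Z}$ and integers $m,K\ge 1$ put \[ T_a(m)=\sum_{\substack{1\le u\le m\\ \gcd(u,m)=1}}\ \sum_{1\le x,y,z\le m} e_m\bigl(u\,(M(x,y,z)-a)\bigr),\qquad s_a(K)=\sum_{m\le K} m^{-3}\,T_a(m). \] For integers $A,K\ge 1$ and real $\eta>0$ let \[ \mathcal{S}(A,K,\eta)=\{a\in\mathbb{Z}:\ |a|\le A,\ a\not\equiv 3 \bmod 4,\ a\not\equiv \pm 3 \bmod 9,\ |s_a(K)|\le \eta\}. \] Theorem 4.1. For every integer $j\ge 1$ and every real $\epsilon>0$ there is a constant $C>0$, depending only on $j$ and $\epsilon$, such that for all real $\eta>0$ and all integers $A,K\ge 1$ with $A\ge K^{6j}$, \[ \frac{\#\mathcal{S}(A,K,\eta)}{A}\le C\left(\eta^{1.8j}+A^{\epsilon}K^{-1.5j}+\eta^{0.2j}K^{-j+\epsilon}\right). \] -/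

import Mathlib

namespace Markoff

/-- The Markoff polynomial `M(x, y, z) = x² + y² + z² - xyz`. -/
def M (x y z : ℤ) : ℤ := x ^ 2 + y ^ 2 + z ^ 2 - x * y * z

/-- The additive character `e_m(t) = exp(2πi t / m)`. -/
noncomputable def e (m : ℕ) (t : ℤ) : ℂ :=
  Complex.exp (2 * (Real.pi : ℂ) * Complex.I * (t : ℂ) / (m : ℂ))

/-- The complete exponential sum
`T_a(m) = ∑_{1 ≤ u ≤ m, gcd(u, m) = 1} ∑_{1 ≤ x, y, z ≤ m} e_m(u (M(x, y, z) - a))`.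
(Its values are real numbers, by the symmetry `u ↦ m - u`.) -/
noncomputable def T (a : ℤ) (m : ℕ) : ℂ :=
  ∑ u ∈ (Finset.Icc 1 m).filter (fun u : ℕ => Nat.gcd u m = 1),
    ∑ x ∈ Finset.Icc (1 : ℤ) m, ∑ y ∈ Finset.Icc (1 : ℤ) m, ∑ z ∈ Finset.Icc (1 : ℤ) m,
      e m ((u : ℤ) * (M x y z - a))

/-- The truncated singular series `s_a(K) = ∑_{1 ≤ m ≤ K} m⁻³ T_a(m)`. -/
noncomputable def s (a : ℤ) (K : ℕ) : ℂ :=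
  ∑ m ∈ Finset.Icc 1 K, ((m : ℂ) ^ 3)⁻¹ * T a m

/-- An integer `a` is admissible if `a ≢ 3 (mod 4)` and `a ≢ ±3 (mod 9)`. -/
def Admissible (a : ℤ) : Prop :=
  ¬ a ≡ 3 [ZMOD 4] ∧ ¬ a ≡ 3 [ZMOD 9] ∧ ¬ a ≡ -3 [ZMOD 9]

/-- The set `S(A, K, η)` of admissible integers `a` with `|a| ≤ A` and `|s_a(K)| ≤ η`. -/
def smallValueSet (A K : ℕ) (η : ℝ) : Set ℤ :=
  {a : ℤ | |a| ≤ (A : ℤ) ∧ Admissible a ∧ ‖s a K‖ ≤ η}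

/-- The set `S(A, K, η)` is finite, so that its `Set.ncard` is its number of elements. -/
theorem smallValueSet_finite (A K : ℕ) (η : ℝ) : (smallValueSet A K η).Finite :=
  (Set.finite_Icc (-(A : ℤ)) (A : ℤ)).subset fun _ ha => abs_le.mp ha.1

end Markoff

/-! The truncated series is `∑ m ≤ K, c_a(m)` with `c_a = coeff a` real and multiplicative
(`s_eq_sum_coeff`). To exploit that it is small, multiply it by a truncated inverse. The function
`r_a = roughInverse P (coeff a)` inverts the Euler factors of `c_a` at the primes `p ≥ P` only, so
`c_a * r_a` lives on `P`-smooth integers. For admissible `a` and large `K` its partial sums exceed a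
fixed `σ > 0` (`exists_le_sum_smoothPart_coeff`): at the finitely many primes below `P`, the surface
`M = a` has nonsingular local points. Expanding the product of the two truncated sums
(`sum_mul_sum_eq`) gives `σ ≤ η|X| + |Y| + |Z|`, where `X = ∑ n ≤ K, r_a(n)`, and `Y`, `Z` collect
the terms `c_a(m) r_a(n)` with `K < mn ≤ K^(3/2)` and `mn > K^(3/2)` respectively. One of the three
is at least `σ/3`, and Chebyshev's inequality with exponents `2j`, `4j`, `2j` counts the possible
`a`. These exponents fit `A ≥ K^(6j)`, since `(K^(3/2))^(4j) = K^(6j)` and `(K^2)^(2j) ≤ K^(6j)`.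

The moments come from `TameFamily.exists_moment_le`. Expanding a power gives means over `|a| ≤ A` of
products periodic in `a` with period at most `A`. A Fejér weight has compactly supported Fourier
transform, hence sees exactly the mean over a full period (`hasSum_fejer_mul`). By the Chinese
remainder theorem that mean factors over primes. After weighting by `m^(1/2 - δ)`, the absolute
values sum to an Euler product with factors `1 + O(p^(-1-δ))`: a single nontrivial local factor has
tiny mean, and two or more are handled by Cauchy–Schwarz. The weights turn a lower bound `mn ≥ L`
into the saving `L^(-(1/2 - δ)k)` in the `k`-th moment. Thus `X` has bounded moments, while `Y` and
`Z` save `K^(-2j + 4δj)` and `K^(-3j/2 + 3δj)`; the first two terms of the stated bound already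
absorb all three.

The local inputs are size `p^(-l/2)`, mean square `O(p^(-l-1))` and mean zero for `c_a(p^l)`. At `l
= 1` they follow by counting points on the conics that fibre the surface (`abs_coeff_prime_le`); for
`l ≥ 2` by stationary phase at the five critical points of `M` and Parseval in `a`
(`norm_markoff_descent`, `avg_coeff_sq_le`). The recursion for inverse power series passes them on
to `r_a` (`invCoeff_bounds`). -/

/-! ### Means of periodic functions -/

open Finset in
/-- A sum over `range (P * N)` split according to residues modulo `P`. -/
theorem sum_range_mul_residue {E : Type*} [AddCommMonoid E] (P N : ℕ) (f : ℤ → E) :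
    ∑ x ∈ range (P * N), f x = ∑ r ∈ range P, ∑ x ∈ range N, f (r + P * x) := by
  rw [← Finset.sum_product']
  symm
  refine Finset.sum_nbij' (fun v => v.1 + P * v.2) (fun n => (n % P, n / P)) ?_ ?_ ?_ ?_ ?_
  · rintro ⟨r, x⟩ h
    simp only [mem_product, mem_range] at h ⊢
    calc r + P * x < P + P * x := by omega
      _ = P * (x + 1) := by ring
      _ ≤ P * N := Nat.mul_le_mul_left _ h.2
  · intro n hn
    simp only [mem_product, mem_range] at hn ⊢
    have hP : 0 < P := Nat.pos_of_ne_zero (by rintro rfl; simp at hn)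
    exact ⟨Nat.mod_lt _ hP, Nat.div_lt_of_lt_mul hn⟩
  · rintro ⟨r, x⟩ h
    simp only [mem_product, mem_range] at h
    have hP : 0 < P := by omega
    simp [Nat.add_mul_mod_self_left, Nat.mod_eq_of_lt h.1, Nat.add_mul_div_left _ _ hP,
      Nat.div_eq_of_lt h.1]
  · intro n _
    simp [Nat.mod_add_div]
  · rintro ⟨r, x⟩ _
    simp

theorem sum_range_shift {E : Type*} [AddCommGroup E] {N : ℕ} {f : ℤ → E}
    (hf : Function.Periodic f N) (t : ℤ) :
    ∑ x ∈ Finset.range N, f (x + t) = ∑ x ∈ Finset.range N, f x := by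
  have key : ∀ g : ℤ → E, Function.Periodic g N →
      ∑ x ∈ Finset.range N, g (x + 1) = ∑ x ∈ Finset.range N, g x := by
    intro g hg
    have h1 := Finset.sum_range_succ (fun x : ℕ => g x) N
    have h2 := Finset.sum_range_succ' (fun x : ℕ => g x) N
    have h3 : g (N : ℤ) = g ((0 : ℕ) : ℤ) := by simpa using hg 0
    rw [h2, h3] at h1
    simpa using add_right_cancel h1
  have hper : ∀ s : ℤ, Function.Periodic (fun x => f (x + s)) N := fun s x => by
    simpa [add_right_comm] using hf (x + s)
  induction t using Int.induction_on with
  | zero => simp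
  | succ i ih =>
    rw [← ih, ← key _ (hper i)]
    exact Finset.sum_congr rfl fun x _ => by congr 1; ring
  | pred i ih =>
    rw [← ih, ← key _ (hper (-i - 1))]
    exact Finset.sum_congr rfl fun x _ => by congr 1; ring

theorem sum_range_period_mul {E : Type*} [AddCommGroup E] {N : ℕ} {f : ℤ → E}
    (hf : Function.Periodic f N) (n : ℕ) :
    ∑ x ∈ Finset.range (n * N), f x = n • ∑ x ∈ Finset.range N, f x := by
  induction n with
  | zero => simp
  | succ n ih =>
    rw [Nat.succ_mul, Finset.sum_range_add, ih, succ_nsmul]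
    congr 1
    rw [← sum_range_shift hf (n * N : ℕ)]
    exact Finset.sum_congr rfl fun x _ => by push_cast; ring_nf

/-- The mean value of `f` over `{0, …, q - 1}`. -/
noncomputable def avg {E : Type*} [NormedAddCommGroup E] [NormedSpace ℝ E] (q : ℕ) (f : ℤ → E) :
    E :=
  (q : ℝ)⁻¹ • ∑ x ∈ Finset.range q, f x

section avg

variable {E : Type*} [NormedAddCommGroup E] [NormedSpace ℝ E]

theorem avg_const {q : ℕ} (hq : q ≠ 0) (c : E) : avg q (fun _ => c) = c := by
  have : (q : ℝ) ≠ 0 := by exact_mod_cast hq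
  simp [avg, ← Nat.cast_smul_eq_nsmul ℝ, smul_smul, this]

theorem avg_congr {q : ℕ} {f g : ℤ → E} (h : ∀ x, f x = g x) : avg q f = avg q g := by
  simp [avg, h]

theorem avg_sum {ι : Type*} (s : Finset ι) (q : ℕ) (f : ι → ℤ → E) :
    avg q (fun x => ∑ i ∈ s, f i x) = ∑ i ∈ s, avg q (f i) := by
  simp only [avg, ← Finset.smul_sum]
  rw [Finset.sum_comm]

theorem avg_add (q : ℕ) (f g : ℤ → E) :
    avg q (fun x => f x + g x) = avg q f + avg q g := by
  simp [avg, Finset.sum_add_distrib]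

theorem avg_neg (q : ℕ) (f : ℤ → E) : avg q (fun x => -f x) = -avg q f := by
  simp [avg]

theorem avg_smul (q : ℕ) (c : ℝ) (f : ℤ → E) :
    avg q (fun x => c • f x) = c • avg q f := by
  simp only [avg, ← Finset.smul_sum]
  rw [smul_comm]

theorem avg_shift {q : ℕ} {f : ℤ → E} (hf : Function.Periodic f q) (t : ℤ) :
    avg q (fun x => f (x + t)) = avg q f := by
  simp only [avg, sum_range_shift hf]

theorem avg_period_mul {q n : ℕ} {f : ℤ → E} (hf : Function.Periodic f q) (hn : n ≠ 0) :
    avg (n * q) f = avg q f := by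
  have : (n : ℝ) ≠ 0 := by exact_mod_cast hn
  simp only [avg, sum_range_period_mul hf, ← Nat.cast_smul_eq_nsmul ℝ, smul_smul]
  congr 1
  push_cast
  field_simp

theorem avg_of_dvd {q m : ℕ} {f : ℤ → E} (hf : Function.Periodic f q) (hm : m ≠ 0) (h : q ∣ m) :
    avg m f = avg q f := by
  obtain ⟨n, rfl⟩ := h
  rw [mul_comm]
  exact avg_period_mul hf (by rintro rfl; simp at hm)

theorem avg_residue (P N : ℕ) (f : ℤ → E) :
    avg (P * N) f = avg P (fun r => avg N (fun x => f (r + P * x))) := by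
  simp only [avg, sum_range_mul_residue, ← Finset.smul_sum, smul_smul]
  congr 1
  push_cast
  rw [mul_inv]

theorem norm_avg_le {q : ℕ} {f : ℤ → E} {B : ℝ} (hB : 0 ≤ B) (h : ∀ x, ‖f x‖ ≤ B) :
    ‖avg q f‖ ≤ B := by
  rcases eq_or_ne q 0 with rfl | hq
  · simpa [avg] using hB
  have hq' : (0 : ℝ) < q := by positivity
  rw [avg, norm_smul, norm_inv, Real.norm_natCast, inv_mul_le_iff₀ hq']
  calc _ ≤ ∑ x ∈ Finset.range q, ‖f x‖ := norm_sum_le _ _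
    _ ≤ ∑ x ∈ Finset.range q, B := Finset.sum_le_sum fun x _ => h x
    _ = q * B := by simp

end avg

theorem avg_mul_left (q : ℕ) (c : ℝ) (f : ℤ → ℝ) :
    avg q (fun x => c * f x) = c * avg q f := avg_smul q c f

theorem avg_mono {q : ℕ} {f g : ℤ → ℝ} (h : ∀ x, f x ≤ g x) : avg q f ≤ avg q g := by
  simp only [avg, smul_eq_mul]
  gcongr with x
  exact h x

theorem avg_nonneg {q : ℕ} {f : ℤ → ℝ} (h : ∀ x, 0 ≤ f x) : 0 ≤ avg q f := by
  simp only [avg, smul_eq_mul]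
  exact mul_nonneg (by positivity) (Finset.sum_nonneg fun x _ => h x)

theorem abs_avg_le (q : ℕ) (f : ℤ → ℝ) : |avg q f| ≤ avg q (fun x => |f x|) := by
  simp only [avg, smul_eq_mul, abs_mul, abs_inv, Nat.abs_cast]
  gcongr
  exact Finset.abs_sum_le_sum_abs _ _

theorem avg_mul_sq_le (q : ℕ) (f g : ℤ → ℝ) :
    (avg q (fun x => f x * g x)) ^ 2 ≤ avg q (fun x => f x ^ 2) * avg q (fun x => g x ^ 2) := by
  simp only [avg, smul_eq_mul]
  have := Finset.sum_mul_sq_le_sq_mul_sq (Finset.range q) (fun x : ℕ => f x) (fun x : ℕ => g x)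
  have h2 := mul_le_mul_of_nonneg_left this (sq_nonneg (q : ℝ)⁻¹)
  rw [mul_pow]
  refine h2.trans_eq ?_
  rw [mul_mul_mul_comm, sq (q : ℝ)⁻¹]

theorem periodic_of_dvd {E : Type*} {q m : ℕ} {f : ℤ → E} (hf : Function.Periodic f q)
    (h : q ∣ m) : Function.Periodic f m := by
  obtain ⟨n, rfl⟩ := h
  have := hf.nat_mul n
  rwa [← Nat.cast_mul, mul_comm n q] at this

theorem periodic_eq_of_modEq {E : Type*} {q : ℕ} {f : ℤ → E} (hf : Function.Periodic f q)
    {a b : ℤ} (h : a ≡ b [ZMOD q]) : f a = f b := by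
  obtain ⟨t, ht⟩ := h.dvd
  have : b = a + t * q := by linarith
  rw [this]
  exact ((hf.int_mul t) a).symm

/-- Sums of periodic functions are unchanged by an invertible dilation. -/
theorem sum_range_dilate {E : Type*} [AddCommGroup E] {n : ℕ} {f : ℤ → E}
    (hf : Function.Periodic f n) {m : ℕ} (h : Nat.Coprime m n) (r : ℤ) :
    ∑ x ∈ Finset.range n, f (r + m * x) = ∑ x ∈ Finset.range n, f x := by
  rcases Nat.eq_zero_or_pos n with rfl | hn
  · simp
  rw [← sum_range_shift hf r]
  refine Finset.sum_nbij (fun x => (m * x) % n) ?_ ?_ ?_ ?_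
  · intro x _
    simpa using Nat.mod_lt _ hn
  · intro x hx y hy hxy
    simp only [Finset.coe_range, Set.mem_Iio] at hx hy
    have : x ≡ y [MOD n] :=
      Nat.ModEq.cancel_left_of_coprime (by simpa [Nat.coprime_comm] using h) hxy
    rwa [Nat.ModEq, Nat.mod_eq_of_lt hx, Nat.mod_eq_of_lt hy] at this
  · refine Finset.surjOn_of_injOn_of_card_le _ ?_ ?_ le_rfl
    · intro x _
      simpa using Nat.mod_lt _ hn
    · intro x hx y hy hxy
      simp only [Finset.coe_range, Set.mem_Iio] at hx hy
      have : x ≡ y [MOD n] :=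
        Nat.ModEq.cancel_left_of_coprime (by simpa [Nat.coprime_comm] using h) hxy
      rwa [Nat.ModEq, Nat.mod_eq_of_lt hx, Nat.mod_eq_of_lt hy] at this
  · intro x _
    apply periodic_eq_of_modEq hf
    rw [add_comm]
    apply Int.ModEq.add_right
    push_cast
    exact (Int.mod_modEq _ _).symm

/-- Periodic functions with coprime periods are independent. -/
theorem avg_mul_of_coprime {m n : ℕ} (h : Nat.Coprime m n) {f g : ℤ → ℝ}
    (hf : Function.Periodic f m) (hg : Function.Periodic g n) :
    avg (m * n) (fun x => f x * g x) = avg m f * avg n g := by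
  rw [avg_residue]
  have : ∀ r : ℤ, avg n (fun x => f (r + m * x) * g (r + m * x)) = f r * avg n g := by
    intro r
    have h1 : ∀ x : ℤ, f (r + m * x) = f r := fun x => by
      have := (hf.int_mul x) r
      rwa [mul_comm] at this
    simp only [h1]
    rw [avg_mul_left]
    congr 1
    simp only [avg]
    rw [sum_range_dilate hg h]
  simp only [this]
  simp_rw [mul_comm _ (avg n g)]
  rw [avg_mul_left]

theorem avg_prod_of_coprime {ι : Type*} [DecidableEq ι] (s : Finset ι) (q : ι → ℕ)
    (hq : ∀ i ∈ s, ∀ j ∈ s, i ≠ j → Nat.Coprime (q i) (q j)) (f : ι → ℤ → ℝ)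
    (hf : ∀ i ∈ s, Function.Periodic (f i) (q i)) :
    avg (∏ i ∈ s, q i) (fun x => ∏ i ∈ s, f i x) = ∏ i ∈ s, avg (q i) (f i) := by
  induction s using Finset.induction_on with
  | empty => simp [avg]
  | insert a s ha ih =>
    simp only [Finset.prod_insert ha]
    rw [avg_mul_of_coprime _ (hf a (by simp)), ih]
    · exact fun i hi j hj hij => hq i (by simp [hi]) j (by simp [hj]) hij
    · exact fun i hi => hf i (by simp [hi])
    · intro x
      refine Finset.prod_congr rfl fun i hi => ?_
      exact periodic_of_dvd (hf i (by simp [hi])) (Finset.dvd_prod_of_mem q hi) x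
    · refine Nat.Coprime.prod_right fun i hi => hq a (by simp) i (by simp [hi]) ?_
      rintro rfl
      exact ha hi

/-! ### A Fejér weight -/

/-- The Fejér weight `sin²(π n / N) / n²`, with its limiting value at `0`. -/
noncomputable def fejer (N : ℕ) (n : ℤ) : ℝ :=
  if n = 0 then Real.pi ^ 2 / N ^ 2 else Real.sin (Real.pi * n / N) ^ 2 / n ^ 2

theorem fejer_nonneg (N : ℕ) (n : ℤ) : 0 ≤ fejer N n := by
  unfold fejer; split_ifs <;> positivity

/-- Jordan's inequality `sin t ≥ 2t/π` on `[0, π/2]`. It makes the weight, up to scaling, a majorant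
of the indicator of an interval. -/
theorem le_fejer {N : ℕ} (hN : 0 < N) {n : ℤ} (hn : 2 * |n| ≤ N) : 4 / (N : ℝ) ^ 2 ≤ fejer N n := by
  have hN' : (0 : ℝ) < N := by exact_mod_cast hN
  have hpi := Real.two_le_pi
  unfold fejer
  split_ifs with h
  · gcongr
    nlinarith
  · have hn' : 0 < |(n : ℝ)| := by positivity
    have h1 : 2 * |(n : ℝ)| ≤ N := by exact_mod_cast hn
    have h2 : 2 / Real.pi * (Real.pi * |(n : ℝ)| / N) ≤ Real.sin (Real.pi * |(n : ℝ)| / N) := by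
      apply Real.mul_le_sin (by positivity)
      rw [div_le_div_iff₀ hN' two_pos]
      nlinarith [Real.pi_pos]
    have h3 : Real.sin (Real.pi * n / N) ^ 2 = Real.sin (Real.pi * |(n : ℝ)| / N) ^ 2 := by
      rcases abs_choice (n : ℝ) with h | h <;> rw [h]
      rw [mul_neg, neg_div, Real.sin_neg, neg_sq]
    rw [h3, ← sq_abs (n : ℝ), le_div_iff₀ (by positivity)]
    calc 4 / (N : ℝ) ^ 2 * |(n : ℝ)| ^ 2 = (2 / Real.pi * (Real.pi * |(n : ℝ)| / N)) ^ 2 := by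
          field_simp; norm_num
      _ ≤ _ := by gcongr

theorem hasSum_fourier_two {y : ℝ} (hy : y ∈ Set.Icc (0 : ℝ) 1) :
    HasSum (fun n : ℤ => 1 / (n : ℂ) ^ 2 * Complex.exp (2 * Real.pi * Complex.I * n * y))
      ((2 * Real.pi ^ 2 * (y ^ 2 - y + 1 / 6) : ℝ) : ℂ) := by
  have h := hasSum_one_div_pow_mul_fourier_mul_bernoulliFun (k := 2) le_rfl hy
  have hb : bernoulliFun 2 y = y ^ 2 - y + 1 / 6 := by
    simp [bernoulliFun, Polynomial.bernoulli, Finset.sum_range_succ, bernoulli_eq_bernoulli'_of_ne_one,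
      bernoulli_one, bernoulli'_two]
    ring
  have hb' : bernoulliFun 2 y = y ^ 2 - y + 1 / 6 := hb
  rw [hb'] at h
  convert h using 1
  · ext n
    rw [fourier_coe_apply]
    norm_num
  · push_cast
    rw [mul_pow, mul_pow, Complex.I_sq]
    norm_num [Nat.factorial]
    left; ring

/-- Since `sin²` is a combination of exponentials, the series is a second difference with step `1/N`
of the Fourier series of the Bernoulli polynomial `B₂`. Away from `0` modulo `1` the second
difference of a quadratic is constant and cancels the term `n = 0`; at `x = 0` the wrap-around
leaves `π²/N`. -/
theorem hasSum_fejer_mul_exp {N : ℕ} (hN : 0 < N) {x v : ℝ}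
    (h : (x = 0 ∧ v = Real.pi ^ 2 / N) ∨ (1 / (N : ℝ) ≤ x ∧ x ≤ 1 - 1 / N ∧ v = 0)) :
    HasSum (fun n : ℤ => (fejer N n : ℂ) * Complex.exp (2 * Real.pi * Complex.I * n * x)) v := by
  have hN' : (0 : ℝ) < N := by exact_mod_cast hN
  have hN1 : (1 : ℝ) ≤ N := by exact_mod_cast hN
  set t : ℝ := 1 / N with ht
  have ht0 : 0 < t := by positivity
  have ht1 : t ≤ 1 := by rw [ht, div_le_one hN']; exact hN1
  -- `a`, `b`, `c` represent `x`, `x + t`, `x - t` modulo `1` inside `[0, 1]`, where the `B₂`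
  -- expansion is valid.
  have key : ∀ a b c : ℝ, a ∈ Set.Icc (0 : ℝ) 1 → b ∈ Set.Icc (0 : ℝ) 1 → c ∈ Set.Icc (0 : ℝ) 1 →
      (∀ n : ℤ, Complex.exp (2 * Real.pi * Complex.I * n * b) =
        Complex.exp (2 * Real.pi * Complex.I * n * ((x + t : ℝ) : ℂ))) →
      (∀ n : ℤ, Complex.exp (2 * Real.pi * Complex.I * n * c) =
        Complex.exp (2 * Real.pi * Complex.I * n * ((x - t : ℝ) : ℂ))) → a = x →
      v = Real.pi ^ 2 * t ^ 2 + Real.pi ^ 2 / 2 * (2 * (a ^ 2 - a + 1 / 6) - (b ^ 2 - b + 1 / 6)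
        - (c ^ 2 - c + 1 / 6)) →
      HasSum (fun n : ℤ => (fejer N n : ℂ) * Complex.exp (2 * Real.pi * Complex.I * n * x)) v := by
    intro a b c ha hb hc hb' hc' hax hv
    subst hax
    have h1 := ((((hasSum_fourier_two ha).mul_left 2).sub (hasSum_fourier_two hb)).sub
      (hasSum_fourier_two hc)).mul_left (1 / 4)
    have h0 := hasSum_ite_eq (0 : ℤ) ((Real.pi ^ 2 * t ^ 2 : ℝ) : ℂ)
    convert! h0.add h1 using 1
    · ext n
      rw [hb', hc']
      by_cases hn : n = 0
      · subst hn
        simp [fejer, ht]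
        field_simp
      · have hn' : (n : ℂ) ≠ 0 := by exact_mod_cast hn
        have hs : ((Real.sin (Real.pi * n / N) : ℝ) : ℂ) ^ 2 =
            1 / 4 * (2 - Complex.exp (2 * Real.pi * Complex.I * n * t)
              - Complex.exp (-(2 * Real.pi * Complex.I * n * t))) := by
          rw [Complex.ofReal_sin, Complex.sin]
          set w := Complex.exp (((Real.pi * n / N : ℝ) : ℂ) * Complex.I) with hw
          have e1 : Complex.exp (-((Real.pi * n / N : ℝ) : ℂ) * Complex.I) = w⁻¹ := by
            rw [hw, ← Complex.exp_neg]; congr 1; ring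
          have e2 : Complex.exp (2 * Real.pi * Complex.I * n * t) = w ^ 2 := by
            rw [hw, ← Complex.exp_nat_mul]; congr 1; rw [ht]; push_cast; ring
          have e3 : Complex.exp (-(2 * Real.pi * Complex.I * n * t)) = (w ^ 2)⁻¹ := by
            rw [Complex.exp_neg, e2]
          have hw0 : w ≠ 0 := Complex.exp_ne_zero _
          rw [e1, e2, e3, div_pow, mul_pow, Complex.I_sq]
          field_simp
          ring
        have e4 : Complex.exp (2 * Real.pi * Complex.I * n * ((a + t : ℝ) : ℂ)) =
            Complex.exp (2 * Real.pi * Complex.I * n * a) *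
              Complex.exp (2 * Real.pi * Complex.I * n * t) := by
          rw [← Complex.exp_add]; congr 1; push_cast; ring
        have e5 : Complex.exp (2 * Real.pi * Complex.I * n * ((a - t : ℝ) : ℂ)) =
            Complex.exp (2 * Real.pi * Complex.I * n * a) *
              Complex.exp (-(2 * Real.pi * Complex.I * n * t)) := by
          rw [← Complex.exp_add]; congr 1; push_cast; ring
        rw [e4, e5]
        simp only [fejer, hn, if_false]
        push_cast at hs ⊢
        rw [hs]
        ring
    · rw [hv]
      push_cast
      ring
  have hint : ∀ n : ℤ, Complex.exp (2 * Real.pi * Complex.I * n) = 1 := fun n => by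
    rw [show (2 * Real.pi * Complex.I * n : ℂ) = n * (2 * Real.pi * Complex.I) by ring]
    exact Complex.exp_int_mul_two_pi_mul_I n
  rcases h with ⟨rfl, rfl⟩ | ⟨hx1, hx2, rfl⟩
  · refine key 0 t (1 - t) (by simp) ⟨ht0.le, ht1⟩ ⟨by linarith, by linarith⟩ ?_ ?_ rfl ?_
    · intro n; simp
    · intro n
      rw [show (2 * Real.pi * Complex.I * n * ((1 - t : ℝ) : ℂ) : ℂ) =
        2 * Real.pi * Complex.I * n + 2 * Real.pi * Complex.I * n * ((0 - t : ℝ) : ℂ) by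
          push_cast; ring, Complex.exp_add, hint, one_mul]
    · rw [ht]; field_simp; ring
  · refine key x (x + t) (x - t) ⟨by linarith, by linarith⟩ ⟨by linarith, by linarith⟩
      ⟨by linarith, by linarith⟩ (fun n => rfl) (fun n => rfl) rfl ?_
    ring

/-! ### The additive character -/

namespace Markoff

theorem e_add (m : ℕ) (s t : ℤ) : e m (s + t) = e m s * e m t := by
  rw [e, e, e, ← Complex.exp_add]
  congr 1
  push_cast
  ring

theorem e_zero (m : ℕ) : e m 0 = 1 := by simp [e]

theorem e_mul_self (m : ℕ) (t : ℤ) : e m (m * t) = 1 := by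
  rcases eq_or_ne m 0 with rfl | hm
  · simp [e]
  have : (m : ℂ) ≠ 0 := by exact_mod_cast hm
  rw [e, Complex.exp_eq_one_iff]
  exact ⟨t, by push_cast; field_simp⟩

theorem e_periodic (m : ℕ) : Function.Periodic (e m) m := fun t => by
  have := e_mul_self m 1
  rw [mul_one] at this
  rw [e_add, this, mul_one]

theorem e_eq_of_modEq {m : ℕ} {s t : ℤ} (h : s ≡ t [ZMOD m]) : e m s = e m t :=
  periodic_eq_of_modEq (e_periodic m) h

theorem norm_e (m : ℕ) (t : ℤ) : ‖e m t‖ = 1 := by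
  rw [e, show (2 * (Real.pi : ℂ) * Complex.I * (t : ℂ) / (m : ℂ)) =
    ((2 * Real.pi * t / m : ℝ) : ℂ) * Complex.I by push_cast; ring]
  exact Complex.norm_exp_ofReal_mul_I _

theorem e_neg (m : ℕ) (t : ℤ) : e m (-t) = (starRingEnd ℂ) (e m t) := by
  rw [e, e, ← Complex.exp_conj]
  congr 1
  simp only [Int.cast_neg, map_div₀, map_mul, Complex.conj_ofReal, Complex.conj_I, map_ofNat,
    Complex.conj_natCast, map_intCast]
  ring

theorem e_mul_mul {P : ℕ} (hP : P ≠ 0) (m : ℕ) (t : ℤ) : e (P * m) (P * t) = e m t := by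
  have : (P : ℂ) ≠ 0 := by exact_mod_cast hP
  rw [e, e]
  congr 1
  push_cast
  rw [show 2 * (Real.pi : ℂ) * Complex.I * (P * t) = P * (2 * Real.pi * Complex.I * t) by ring,
    mul_div_mul_left _ _ this]

theorem e_eq_one_iff {m : ℕ} (hm : m ≠ 0) {t : ℤ} : e m t = 1 ↔ (m : ℤ) ∣ t := by
  constructor
  · intro h
    rw [e, Complex.exp_eq_one_iff] at h
    obtain ⟨n, hn⟩ := h
    have hm' : (m : ℂ) ≠ 0 := by exact_mod_cast hm
    have h2 : (2 * (Real.pi : ℂ) * Complex.I) ≠ 0 := Complex.two_pi_I_ne_zero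
    refine ⟨n, ?_⟩
    have : (t : ℂ) = m * n := by
      rw [div_eq_iff hm'] at hn
      apply mul_left_cancel₀ h2
      rw [hn]; ring
    exact_mod_cast this
  · rintro ⟨n, rfl⟩
    exact e_mul_self m n

/-- Orthogonality of additive characters. -/
theorem sum_e_mul {m : ℕ} (hm : m ≠ 0) (t : ℤ) :
    ∑ x ∈ Finset.range m, e m (t * x) = if (m : ℤ) ∣ t then (m : ℂ) else 0 := by
  split_ifs with h
  · have : ∀ x : ℕ, e m (t * x) = 1 := fun x => (e_eq_one_iff hm).2 (h.mul_right _)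
    simp [this]
  · have h1 : e m t ≠ 1 := fun h' => h ((e_eq_one_iff hm).1 h')
    have hpow : ∀ x : ℕ, e m (t * x) = e m t ^ x := by
      intro x
      induction x with
      | zero => simp [e_zero]
      | succ x ih => rw [pow_succ, ← ih, ← e_add]; congr 1; push_cast; ring
    simp only [hpow]
    have := mul_neg_geom_sum (e m t) m
    rw [← hpow, mul_comm t, e_mul_self, sub_self] at this
    exact (mul_eq_zero.1 this).resolve_left (sub_ne_zero.2 h1.symm)

theorem avg_e_mul {m : ℕ} {t : ℤ} (h : ¬ (m : ℤ) ∣ t) : avg m (fun x => e m (t * x)) = 0 := by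
  rcases eq_or_ne m 0 with rfl | hm
  · simp [avg]
  · rw [avg, sum_e_mul hm, if_neg h, smul_zero]

/-- The Fejér weight is equidistributed modulo every `q ≤ N`. -/
theorem hasSum_fejer_mul {N q : ℕ} (hq : q ≠ 0) (hqN : q ≤ N) {g : ℤ → ℝ}
    (hg : Function.Periodic g q) :
    HasSum (fun n : ℤ => fejer N n * g n) (Real.pi ^ 2 / N * avg q g) := by
  have hN : 0 < N := by omega
  have hN' : (0 : ℝ) < N := by exact_mod_cast hN
  have hq' : (0 : ℝ) < q := by positivity
  have hqC : (q : ℂ) ≠ 0 := by exact_mod_cast hq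
  -- The nonzero frequencies `k/q` keep distance at least `1/q ≥ 1/N` from the integers, so only `k
  -- = 0` survives.
  have h1 : ∀ b k : ℕ, k < q → HasSum (fun n : ℤ => (fejer N n : ℂ) * e q ((n - b) * k))
      (if k = 0 then ((Real.pi ^ 2 / N : ℝ) : ℂ) else 0) := by
    intro b k hk
    have h2 : HasSum (fun n : ℤ => (fejer N n : ℂ) *
        Complex.exp (2 * Real.pi * Complex.I * n * ((k / q : ℝ) : ℂ)))
        ((if k = 0 then Real.pi ^ 2 / N else 0 : ℝ) : ℂ) := by
      apply hasSum_fejer_mul_exp hN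
      rcases Nat.eq_zero_or_pos k with rfl | hk0
      · left; simp
      · right
        have : (q : ℝ) ≤ N := by exact_mod_cast hqN
        have h3 : 1 / (N : ℝ) ≤ 1 / q := by gcongr
        have hk1 : (1 : ℝ) ≤ k := by exact_mod_cast hk0
        have hk2 : (k : ℝ) + 1 ≤ q := by exact_mod_cast hk
        refine ⟨h3.trans (by gcongr), ?_, by simp [hk0.ne']⟩
        have : (k : ℝ) / q ≤ 1 - 1 / q := by
          rw [le_sub_iff_add_le, ← add_div, div_le_one hq']; exact hk2
        linarith
    convert! h2.mul_left (e q (-b * k)) using 1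
    · ext n
      have h6 : Complex.exp (2 * Real.pi * Complex.I * n * ((k / q : ℝ) : ℂ)) = e q (n * k) := by
        rw [e]
        congr 1
        push_cast
        ring
      rw [h6, mul_left_comm, ← e_add]
      congr 2
      ring
    · split_ifs with h
      · subst h; simp [e_zero]
      · simp
  have h3 : ∀ b : ℕ, HasSum (fun n : ℤ => (fejer N n : ℂ) * (if (q : ℤ) ∣ n - b then 1 else 0))
      ((Real.pi ^ 2 / N / q : ℝ) : ℂ) := by
    intro b
    have h4 := (hasSum_sum (s := Finset.range q) fun k hk => h1 b k (Finset.mem_range.1 hk)).mul_left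
      ((q : ℂ)⁻¹)
    convert! h4 using 1
    · ext n
      rw [← Finset.mul_sum, sum_e_mul hq]
      split_ifs
      · field_simp
      · simp
    · rw [Finset.sum_ite_eq' (Finset.range q) 0, if_pos (by simpa using hq.bot_lt)]
      push_cast
      ring
  have h5 := hasSum_sum (s := Finset.range q) fun b _ => (h3 b).mul_left ((g b : ℝ) : ℂ)
  rw [← Complex.hasSum_ofReal]
  convert! h5 using 1
  · ext n
    have hn : ((n % q).toNat : ℤ) = n % q := Int.toNat_of_nonneg (Int.emod_nonneg _ (by exact_mod_cast hq))
    have hlt : n % q < q := Int.emod_lt_of_pos _ (by positivity)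
    rw [Finset.sum_eq_single_of_mem (n % q).toNat]
    · have hd : (q : ℤ) ∣ n - (n % q).toNat := by
        rw [hn]; exact Int.dvd_self_sub_emod
      rw [if_pos hd, hn, ← periodic_eq_of_modEq hg (Int.mod_modEq n q).symm]
      push_cast
      ring
    · rw [Finset.mem_range]; omega
    · intro b hb hbn
      rw [if_neg, mul_zero, mul_zero]
      intro hd
      apply hbn
      have h6 : n % q = b % q := Int.ModEq.symm (Int.modEq_iff_dvd.2 hd)
      rw [Finset.mem_range] at hb
      rw [Int.emod_eq_of_lt (a := (b : ℤ)) (by positivity) (by exact_mod_cast hb)] at h6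
      omega
  · rw [← Finset.sum_mul]
    simp only [avg, smul_eq_mul]
    push_cast
    ring

end Markoff

/-! ### Moments of sums of multiplicative families -/

open Finset in
/-- If the nonconstant members of finitely many sequences of functions have small mean and small
mean square, then the mean values of their products are summable with a small sum. -/
theorem sum_abs_avg_prod_le {ι : Type*} [Fintype ι] [DecidableEq ι] {q κ : ℕ} (hq : q ≠ 0)
    {w : ι → ℕ → ℤ → ℝ} (h0 : ∀ i x, w i 0 x = 1) {μ lam ε : ℕ → ℝ} {Λ E : ℝ}
    (hμ : ∀ l, 0 ≤ μ l) (hlam : ∀ l, 0 ≤ lam l) (hε : ∀ l, 0 ≤ ε l)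
    (hsup : ∀ i l x, l ∈ Finset.Icc 1 κ → |w i l x| ≤ μ l)
    (hsq : ∀ i l, l ∈ Finset.Icc 1 κ → avg q (fun x => w i l x ^ 2) ≤ lam l ^ 2)
    (hmean : ∀ i l, l ∈ Finset.Icc 1 κ → |avg q (w i l)| ≤ ε l)
    (hμs : ∑ l ∈ range κ, μ (l + 1) ≤ 1) (hls : ∑ l ∈ range κ, lam (l + 1) ≤ Λ)
    (hεs : ∑ l ∈ range κ, ε (l + 1) ≤ E) :
    ∑ l ∈ Fintype.piFinset (fun _ : ι => range (κ + 1)), |avg q (fun x => ∏ i, w i (l i) x)| ≤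
      1 + Fintype.card ι * E + Fintype.card ι ^ 2 * 2 ^ Fintype.card ι * Λ ^ 2 := by
  have hΛ : 0 ≤ Λ := (sum_nonneg fun l _ => hlam _).trans hls
  -- Majorants according to the number of nonzero exponents: none (`g0`), exactly one, at `i`, using
  -- the mean (`g1`), or at least two, among them `i` and `j`, using mean squares at these and
  -- suprema elsewhere (`g2`). Each is a product over the index set, so its sum over tuples factors.
  let g0 : ι → ℕ → ℝ := fun _ l => if l = 0 then 1 else 0
  let g1 : ι → ι → ℕ → ℝ := fun i o l =>
    if o = i then (if l = 0 then 0 else ε l) else (if l = 0 then 1 else 0)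
  let g2 : ι → ι → ι → ℕ → ℝ := fun i j o l =>
    if o = i ∨ o = j then (if l = 0 then 0 else lam l) else (if l = 0 then 1 else μ l)
  have hg0 : ∀ o l, 0 ≤ g0 o l := by intro o l; simp only [g0]; split_ifs <;> simp
  have hg1 : ∀ i o l, 0 ≤ g1 i o l := by
    intro i o l; simp only [g1]; split_ifs <;> simp [hε]
  have hg2 : ∀ i j o l, 0 ≤ g2 i j o l := by
    intro i j o l; simp only [g2]; split_ifs <;> simp [hlam, hμ]
  have hpt : ∀ l ∈ Fintype.piFinset (fun _ : ι => range (κ + 1)),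
      |avg q (fun x => ∏ i, w i (l i) x)| ≤ ∏ o, g0 o (l o) + ∑ i, ∏ o, g1 i o (l o)
        + ∑ i, ∑ j ∈ univ.erase i, ∏ o, g2 i j o (l o) := by
    intro l hl
    have hlκ : ∀ i, l i ≠ 0 → l i ∈ Finset.Icc 1 κ := by
      intro i hi
      have := Fintype.mem_piFinset.1 hl i
      rw [mem_range] at this
      rw [Finset.mem_Icc]
      omega
    have p0 : 0 ≤ ∏ o, g0 o (l o) := prod_nonneg fun o _ => hg0 o _
    have p1 : ∀ i, 0 ≤ ∏ o, g1 i o (l o) := fun i => prod_nonneg fun o _ => hg1 _ _ _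
    have p2 : ∀ i j, 0 ≤ ∏ o, g2 i j o (l o) := fun i j => prod_nonneg fun o _ => hg2 _ _ _ _
    have s1 : 0 ≤ ∑ i, ∏ o, g1 i o (l o) := sum_nonneg fun i _ => p1 i
    have s2 : 0 ≤ ∑ i, ∑ j ∈ univ.erase i, ∏ o, g2 i j o (l o) :=
      sum_nonneg fun i _ => sum_nonneg fun j _ => p2 i j
    by_cases hz : ∀ i, l i = 0
    · have : ∏ o, g0 o (l o) = 1 := by simp [g0, hz]
      have h2 : avg q (fun x => ∏ i, w i (l i) x) = 1 := by
        simp only [hz, h0, prod_const_one]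
        exact avg_const hq 1
      rw [h2, this, abs_one]
      linarith
    · push Not at hz
      obtain ⟨i, hi⟩ := hz
      by_cases hz' : ∀ j, j ≠ i → l j = 0
      · have h2 : ∀ x, ∏ o, w o (l o) x = w i (l i) x := by
          intro x
          refine prod_eq_single i (fun j _ hj => ?_) (by simp)
          rw [hz' j hj, h0]
        have h3 : ∏ o, g1 i o (l o) = ε (l i) := by
          rw [prod_eq_single i (fun j _ hj => ?_) (by simp)]
          · simp [g1, hi]
          · simp [g1, hj, hz' j hj]
        have h4 : ∏ o, g1 i o (l o) ≤ ∑ i, ∏ o, g1 i o (l o) :=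
          single_le_sum (f := fun i => ∏ o, g1 i o (l o)) (fun i _ => p1 i) (mem_univ i)
        simp only [h2]
        have := hmean i (l i) (hlκ i hi)
        change |avg q (w i (l i))| ≤ _
        linarith
      · push Not at hz'
        obtain ⟨j, hji, hj⟩ := hz'
        have hjm : j ∈ univ.erase i := mem_erase.2 ⟨hji, mem_univ _⟩
        have hsplit : ∀ f : ι → ℝ, ∏ o, f o = f i * f j * ∏ o ∈ (univ.erase i).erase j, f o := by
          intro f
          rw [← mul_prod_erase univ f (mem_univ i), ← mul_prod_erase (univ.erase i) f hjm, mul_assoc]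
        set M : ℝ := ∏ o ∈ (univ.erase i).erase j, g2 i j o (l o) with hM
        have hM0 : 0 ≤ M := prod_nonneg fun o _ => hg2 _ _ _ _
        have h3 : ∏ o, g2 i j o (l o) = lam (l i) * lam (l j) * M := by
          rw [hsplit]; simp [g2, hi, hj, hM]
        have h4 : ∏ o, g2 i j o (l o) ≤ ∑ i, ∑ j ∈ univ.erase i, ∏ o, g2 i j o (l o) :=
          (single_le_sum (f := fun j => ∏ o, g2 i j o (l o)) (fun j _ => p2 i j) hjm).trans
            (single_le_sum (f := fun i => ∑ j ∈ univ.erase i, ∏ o, g2 i j o (l o))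
              (fun i _ => sum_nonneg fun j _ => p2 i j) (mem_univ i))
        have h5 : |avg q (fun x => ∏ o, w o (l o) x)| ≤
            M * avg q (fun x => |w i (l i) x| * |w j (l j) x|) := by
          refine (abs_avg_le _ _).trans ?_
          rw [← avg_mul_left]
          refine avg_mono fun x => ?_
          rw [hsplit, abs_mul, abs_mul, mul_comm M]
          refine mul_le_mul_of_nonneg_left ?_ (by positivity)
          rw [abs_prod]
          refine prod_le_prod (fun o _ => abs_nonneg _) fun o ho => ?_
          simp only [mem_erase] at ho
          simp only [g2, ho.1, ho.2.1, or_self, if_false]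
          split_ifs with h
          · rw [h, h0, abs_one]
          · exact hsup o _ x (hlκ o h)
        have h6 : avg q (fun x => |w i (l i) x| * |w j (l j) x|) ≤ lam (l i) * lam (l j) := by
          refine abs_le_of_sq_le_sq' ?_ (mul_nonneg (hlam _) (hlam _)) |>.2
          refine (avg_mul_sq_le _ _ _).trans ?_
          simp only [sq_abs]
          rw [mul_pow]
          exact mul_le_mul (hsq i _ (hlκ i hi)) (hsq j _ (hlκ j hj))
            (avg_nonneg fun x => sq_nonneg _) (sq_nonneg _)
        have h7 := mul_le_mul_of_nonneg_left h6 hM0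
        rw [mul_comm M (lam _ * lam _), ← h3] at h7
        linarith
  refine (sum_le_sum hpt).trans ?_
  have hsum : ∀ g : ι → ℕ → ℝ, ∑ l ∈ Fintype.piFinset (fun _ : ι => range (κ + 1)), ∏ o, g o (l o)
      = ∏ o, (∑ l ∈ range κ, g o (l + 1) + g o 0) := by
    intro g
    rw [← prod_univ_sum]
    simp only [sum_range_succ' _ κ]
  rw [sum_add_distrib, sum_add_distrib]
  have t0 : ∑ l ∈ Fintype.piFinset (fun _ : ι => range (κ + 1)), ∏ o, g0 o (l o) = 1 := by
    rw [hsum]; simp [g0]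
  have t1 : ∑ l ∈ Fintype.piFinset (fun _ : ι => range (κ + 1)), ∑ i, ∏ o, g1 i o (l o) ≤
      Fintype.card ι * E := by
    rw [sum_comm]
    refine (sum_le_sum (g := fun _ => E) fun i _ => ?_).trans (by simp)
    rw [hsum, prod_eq_single i (fun j _ hj => by simp [g1, hj]) (by simp)]
    simpa [g1] using hεs
  have t2 : ∑ l ∈ Fintype.piFinset (fun _ : ι => range (κ + 1)),
      ∑ i, ∑ j ∈ univ.erase i, ∏ o, g2 i j o (l o) ≤
      Fintype.card ι ^ 2 * 2 ^ Fintype.card ι * Λ ^ 2 := by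
    rw [sum_comm]
    have : ∀ i, ∑ l ∈ Fintype.piFinset (fun _ : ι => range (κ + 1)),
        ∑ j ∈ univ.erase i, ∏ o, g2 i j o (l o) ≤
        Fintype.card ι * (2 ^ Fintype.card ι * Λ ^ 2) := by
      intro i
      rw [sum_comm]
      refine (sum_le_sum (g := fun _ => 2 ^ Fintype.card ι * Λ ^ 2) fun j hj => ?_).trans ?_
      · have hji := (mem_erase.1 hj).1
        rw [hsum, ← mul_prod_erase univ _ (mem_univ i), ← mul_prod_erase (univ.erase i) _ hj]
        have e1 : ∑ l ∈ range κ, g2 i j i (l + 1) + g2 i j i 0 ≤ Λ := by simpa [g2] using hls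
        have e2 : ∑ l ∈ range κ, g2 i j j (l + 1) + g2 i j j 0 ≤ Λ := by simpa [g2] using hls
        have e3 : ∏ o ∈ (univ.erase i).erase j, (∑ l ∈ range κ, g2 i j o (l + 1) + g2 i j o 0) ≤
            2 ^ Fintype.card ι := by
          calc _ ≤ ∏ o ∈ (univ.erase i).erase j, (2 : ℝ) := by
                refine prod_le_prod (fun o _ => ?_) fun o ho => ?_
                · exact add_nonneg (sum_nonneg fun l _ => hg2 _ _ _ _) (hg2 _ _ _ _)
                · simp only [mem_erase] at ho
                  simp only [g2, ho.1, ho.2.1, or_self, if_false]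
                  simp only [Nat.add_eq_zero_iff, one_ne_zero, and_false, if_false, if_true]
                  linarith
            _ ≤ 2 ^ Fintype.card ι := by
                rw [prod_const]
                exact pow_le_pow_right₀ (by norm_num) (card_le_univ _)
        have n1 : ∀ o, 0 ≤ ∑ l ∈ range κ, g2 i j o (l + 1) + g2 i j o 0 := fun o =>
          add_nonneg (sum_nonneg fun l _ => hg2 _ _ _ _) (hg2 _ _ _ _)
        calc _ ≤ Λ * (Λ * 2 ^ Fintype.card ι) :=
              mul_le_mul e1 (mul_le_mul e2 e3 (prod_nonneg fun o _ => n1 o) hΛ)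
                (mul_nonneg (n1 j) (prod_nonneg fun o _ => n1 o)) hΛ
          _ = _ := by ring
      · rw [sum_const, nsmul_eq_mul]
        gcongr
        exact card_le_univ _
    refine (sum_le_sum fun i _ => this i).trans_eq ?_
    simp
    ring
  linarith

theorem sum_pow_succ_le {β : ℝ} (h0 : 0 ≤ β) (h1 : β ≤ 1 / 2) (κ : ℕ) :
    ∑ l ∈ Finset.range κ, β ^ (l + 1) ≤ 2 * β := by
  have h2 : ∑ l ∈ Finset.range κ, β ^ l ≤ 2 := by
    have h3 := Summable.sum_le_tsum (Finset.range κ) (fun l _ => pow_nonneg h0 l)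
      (summable_geometric_of_lt_one h0 (by linarith))
    rw [tsum_geometric_of_lt_one h0 (by linarith)] at h3
    refine h3.trans ?_
    rw [inv_le_comm₀ (by linarith) two_pos]
    linarith
  calc _ = β * ∑ l ∈ Finset.range κ, β ^ l := by
        rw [Finset.mul_sum]; exact Finset.sum_congr rfl fun l _ => by ring
    _ ≤ β * 2 := by gcongr
    _ = _ := by ring

/-! ### Tame families and Euler products for their joint moments -/

/-- A family of multiplicative functions, periodic in the parameter, whose values at prime powers
have nearly square-root size, small mean square and small mean. -/
structure TameFamily (P₀ : ℕ) (C D : ℝ) (f : ℤ → ArithmeticFunction ℝ) : Prop where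
  mult : ∀ a, (f a).IsMultiplicative
  per : ∀ p k : ℕ, p.Prime → Function.Periodic (fun a => f a (p ^ k)) (p ^ k : ℕ)
  sup_small : ∀ p l : ℕ, p.Prime → p < P₀ → 1 ≤ l → ∀ a, |f a (p ^ l)| ≤ C * (1 / √p) ^ l
  sup : ∀ p l : ℕ, p.Prime → P₀ ≤ p → 1 ≤ l → ∀ a, |f a (p ^ l)| ≤ (D / √p) ^ l
  sq : ∀ p l : ℕ, p.Prime → P₀ ≤ p → 1 ≤ l →
    avg (p ^ l) (fun a => f a (p ^ l) ^ 2) ≤ ((D / √p) ^ l) ^ 2 / p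
  mean : ∀ p l : ℕ, p.Prime → P₀ ≤ p → 1 ≤ l →
    |avg (p ^ l) (fun a => f a (p ^ l))| ≤ (D / √p) ^ l / p

section

variable {ι : Type*} [Fintype ι] [DecidableEq ι] {P₀ : ℕ} {C D : ℝ}
  {F : ι → ℤ → ArithmeticFunction ℝ}

/-- Apply `sum_abs_avg_prod_le` with supremum `β^l`, root mean square `β^l/√p` and mean `β^l/p`.
Both kinds of nontrivial terms then cost `O(β/p)`, which is summable over primes once `β` is a
constant times `p^(-δ)`. -/
theorem TameFamily.local_sum_le_large (hD : 0 ≤ D) (hF : ∀ i, TameFamily P₀ C D (F i)) {p K : ℕ}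
    (hp : p.Prime) (hpP : P₀ ≤ p) {θ : ℝ} (hβ : D / √p * (p : ℝ) ^ θ ≤ 1 / 2) :
    ∑ l ∈ Fintype.piFinset (fun _ : ι => Finset.range (K + 1)),
      |avg (p ^ K) (fun a => ∏ i, (((p ^ l i : ℕ) : ℝ) ^ θ * F i a (p ^ l i)))| ≤
      1 + (2 * Fintype.card ι + 4 * (Fintype.card ι ^ 2 * 2 ^ Fintype.card ι)) *
        (D / √p * (p : ℝ) ^ θ / p) := by
  set β : ℝ := D / √p * (p : ℝ) ^ θ with hβdef
  have hp0 : (0 : ℝ) < p := by exact_mod_cast hp.pos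
  have hβ0 : 0 ≤ β := by positivity
  have hpow : ∀ l : ℕ, ((p ^ l : ℕ) : ℝ) ^ θ = ((p : ℝ) ^ θ) ^ l := fun l => by
    push_cast
    rw [← Real.rpow_natCast, ← Real.rpow_mul hp0.le, mul_comm, Real.rpow_mul hp0.le,
      Real.rpow_natCast]
  have hpK : p ^ K ≠ 0 := pow_ne_zero _ hp.ne_zero
  have hdvd : ∀ l ∈ Finset.Icc 1 K, p ^ l ∣ p ^ K := fun l hl =>
    pow_dvd_pow _ (Finset.mem_Icc.1 hl).2
  have hβl : ∀ l : ℕ, β ^ l = ((p : ℝ) ^ θ) ^ l * (D / √p) ^ l := fun l => by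
    rw [hβdef, mul_pow, mul_comm]
  have main := sum_abs_avg_prod_le (ι := ι) (q := p ^ K) (κ := K) hpK
    (w := fun i l a => ((p ^ l : ℕ) : ℝ) ^ θ * F i a (p ^ l))
    (μ := fun l => β ^ l) (lam := fun l => β ^ l / √p) (ε := fun l => β ^ l / p)
    (Λ := 2 * β / √p) (E := 2 * β / p)
    (fun i x => by simp [(hF i).mult x |>.map_one]) (fun l => by positivity)
    (fun l => by positivity) (fun l => by positivity) ?_ ?_ ?_ ?_ ?_ ?_
  · refine main.trans ?_
    rw [div_pow, Real.sq_sqrt hp0.le, add_assoc]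
    gcongr
    have : (2 * β) ^ 2 / p ≤ 4 * (β / p) := by
      rw [mul_pow, ← mul_div_assoc]
      gcongr
      · norm_num
      · nlinarith [mul_le_mul_of_nonneg_left hβ hβ0]
    calc _ ≤ Fintype.card ι * (2 * β / p) +
          Fintype.card ι ^ 2 * 2 ^ Fintype.card ι * (4 * (β / p)) := by gcongr
      _ = _ := by ring
  · intro i l a hl
    rw [abs_mul, hpow, abs_of_nonneg (by positivity), hβl]
    gcongr
    exact (hF i).sup p l hp hpP (Finset.mem_Icc.1 hl).1 a
  · intro i l hl
    simp only [mul_pow]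
    rw [avg_mul_left, avg_of_dvd (q := p ^ l) _ hpK (hdvd l hl)]
    · rw [hpow, div_pow, Real.sq_sqrt hp0.le, hβl, mul_pow, mul_div_assoc]
      gcongr
      exact (hF i).sq p l hp hpP (Finset.mem_Icc.1 hl).1
    · intro a
      exact congrArg (· ^ 2) ((hF i).per p l hp a)
  · intro i l hl
    rw [avg_mul_left, avg_of_dvd (q := p ^ l) _ hpK (hdvd l hl)]
    · rw [hpow, abs_mul, abs_of_nonneg (by positivity), hβl, mul_div_assoc]
      gcongr
      exact (hF i).mean p l hp hpP (Finset.mem_Icc.1 hl).1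
    · exact (hF i).per p l hp
  · exact (sum_pow_succ_le hβ0 hβ K).trans (by linarith)
  · rw [← Finset.sum_div]
    gcongr
    exact sum_pow_succ_le hβ0 hβ K
  · rw [← Finset.sum_div]
    gcongr
    exact sum_pow_succ_le hβ0 hβ K

/-- Only finitely many primes are small, so a bound independent of `K` suffices; the supremum bound
and a geometric series give it. -/
theorem TameFamily.local_sum_le_small (hC : 0 ≤ C) (hF : ∀ i, TameFamily P₀ C D (F i)) {p K : ℕ}
    (hp : p.Prime) (hpP : p < P₀) {θ β : ℝ} (hβ : 1 / √p * (p : ℝ) ^ θ ≤ β) (hβ1 : β < 1) :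
    ∑ l ∈ Fintype.piFinset (fun _ : ι => Finset.range (K + 1)),
      |avg (p ^ K) (fun a => ∏ i, (((p ^ l i : ℕ) : ℝ) ^ θ * F i a (p ^ l i)))| ≤
      (1 + C / (1 - β)) ^ Fintype.card ι := by
  have hp0 : (0 : ℝ) < p := by exact_mod_cast hp.pos
  have hβ0 : 0 ≤ β := le_trans (by positivity) hβ
  have hpow : ∀ l : ℕ, ((p ^ l : ℕ) : ℝ) ^ θ = ((p : ℝ) ^ θ) ^ l := fun l => by
    push_cast
    rw [← Real.rpow_natCast, ← Real.rpow_mul hp0.le, mul_comm, Real.rpow_mul hp0.le,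
      Real.rpow_natCast]
  let g : ℕ → ℝ := fun l => if l = 0 then 1 else C * β ^ l
  have hg : ∀ l, 0 ≤ g l := fun l => by simp only [g]; split_ifs <;> positivity
  have hpt : ∀ l ∈ Fintype.piFinset (fun _ : ι => Finset.range (K + 1)),
      |avg (p ^ K) (fun a => ∏ i, (((p ^ l i : ℕ) : ℝ) ^ θ * F i a (p ^ l i)))| ≤ ∏ i, g (l i) := by
    intro l _
    rw [← Real.norm_eq_abs]
    refine norm_avg_le (Finset.prod_nonneg fun i _ => hg _) fun a => ?_
    rw [Real.norm_eq_abs, Finset.abs_prod]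
    refine Finset.prod_le_prod (fun i _ => abs_nonneg _) fun i _ => ?_
    simp only [g]
    split_ifs with h
    · simp [h, ((hF i).mult a).map_one]
    · rw [hpow, abs_mul, abs_of_nonneg (by positivity)]
      calc _ ≤ ((p : ℝ) ^ θ) ^ l i * (C * (1 / √p) ^ l i) := by
            gcongr
            exact (hF i).sup_small p _ hp hpP (Nat.pos_of_ne_zero h) a
        _ = C * (1 / √p * (p : ℝ) ^ θ) ^ l i := by rw [mul_pow]; ring
        _ ≤ _ := by gcongr
  refine (Finset.sum_le_sum hpt).trans ?_
  rw [← Finset.prod_univ_sum (fun _ => Finset.range (K + 1)) (fun _ l => g l)]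
  rw [Finset.prod_const, Finset.card_univ]
  refine pow_le_pow_left₀ (Finset.sum_nonneg fun l _ => hg l) ?_ _
  rw [Finset.sum_range_succ', add_comm]
  have h1 := Summable.sum_le_tsum (Finset.range K) (fun l _ => pow_nonneg hβ0 l)
    (summable_geometric_of_lt_one hβ0 hβ1)
  rw [tsum_geometric_of_lt_one hβ0 hβ1] at h1
  have h2 : ∑ l ∈ Finset.range K, g (l + 1) ≤ C * ∑ l ∈ Finset.range K, β ^ l := by
    rw [Finset.mul_sum]
    refine Finset.sum_le_sum fun l _ => ?_
    simp only [g, Nat.add_eq_zero_iff, one_ne_zero, and_false, if_false]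
    refine mul_le_mul_of_nonneg_left ?_ hC
    rw [pow_succ]
    exact mul_le_of_le_one_right (by positivity) hβ1.le
  have h3 : C * ∑ l ∈ Finset.range K, β ^ l ≤ C * (1 - β)⁻¹ := by gcongr
  simp only [g, if_true]
  rw [div_eq_mul_inv]
  linarith

end


/-- A sum over tuples of a function of the exponent vectors of the entries is at most the
corresponding product over primes. -/
theorem sum_le_prod_primesBelow {ι : Type*} [Fintype ι] [DecidableEq ι] (K : ℕ)
    (g : ℕ → (ι → ℕ) → ℝ) (hg : ∀ p l, 0 ≤ g p l) :
    ∑ m ∈ Fintype.piFinset (fun _ : ι => Finset.Icc 1 K),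
      ∏ p ∈ (K + 1).primesBelow, g p (fun i => (m i).factorization p) ≤
    ∏ p ∈ (K + 1).primesBelow,
      ∑ l ∈ Fintype.piFinset (fun _ : ι => Finset.range (K + 1)), g p l := by
  classical
  rw [Finset.prod_sum]
  -- Unique factorization makes `φ` injective, so the left side is a partial sum of the expanded
  -- product, whose terms are nonnegative.
  let φ : (ι → ℕ) → (∀ p ∈ (K + 1).primesBelow, ι → ℕ) := fun m p _ i => (m i).factorization p
  have hφ : ∀ m : ι → ℕ, ∏ p ∈ (K + 1).primesBelow, g p (fun i => (m i).factorization p) =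
      ∏ p ∈ (K + 1).primesBelow.attach, g p.1 (φ m p.1 p.2) := by
    intro m
    rw [← Finset.prod_attach]
  simp only [hφ]
  have hinj : Set.InjOn φ (Fintype.piFinset (fun _ : ι => Finset.Icc 1 K)) := by
    intro m hm n hn h
    ext i
    have hmi := Finset.mem_Icc.1 (Fintype.mem_piFinset.1 hm i)
    have hni := Finset.mem_Icc.1 (Fintype.mem_piFinset.1 hn i)
    refine Nat.eq_of_factorization_eq (by omega) (by omega) fun p => ?_
    by_cases hp : p ∈ (K + 1).primesBelow
    · exact congrFun (congrFun (congrFun h p) hp) i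
    · have : ∀ n, 1 ≤ n → n ≤ K → n.factorization p = 0 := by
        intro n h1 h2
        by_cases hpp : p.Prime
        · refine Nat.factorization_eq_zero_of_lt ?_
          by_contra hlt
          exact hp (Nat.mem_primesBelow.2 ⟨by omega, hpp⟩)
        · exact Nat.factorization_eq_zero_of_not_prime _ hpp
      rw [this _ hmi.1 hmi.2, this _ hni.1 hni.2]
  rw [← Finset.sum_image (f := fun h => ∏ p ∈ (K + 1).primesBelow.attach, g p.1 (h p.1 p.2)) hinj]
  refine Finset.sum_le_sum_of_subset_of_nonneg ?_ fun h _ _ => Finset.prod_nonneg fun p _ => hg _ _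
  intro h hh
  obtain ⟨m, hm, rfl⟩ := Finset.mem_image.1 hh
  refine Finset.mem_pi.2 fun p hp => Fintype.mem_piFinset.2 fun i => ?_
  have hmi := Finset.mem_Icc.1 (Fintype.mem_piFinset.1 hm i)
  rw [Finset.mem_range]
  have := Nat.factorization_lt (n := m i) p (by omega)
  simp only [φ]
  omega

theorem ArithmeticFunction.IsMultiplicative.eq_prod_primesBelow {f : ArithmeticFunction ℝ}
    (hf : f.IsMultiplicative) {m K : ℕ} (hm : 1 ≤ m) (hmK : m ≤ K) :
    f m = ∏ p ∈ (K + 1).primesBelow, f (p ^ m.factorization p) := by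
  rw [hf.multiplicative_factorization f (by omega)]
  rw [Finsupp.prod_of_support_subset]
  · intro p hp
    rw [Nat.support_factorization, Nat.mem_primeFactors] at hp
    exact Nat.mem_primesBelow.2 ⟨by have := Nat.le_of_dvd (by omega) hp.2.1; omega, hp.1⟩
  · intro p _
    simp [hf.map_one]

theorem prod_primesBelow_pow_factorization {m K : ℕ} (hm : 1 ≤ m) (hmK : m ≤ K) :
    m = ∏ p ∈ (K + 1).primesBelow, p ^ m.factorization p := by
  conv_lhs => rw [← Nat.prod_factorization_pow_eq_self (n := m) (by omega)]
  rw [Finsupp.prod_of_support_subset]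
  · intro p hp
    rw [Nat.support_factorization, Nat.mem_primeFactors] at hp
    exact Nat.mem_primesBelow.2 ⟨by have := Nat.le_of_dvd (by omega) hp.2.1; omega, hp.1⟩
  · intro p _
    simp

section

variable {ι : Type*} [Fintype ι] [DecidableEq ι] {P₀ : ℕ} {C D : ℝ}
  {F : ι → ℤ → ArithmeticFunction ℝ}

theorem TameFamily.periodic {f : ℤ → ArithmeticFunction ℝ} (hf : TameFamily P₀ C D f) {m : ℕ}
    (hm : 1 ≤ m) : Function.Periodic (fun a => f a m) m := by
  intro a
  simp only
  rw [(hf.mult _).eq_prod_primesBelow hm le_rfl, (hf.mult _).eq_prod_primesBelow hm le_rfl]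
  refine Finset.prod_congr rfl fun p hp => ?_
  exact periodic_of_dvd (hf.per p (m.factorization p) (Nat.prime_of_mem_primesBelow hp))
    (Nat.ordProj_dvd m p) a

/-- The common period of all tuples with entries at most `K`. -/
def commonPeriod (K : ℕ) : ℕ := ∏ p ∈ (K + 1).primesBelow, p ^ K

theorem commonPeriod_ne_zero (K : ℕ) : commonPeriod K ≠ 0 :=
  Finset.prod_ne_zero_iff.2 fun _ hp => pow_ne_zero _ (Nat.prime_of_mem_primesBelow hp).ne_zero

/-- By the Chinese remainder theorem the residues of `a` modulo powers of distinct primes are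
independent. -/
theorem TameFamily.avg_prod_eq (hF : ∀ i, TameFamily P₀ C D (F i)) {K : ℕ} {θ : ℝ} {m : ι → ℕ}
    (hm : ∀ i, 1 ≤ m i ∧ m i ≤ K) :
    avg (commonPeriod K) (fun a => ∏ i, ((m i : ℝ) ^ θ * F i a (m i))) =
      ∏ p ∈ (K + 1).primesBelow, avg (p ^ K) (fun a => ∏ i,
        (((p ^ (m i).factorization p : ℕ) : ℝ) ^ θ * F i a (p ^ (m i).factorization p))) := by
  rw [commonPeriod, ← avg_prod_of_coprime]
  · refine avg_congr fun a => ?_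
    rw [Finset.prod_comm]
    refine Finset.prod_congr rfl fun i _ => ?_
    rw [Finset.prod_mul_distrib, ((hF i).mult a).eq_prod_primesBelow (hm i).1 (hm i).2]
    congr 1
    rw [Real.finsetProd_rpow _ _ (fun p _ => by positivity)]
    congr 1
    exact_mod_cast prod_primesBelow_pow_factorization (hm i).1 (hm i).2
  · intro p hp r hr hpr
    exact Nat.coprime_pow_primes _ _ (Nat.prime_of_mem_primesBelow hp)
      (Nat.prime_of_mem_primesBelow hr) hpr
  · intro p hp a
    refine Finset.prod_congr rfl fun i _ => ?_
    congr 1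
    refine periodic_of_dvd ((hF i).per p _ (Nat.prime_of_mem_primesBelow hp)) ?_ a
    refine pow_dvd_pow _ ?_
    have h1 := hm i
    have := Nat.factorization_lt (n := m i) p (by omega)
    omega

/-- The Euler product bound for weighted joint moments of tame families. -/
theorem TameFamily.exists_sum_le (hC : 0 ≤ C) (hD : 0 ≤ D)
    (hF : ∀ i, TameFamily P₀ C D (F i)) {δ : ℝ} (hδ : 0 < δ)
    (hP : ∀ p : ℕ, p.Prime → P₀ ≤ p → D / √p * (p : ℝ) ^ (1 / 2 - δ) ≤ 1 / 2) :
    ∃ B : ℝ, 0 < B ∧ ∀ K : ℕ, ∑ m ∈ Fintype.piFinset (fun _ : ι => Finset.Icc 1 K),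
      |avg (commonPeriod K) (fun a => ∏ i, ((m i : ℝ) ^ (1 / 2 - δ) * F i a (m i)))| ≤ B := by
  set θ : ℝ := 1 / 2 - δ with hθ
  have hsplit : ∀ p : ℕ, p.Prime → 1 / √p * (p : ℝ) ^ θ = (p : ℝ) ^ (-δ) := by
    intro p hp
    have hp0 : (0 : ℝ) < p := by exact_mod_cast hp.pos
    rw [Real.sqrt_eq_rpow, one_div, ← Real.rpow_neg hp0.le, ← Real.rpow_add hp0]
    congr 1
    rw [hθ]; ring
  set β : ℝ := (2 : ℝ) ^ (-δ) with hβ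
  have hβ1 : β < 1 := Real.rpow_lt_one_of_one_lt_of_neg (by norm_num) (by linarith)
  have hβ0 : 0 < β := by positivity
  set G : ℝ := (1 + C / (1 - β)) ^ Fintype.card ι with hG
  have hG1 : 1 ≤ G := by
    apply one_le_pow₀
    have : 0 ≤ C / (1 - β) := div_nonneg hC (by linarith)
    linarith
  set H : ℝ := (2 * Fintype.card ι + 4 * (Fintype.card ι ^ 2 * 2 ^ Fintype.card ι)) * D with hH
  have hH0 : 0 ≤ H := by positivity
  have hsummable : Summable (fun n : ℕ => 1 / (n : ℝ) ^ (1 + δ)) :=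
    Real.summable_one_div_nat_rpow.2 (by linarith)
  -- At most `P₀` small primes contribute a factor `G` each; the large ones contribute `∏ (1 + H
  -- p^(-1-δ))`, bounded by an exponential.
  refine ⟨G ^ P₀ * Real.exp (H * ∑' n : ℕ, 1 / (n : ℝ) ^ (1 + δ)), by positivity, fun K => ?_⟩
  let g : ℕ → (ι → ℕ) → ℝ := fun p l =>
    |avg (p ^ K) (fun a => ∏ i, (((p ^ l i : ℕ) : ℝ) ^ θ * F i a (p ^ l i)))|
  have h1 : ∑ m ∈ Fintype.piFinset (fun _ : ι => Finset.Icc 1 K),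
      |avg (commonPeriod K) (fun a => ∏ i, ((m i : ℝ) ^ θ * F i a (m i)))| =
      ∑ m ∈ Fintype.piFinset (fun _ : ι => Finset.Icc 1 K),
      ∏ p ∈ (K + 1).primesBelow, g p (fun i => (m i).factorization p) := by
    refine Finset.sum_congr rfl fun m hm => ?_
    rw [TameFamily.avg_prod_eq hF fun i => Finset.mem_Icc.1 (Fintype.mem_piFinset.1 hm i),
      Finset.abs_prod]
  rw [h1]
  refine (sum_le_prod_primesBelow K g fun p l => abs_nonneg _).trans ?_
  have h2 : ∀ p ∈ (K + 1).primesBelow,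
      ∑ l ∈ Fintype.piFinset (fun _ : ι => Finset.range (K + 1)), g p l ≤
      (if p < P₀ then G else 1) * Real.exp (H * (1 / (p : ℝ) ^ (1 + δ))) := by
    intro p hp
    have hpp := Nat.prime_of_mem_primesBelow hp
    have hp0 : (0 : ℝ) < p := by exact_mod_cast hpp.pos
    split_ifs with hlt
    · refine (TameFamily.local_sum_le_small hC hF hpp hlt (θ := θ) (β := β) ?_ hβ1).trans ?_
      · rw [hsplit p hpp]
        exact Real.rpow_le_rpow_of_nonpos (by norm_num) (by exact_mod_cast hpp.two_le) (by linarith)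
      · exact le_mul_of_one_le_right (by positivity) (Real.one_le_exp (by positivity))
    · refine (TameFamily.local_sum_le_large hD hF hpp (not_lt.1 hlt) (θ := θ)
        (hP p hpp (not_lt.1 hlt))).trans ?_
      rw [one_mul]
      refine le_trans (le_of_eq ?_) ((add_comm _ _).trans_le (Real.add_one_le_exp _))
      have h4 : (p : ℝ) ^ (-δ) / p = 1 / (p : ℝ) ^ (1 + δ) := by
        rw [Real.rpow_add hp0, Real.rpow_one, Real.rpow_neg hp0.le]
        field_simp
      rw [← h4, ← hsplit p hpp, hH]
      ring
  refine (Finset.prod_le_prod (fun p _ => Finset.sum_nonneg fun l _ => abs_nonneg _) h2).trans ?_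
  rw [Finset.prod_mul_distrib, ← Real.exp_sum, ← Finset.mul_sum]
  gcongr
  · rw [Finset.prod_ite, Finset.prod_const_one, mul_one, Finset.prod_const]
    refine pow_le_pow_right₀ hG1 ?_
    calc _ ≤ (Finset.range P₀).card := Finset.card_le_card fun p hp => by
          rw [Finset.mem_filter] at hp
          exact Finset.mem_range.2 hp.2
      _ = P₀ := Finset.card_range _
  · exact hsummable.sum_le_tsum _ (fun p _ => by positivity)

end

/-! ### From means over a full period to sums over an interval -/

/-- Moments of sums of products of members of two tame families, over all `|a| ≤ A`. -/
theorem TameFamily.exists_moment_le {P₀ : ℕ} {C D : ℝ} {c r : ℤ → ArithmeticFunction ℝ}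
    (hC : 0 ≤ C) (hD : 0 ≤ D) (hc : TameFamily P₀ C D c) (hr : TameFamily P₀ C D r)
    {δ : ℝ} (hδ : 0 < δ) (hδ' : δ ≤ 1 / 2)
    (hP : ∀ p : ℕ, p.Prime → P₀ ≤ p → D / √p * (p : ℝ) ^ (1 / 2 - δ) ≤ 1 / 2)
    {k : ℕ} (hk : Even k) :
    ∃ B : ℝ, 0 < B ∧ ∀ (A K : ℕ) (L : ℝ) (R : Finset (ℕ × ℕ)), 1 ≤ A → 0 < L →
      (∀ x ∈ R, x.1 ∈ Finset.Icc 1 K ∧ x.2 ∈ Finset.Icc 1 K ∧ L ≤ x.1 * x.2 ∧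
        (x.1 * x.2) ^ k ≤ A) →
      ∑ a ∈ Finset.Icc (-(A : ℤ)) A, (∑ x ∈ R, c a x.1 * r a x.2) ^ k ≤
        B * A * (L ^ (1 / 2 - δ))⁻¹ ^ k := by
  set θ : ℝ := 1 / 2 - δ with hθ
  have hθ0 : 0 ≤ θ := by linarith
  -- Expanding the `k`-th power produces `k` factors from each family, treated as one family of `2k`
  -- members.
  let F : Fin k ⊕ Fin k → ℤ → ArithmeticFunction ℝ := Sum.elim (fun _ => c) (fun _ => r)
  have hF : ∀ i, TameFamily P₀ C D (F i) := by
    rintro (i | i)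
    · exact hc
    · exact hr
  obtain ⟨B, hB0, hB⟩ := TameFamily.exists_sum_le hC hD hF hδ hP
  refine ⟨2 * Real.pi ^ 2 * B, by positivity, fun A K L R hA hL hR => ?_⟩
  have hA' : (0 : ℝ) < A := by exact_mod_cast hA
  set T := Fintype.piFinset (fun _ : Fin k => R) with hT
  have hexp : ∀ a, (∑ x ∈ R, c a x.1 * r a x.2) ^ k = ∑ y ∈ T, ∏ i, (c a (y i).1 * r a (y i).2) := by
    intro a
    rw [← Fin.prod_const, Finset.prod_univ_sum]
  have hmem : ∀ y ∈ T, ∀ i, y i ∈ R := fun y hy i => Fintype.mem_piFinset.1 hy i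
  let m : (Fin k → ℕ × ℕ) → Fin k ⊕ Fin k → ℕ := fun y =>
    Sum.elim (fun i => (y i).1) (fun i => (y i).2)
  have hm : ∀ y ∈ T, ∀ i, 1 ≤ m y i ∧ m y i ≤ K := by
    rintro y hy (i | i)
    · exact Finset.mem_Icc.1 (hR _ (hmem y hy i)).1
    · exact Finset.mem_Icc.1 (hR _ (hmem y hy i)).2.1
  have hprod : ∀ y a, ∏ i, (c a (y i).1 * r a (y i).2) = ∏ i, F i a (m y i) := by
    intro y a
    rw [Fintype.prod_sum_type, ← Finset.prod_mul_distrib]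
    rfl
  let q : (Fin k → ℕ × ℕ) → ℕ := fun y => ∏ i, m y i
  -- The product `q y` of all entries is a period of the term `y`. It splits into `k` pair products,
  -- each with `k`-th power at most `A`, whence `q y ≤ A`; this is what the Fejér weight requires.
  have hq0 : ∀ y ∈ T, q y ≠ 0 := fun y hy =>
    Finset.prod_ne_zero_iff.2 fun i _ => by have := (hm y hy i).1; omega
  have hqA : ∀ y ∈ T, q y ≤ A := by
    intro y hy
    have h1 : q y = ∏ i, ((y i).1 * (y i).2) := by
      simp only [q]
      rw [Fintype.prod_sum_type, ← Finset.prod_mul_distrib]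
      rfl
    rcases Nat.eq_zero_or_pos k with rfl | hk0
    · rw [h1]; simpa using hA
    rw [h1]
    refine (Nat.pow_le_pow_iff_left hk0.ne').1 ?_
    rw [← Finset.prod_pow]
    calc _ ≤ ∏ _i : Fin k, A := Finset.prod_le_prod' fun i _ => (hR _ (hmem y hy i)).2.2.2
      _ = A ^ k := by simp
  have hper : ∀ y ∈ T, ∀ i, Function.Periodic (fun a => F i a (m y i)) (m y i) :=
    fun y hy i => (hF i).periodic (hm y hy i).1
  have hperq : ∀ y ∈ T, Function.Periodic (fun a => ∏ i, F i a (m y i)) (q y) := by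
    intro y hy a
    refine Finset.prod_congr rfl fun i _ => ?_
    exact periodic_of_dvd (hper y hy i) (Finset.dvd_prod_of_mem _ (Finset.mem_univ i)) a
  have hperW : ∀ y ∈ T, Function.Periodic (fun a => ∏ i, F i a (m y i)) (commonPeriod K) := by
    intro y hy a
    refine Finset.prod_congr rfl fun i _ => ?_
    refine periodic_of_dvd (hper y hy i) ?_ a
    rw [prod_primesBelow_pow_factorization (hm y hy i).1 (hm y hy i).2]
    refine Finset.prod_dvd_prod_of_dvd _ _ fun p _ => pow_dvd_pow _ ?_
    have h1 := hm y hy i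
    have := Nat.factorization_lt (n := m y i) p (by omega)
    omega
  -- The period `q y` is short enough for the Fejér weight; `commonPeriod K` is the one over which
  -- the Euler product bound is stated.
  have havg : ∀ y ∈ T, avg (q y) (fun a => ∏ i, F i a (m y i)) =
      avg (commonPeriod K) (fun a => ∏ i, F i a (m y i)) := by
    intro y hy
    rw [← avg_of_dvd (hperq y hy) (mul_ne_zero (hq0 y hy) (commonPeriod_ne_zero K)) ⟨_, rfl⟩,
      ← avg_of_dvd (hperW y hy) (mul_ne_zero (hq0 y hy) (commonPeriod_ne_zero K)) ⟨_, mul_comm _ _⟩]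
  have hsum : HasSum (fun a : ℤ => fejer (2 * A) a * (∑ x ∈ R, c a x.1 * r a x.2) ^ k)
      (∑ y ∈ T, Real.pi ^ 2 / (2 * A : ℕ) *
        avg (commonPeriod K) (fun a => ∏ i, F i a (m y i))) := by
    have h1 : HasSum (fun a : ℤ => ∑ y ∈ T, fejer (2 * A) a * ∏ i, F i a (m y i))
        (∑ y ∈ T, Real.pi ^ 2 / (2 * A : ℕ) *
          avg (commonPeriod K) (fun a => ∏ i, F i a (m y i))) := by
      refine hasSum_sum fun y hy => ?_
      rw [← havg y hy]
      exact Markoff.hasSum_fejer_mul (hq0 y hy) ((hqA y hy).trans (by omega)) (hperq y hy)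
    refine h1.congr_fun fun a => ?_
    rw [hexp, Finset.mul_sum]
    exact Finset.sum_congr rfl fun y _ => by rw [hprod]
  have hnn : ∀ a : ℤ, 0 ≤ (∑ x ∈ R, c a x.1 * r a x.2) ^ k := fun a => hk.pow_nonneg _
  have h2 : ∑ a ∈ Finset.Icc (-(A : ℤ)) A, fejer (2 * A) a * (∑ x ∈ R, c a x.1 * r a x.2) ^ k ≤
      ∑ y ∈ T, Real.pi ^ 2 / (2 * A : ℕ) * avg (commonPeriod K) (fun a => ∏ i, F i a (m y i)) :=
    sum_le_hasSum _ (fun a _ => mul_nonneg (fejer_nonneg _ _) (hnn a)) hsum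
  have h3 : 1 / (A : ℝ) ^ 2 * ∑ a ∈ Finset.Icc (-(A : ℤ)) A, (∑ x ∈ R, c a x.1 * r a x.2) ^ k ≤
      ∑ a ∈ Finset.Icc (-(A : ℤ)) A, fejer (2 * A) a * (∑ x ∈ R, c a x.1 * r a x.2) ^ k := by
    rw [Finset.mul_sum]
    refine Finset.sum_le_sum fun a ha => mul_le_mul_of_nonneg_right ?_ (hnn a)
    have h4 : |a| ≤ A := abs_le.2 (Finset.mem_Icc.1 ha)
    refine le_trans (le_of_eq ?_) (le_fejer (N := 2 * A) (by omega) (n := a) (by push_cast; omega))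
    push_cast
    field_simp
    norm_num
  have h5 : ∑ y ∈ T, avg (commonPeriod K) (fun a => ∏ i, F i a (m y i)) ≤
      (L ^ θ)⁻¹ ^ k * B := by
    have hLθ : 0 < L ^ θ := by positivity
    -- Rankin's trick: the inserted weights multiply to at least `(L^θ)^k`.
    have h6 : ∀ y ∈ T, avg (commonPeriod K) (fun a => ∏ i, F i a (m y i)) ≤ (L ^ θ)⁻¹ ^ k *
        |avg (commonPeriod K) (fun a => ∏ i, ((m y i : ℝ) ^ θ * F i a (m y i)))| := by
      intro y hy
      simp only [Finset.prod_mul_distrib]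
      rw [avg_mul_left, abs_mul, ← mul_assoc]
      refine (le_abs_self _).trans (le_mul_of_one_le_left (abs_nonneg _) ?_)
      rw [abs_of_nonneg (Finset.prod_nonneg fun i _ => by positivity), Fintype.prod_sum_type,
        ← Finset.prod_mul_distrib, inv_pow, le_inv_mul_iff₀ (by positivity), mul_one,
        ← Fin.prod_const]
      refine Finset.prod_le_prod (fun i _ => hLθ.le) fun i _ => ?_
      simp only [m, Sum.elim_inl, Sum.elim_inr]
      rw [← Real.mul_rpow (by positivity) (by positivity)]
      exact Real.rpow_le_rpow hL.le (hR _ (hmem y hy i)).2.2.1 hθ0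
    refine (Finset.sum_le_sum h6).trans ?_
    rw [← Finset.mul_sum]
    refine mul_le_mul_of_nonneg_left ?_ (by positivity)
    refine le_trans ?_ (hB K)
    have hinj : Set.InjOn m T := by
      intro y _ z _ h
      ext i
      · exact congrFun h (Sum.inl i)
      · exact congrFun h (Sum.inr i)
    rw [← Finset.sum_image (f := fun n =>
      |avg (commonPeriod K) (fun a => ∏ i, ((n i : ℝ) ^ θ * F i a (n i)))|) hinj]
    refine Finset.sum_le_sum_of_subset_of_nonneg ?_ fun _ _ _ => abs_nonneg _
    intro n hn
    obtain ⟨y, hy, rfl⟩ := Finset.mem_image.1 hn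
    exact Fintype.mem_piFinset.2 fun i => Finset.mem_Icc.2 (hm y hy i)
  have h6 := h3.trans h2
  rw [← Finset.mul_sum, div_mul_eq_mul_div, one_mul, div_le_iff₀ (by positivity)] at h6
  refine h6.trans ?_
  have h7 : Real.pi ^ 2 / (2 * A : ℕ) * (∑ y ∈ T, avg (commonPeriod K) (fun a => ∏ i, F i a (m y i)))
      * (A : ℝ) ^ 2 ≤ Real.pi ^ 2 / (2 * A : ℕ) * ((L ^ θ)⁻¹ ^ k * B) * (A : ℝ) ^ 2 := by gcongr
  refine h7.trans ?_
  have h8 : Real.pi ^ 2 / (2 * A : ℕ) * ((L ^ θ)⁻¹ ^ k * B) * (A : ℝ) ^ 2 =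
      1 / 2 * (Real.pi ^ 2 * B * A * (L ^ θ)⁻¹ ^ k) := by
    push_cast
    field_simp
  have h9 : 0 ≤ Real.pi ^ 2 * B * A * (L ^ θ)⁻¹ ^ k := by positivity
  rw [h8]
  linarith

/-! ### Triple means -/

section avgThree

variable {E : Type*} [NormedAddCommGroup E] [NormedSpace ℝ E]

theorem avg_comm (m n : ℕ) (f : ℤ → ℤ → E) :
    avg m (fun x => avg n (fun y => f x y)) = avg n (fun y => avg m (fun x => f x y)) := by
  simp only [avg, Finset.smul_sum]
  rw [Finset.sum_comm]
  simp only [smul_smul, mul_comm]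

/-- The mean value over the cube `{0, …, N - 1}³`. -/
noncomputable def avgThree (N : ℕ) (f : ℤ → ℤ → ℤ → E) : E :=
  avg N (fun x => avg N (fun y => avg N (fun z => f x y z)))

/-- Periodicity in each of three variables. -/
def PeriodicThree {E : Type*} (N : ℕ) (f : ℤ → ℤ → ℤ → E) : Prop :=
  ∀ x y z, f (x + N) y z = f x y z ∧ f x (y + N) z = f x y z ∧ f x y (z + N) = f x y z

theorem avgThree_congr {N : ℕ} {f g : ℤ → ℤ → ℤ → E} (h : ∀ x y z, f x y z = g x y z) :
    avgThree N f = avgThree N g := by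
  simp only [avgThree, h]

theorem avgThree_const {N : ℕ} (hN : N ≠ 0) (c : E) : avgThree N (fun _ _ _ => c) = c := by
  simp only [avgThree, avg_const hN]

theorem avg_avgThree_comm (m n : ℕ) (f : ℤ → ℤ → ℤ → ℤ → E) :
    avg m (fun t => avgThree n (f t)) = avgThree n (fun x y z => avg m (fun t => f t x y z)) := by
  simp only [avgThree]
  rw [avg_comm]
  refine avg_congr fun x => ?_
  rw [avg_comm]
  refine avg_congr fun y => ?_
  rw [avg_comm]

theorem avgThree_comm (m n : ℕ) (f : ℤ → ℤ → ℤ → ℤ → ℤ → ℤ → E) :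
    avgThree m (fun a b c => avgThree n (f a b c)) =
      avgThree n (fun x y z => avgThree m (fun a b c => f a b c x y z)) := by
  rw [avgThree]
  simp only [avg_avgThree_comm]
  rfl

theorem avgThree_sum {ι : Type*} (s : Finset ι) (N : ℕ) (f : ι → ℤ → ℤ → ℤ → E) :
    avgThree N (fun x y z => ∑ i ∈ s, f i x y z) = ∑ i ∈ s, avgThree N (f i) := by
  simp only [avgThree, avg_sum]

theorem avgThree_smul (N : ℕ) (c : ℝ) (f : ℤ → ℤ → ℤ → E) :
    avgThree N (fun x y z => c • f x y z) = c • avgThree N f := by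
  simp only [avgThree, avg_smul]

theorem norm_avgThree_le {N : ℕ} {f : ℤ → ℤ → ℤ → E} {B : ℝ} (hB : 0 ≤ B)
    (h : ∀ x y z, ‖f x y z‖ ≤ B) : ‖avgThree N f‖ ≤ B :=
  norm_avg_le hB fun x => norm_avg_le hB fun y => norm_avg_le hB fun z => h x y z

theorem PeriodicThree.periodic_avg {N q : ℕ} {f : ℤ → ℤ → ℤ → E} (hf : PeriodicThree N f) :
    Function.Periodic (fun x => avg q (fun y => avg q (fun z => f x y z))) N := fun x => by
  simp only [(hf _ _ _).1]

theorem PeriodicThree.periodic_avg' {N q : ℕ} {f : ℤ → ℤ → ℤ → E} (hf : PeriodicThree N f)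
    (x : ℤ) : Function.Periodic (fun y => avg q (fun z => f x y z)) N := fun y => by
  simp only [(hf _ _ _).2.1]

theorem PeriodicThree.periodic_last {N : ℕ} {f : ℤ → ℤ → ℤ → E} (hf : PeriodicThree N f)
    (x y : ℤ) : Function.Periodic (fun z => f x y z) N := fun _ => (hf _ _ _).2.2

theorem avgThree_of_dvd {q m : ℕ} {f : ℤ → ℤ → ℤ → E} (hf : PeriodicThree q f) (hm : m ≠ 0)
    (h : q ∣ m) : avgThree m f = avgThree q f := by
  simp only [avgThree, avg_of_dvd (hf.periodic_last _ _) hm h]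
  simp only [avg_of_dvd (hf.periodic_avg' _) hm h]
  exact avg_of_dvd hf.periodic_avg hm h

theorem avgThree_shift {N : ℕ} {f : ℤ → ℤ → ℤ → E} (hf : PeriodicThree N f) (a b c : ℤ) :
    avgThree N (fun x y z => f (x + a) (y + b) (z + c)) = avgThree N f := by
  have h1 : ∀ x y, avg N (fun z => f x y (z + c)) = avg N (fun z => f x y z) := fun x y =>
    avg_shift (hf.periodic_last x y) c
  simp only [avgThree, h1]
  have h2 : ∀ x, avg N (fun y => avg N (fun z => f x (y + b) z)) =
      avg N (fun y => avg N (fun z => f x y z)) := fun x => avg_shift (hf.periodic_avg' x) b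
  simp only [h2]
  exact avg_shift (f := fun x => avg N (fun y => avg N (fun z => f x y z))) hf.periodic_avg a

theorem avgThree_residue (P N : ℕ) (f : ℤ → ℤ → ℤ → E) :
    avgThree (P * N) f = avgThree P (fun a b c =>
      avgThree N (fun x y z => f (a + P * x) (b + P * y) (c + P * z))) := by
  simp only [avgThree, avg_residue P N]
  refine avg_congr fun a => ?_
  rw [avg_comm]
  refine avg_congr fun b => ?_
  have : ∀ x : ℤ, avg N (fun y => avg P (fun c => avg N (fun z =>
      f (a + P * x) (b + P * y) (c + P * z)))) = avg P (fun c => avg N (fun y => avg N (fun z =>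
      f (a + P * x) (b + P * y) (c + P * z)))) := fun x => avg_comm _ _ _
  simp only [this]
  rw [avg_comm]

theorem avg_eq_single {p : ℕ} (hp : 0 < p) {f : ℤ → E} (h : ∀ x, ¬ (p : ℤ) ∣ x → f x = 0) :
    avg p f = (p : ℝ)⁻¹ • f 0 := by
  rw [avg, Finset.sum_eq_single_of_mem 0 (by simpa using hp)]
  · simp
  · intro b hb hb0
    refine h b fun hd => ?_
    have := Int.le_of_dvd (by positivity) hd
    rw [Finset.mem_range] at hb
    omega

theorem avgThree_eq_single {p : ℕ} (hp : 0 < p) {f : ℤ → ℤ → ℤ → E}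
    (h : ∀ x y z, ¬ ((p : ℤ) ∣ x ∧ (p : ℤ) ∣ y ∧ (p : ℤ) ∣ z) → f x y z = 0) :
    avgThree p f = ((p : ℝ) ^ 3)⁻¹ • f 0 0 0 := by
  have h1 : ∀ x, ¬ (p : ℤ) ∣ x → avg p (fun y => avg p (fun z => f x y z)) = 0 := by
    intro x hx
    have : ∀ y z, f x y z = 0 := fun y z => h x y z fun hd => hx hd.1
    simp [this, avg]
  have h2 : ∀ y, ¬ (p : ℤ) ∣ y → avg p (fun z => f 0 y z) = 0 := by
    intro y hy
    have : ∀ z, f 0 y z = 0 := fun z => h 0 y z fun hd => hy hd.2.1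
    simp [this, avg]
  rw [avgThree, avg_eq_single hp h1, avg_eq_single hp h2,
    avg_eq_single hp (fun z hz => h 0 0 z fun hd => hz hd.2.2), smul_smul, smul_smul]
  congr 1
  rw [← mul_inv, ← mul_inv]
  ring

end avgThree

theorem avg_const_mul (q : ℕ) (c : ℂ) (f : ℤ → ℂ) : avg q (fun x => c * f x) = c * avg q f := by
  simp only [avg, ← Finset.mul_sum, mul_smul_comm]

theorem avgThree_const_mul (q : ℕ) (c : ℂ) (f : ℤ → ℤ → ℤ → ℂ) :
    avgThree q (fun x y z => c * f x y z) = c * avgThree q f := by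
  simp only [avgThree, avg_const_mul]

theorem avgThree_mul_mul (q : ℕ) (f g h : ℤ → ℂ) :
    avgThree q (fun x y z => f x * g y * h z) = avg q f * avg q g * avg q h := by
  simp only [avgThree, avg_const_mul]
  have : ∀ x, avg q (fun y => f x * g y * avg q h) = avg q g * avg q h * f x := by
    intro x
    simp only [mul_comm _ (avg q h), mul_left_comm _ (f x), avg_const_mul]
    ring
  simp only [this, avg_const_mul]
  ring

theorem norm_avg_le_avg {q : ℕ} {f : ℤ → ℂ} {g : ℤ → ℝ} (h : ∀ x, ‖f x‖ ≤ g x) :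
    ‖avg q f‖ ≤ avg q g := by
  rw [avg, avg, norm_smul, norm_inv, Real.norm_natCast, smul_eq_mul]
  gcongr
  exact (norm_sum_le _ _).trans (Finset.sum_le_sum fun x _ => h x)

theorem norm_avgThree_le_avgThree {q : ℕ} {f : ℤ → ℤ → ℤ → ℂ} {g : ℤ → ℤ → ℤ → ℝ}
    (h : ∀ x y z, ‖f x y z‖ ≤ g x y z) : ‖avgThree q f‖ ≤ avgThree q g :=
  norm_avg_le_avg fun x => norm_avg_le_avg fun y => norm_avg_le_avg fun z => h x y z

theorem avgThree_mul_of_coprime {m n : ℕ} (h : Nat.Coprime m n) {f g : ℤ → ℤ → ℤ → ℝ}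
    (hf : PeriodicThree m f) (hg : PeriodicThree n g) :
    avgThree (m * n) (fun x y z => f x y z * g x y z) = avgThree m f * avgThree n g := by
  simp only [avgThree, avg_mul_of_coprime h (hf.periodic_last _ _) (hg.periodic_last _ _)]
  simp only [avg_mul_of_coprime h (hf.periodic_avg' _) (hg.periodic_avg' _)]
  exact avg_mul_of_coprime h hf.periodic_avg hg.periodic_avg

/-! ### Exponential sums of cubic polynomials close to quadratic forms -/

namespace Markoff

/-- The cubic `x² + y² + z² + 2(αxy + βyz + γzx) + cxyz`. -/
def cubic (α β γ c x y z : ℤ) : ℤ :=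
  x ^ 2 + y ^ 2 + z ^ 2 + 2 * (α * x * y + β * y * z + γ * z * x) + c * x * y * z

/-- All three partial derivatives of the cubic are divisible by `d`. -/
def CriticalMod (α β γ c : ℤ) (d : ℕ) (x y z : ℤ) : Prop :=
  (d : ℤ) ∣ 2 * x + 2 * α * y + 2 * γ * z + c * y * z ∧
  (d : ℤ) ∣ 2 * y + 2 * α * x + 2 * β * z + c * x * z ∧
  (d : ℤ) ∣ 2 * z + 2 * β * y + 2 * γ * x + c * x * y

/-- The normalized complete exponential sum of a cubic. -/
noncomputable def cubicMean (α β γ c : ℤ) (N : ℕ) (u : ℤ) : ℂ :=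
  avgThree N (fun x y z => e N (u * cubic α β γ c x y z))

theorem avgThree_e_eq_zero {d : ℕ} {a b c : ℤ}
    (h : ¬ ((d : ℤ) ∣ a ∧ (d : ℤ) ∣ b ∧ (d : ℤ) ∣ c)) :
    avgThree d (fun x y z => e d (a * x) * e d (b * y) * e d (c * z)) = 0 := by
  rw [avgThree_mul_mul d (fun x => e d (a * x)) (fun y => e d (b * y)) (fun z => e d (c * z))]
  by_cases ha : (d : ℤ) ∣ a
  · by_cases hb : (d : ℤ) ∣ b
    · rw [avg_e_mul (t := c) (fun hc => h ⟨ha, hb, hc⟩), mul_zero]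
    · rw [avg_e_mul (t := b) hb, mul_zero, zero_mul]
  · rw [avg_e_mul (t := a) ha, zero_mul, zero_mul]

theorem dvd_of_dvd_mul_coprime {d : ℕ} {u t : ℤ} (hu : IsCoprime u (d : ℤ))
    (h : (d : ℤ) ∣ u * t) : (d : ℤ) ∣ t :=
  hu.symm.dvd_of_dvd_mul_left h

theorem cubic_modEq {N : ℕ} (α β γ c : ℤ) {x x' y y' z z' : ℤ} (hx : x ≡ x' [ZMOD N])
    (hy : y ≡ y' [ZMOD N]) (hz : z ≡ z' [ZMOD N]) :
    cubic α β γ c x y z ≡ cubic α β γ c x' y' z' [ZMOD N] := by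
  unfold cubic
  gcongr

theorem add_mul_modEq (P N : ℕ) (r x : ℤ) : r + P * (x + N) ≡ r + P * x [ZMOD (P * N : ℕ)] := by
  refine Int.ModEq.symm (Int.modEq_iff_dvd.2 ⟨1, ?_⟩)
  push_cast
  ring

theorem periodicThree_e_cubic (α β γ c u : ℤ) (P N : ℕ) (r s t : ℤ) :
    PeriodicThree N (fun x y z =>
      e (P * N) (u * cubic α β γ c (r + P * x) (s + P * y) (t + P * z))) := by
  intro x y z
  refine ⟨?_, ?_, ?_⟩ <;> refine e_eq_of_modEq (Int.ModEq.mul_left _ (cubic_modEq _ _ _ _ ?_ ?_ ?_))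
  all_goals first | exact add_mul_modEq _ _ _ _ | exact Int.ModEq.refl _

/-- Stationary phase: residue classes without critical points contribute nothing. -/
theorem avgThree_e_cubic_eq_zero {α β γ c u : ℤ} {P h d : ℕ} (hP : P ≠ 0) (hh : h ≠ 0)
    (hd : d ≠ 0) (hdvd : d ∣ P * h) (hu : IsCoprime u (d : ℤ)) {r s t : ℤ}
    (hcrit : ∀ x y z : ℤ, ¬ CriticalMod α β γ c d (r + P * x) (s + P * y) (t + P * z)) :
    avgThree (h * d) (fun x y z =>
      e (P * (h * d)) (u * cubic α β γ c (r + P * x) (s + P * y) (t + P * z))) = 0 := by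
  set g : ℤ → ℤ → ℤ → ℂ := fun x y z =>
    e (P * (h * d)) (u * cubic α β γ c (r + P * x) (s + P * y) (t + P * z)) with hg
  have hper : PeriodicThree (h * d) g := periodicThree_e_cubic α β γ c u P (h * d) r s t
  -- Shifts by multiples of `h` leave the mean unchanged, so one may average over them; the average
  -- over `v` is a linear exponential sum that detects the gradient modulo `d`.
  have h1 : avgThree (h * d) g = avgThree d (fun v₁ v₂ v₃ =>
      avgThree (h * d) (fun x y z => g (x + h * v₁) (y + h * v₂) (z + h * v₃))) := by
    simp only [avgThree_shift hper]
    exact (avgThree_const hd _).symm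
  rw [h1, avgThree_comm]
  have h2 : ∀ x y z, avgThree d (fun v₁ v₂ v₃ => g (x + h * v₁) (y + h * v₂) (z + h * v₃)) = 0 := by
    intro x y z
    set X := r + P * x with hX
    set Y := s + P * y with hY
    set Z := t + P * z with hZ
    have h3 : ∀ v₁ v₂ v₃ : ℤ, g (x + h * v₁) (y + h * v₂) (z + h * v₃) = g x y z *
        (e d (u * (2 * X + 2 * α * Y + 2 * γ * Z + c * Y * Z) * v₁) *
          e d (u * (2 * Y + 2 * α * X + 2 * β * Z + c * X * Z) * v₂) *
          e d (u * (2 * Z + 2 * β * Y + 2 * γ * X + c * X * Y) * v₃)) := by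
      intro v₁ v₂ v₃
      obtain ⟨w, hw⟩ := hdvd
      have hw' : (P : ℤ) * h = d * w := by exact_mod_cast hw
      -- Taylor expansion with increment `P h v`. Terms of order two and higher carry `(P h)²`, a
      -- multiple of the modulus `P h d` because `d` divides `P h`.
      have key : u * cubic α β γ c (r + P * (x + h * v₁)) (s + P * (y + h * v₂))
          (t + P * (z + h * v₃)) = u * cubic α β γ c X Y Z + (P * h : ℕ) *
          (u * (2 * X + 2 * α * Y + 2 * γ * Z + c * Y * Z) * v₁ +
            u * (2 * Y + 2 * α * X + 2 * β * Z + c * X * Z) * v₂ +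
            u * (2 * Z + 2 * β * Y + 2 * γ * X + c * X * Y) * v₃ + d * (w * u * (cubic α β γ 0 v₁ v₂ v₃
              + c * (X * v₂ * v₃ + Y * v₁ * v₃ + Z * v₁ * v₂) + P * h * c * v₁ * v₂ * v₃))) := by
        rw [← mul_assoc (d : ℤ), ← mul_assoc (d : ℤ), ← hw', hX, hY, hZ]
        simp only [cubic]
        push_cast
        ring
      simp only [hg, ← mul_assoc P h d, key]
      rw [e_add, e_mul_mul (mul_ne_zero hP hh), e_add, e_add, e_add, e_mul_self, mul_one]
    simp only [h3, avgThree_const_mul]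
    rw [avgThree_e_eq_zero, mul_zero]
    rintro ⟨d1, d2, d3⟩
    exact hcrit x y z ⟨dvd_of_dvd_mul_coprime hu d1, dvd_of_dvd_mul_coprime hu d2,
      dvd_of_dvd_mul_coprime hu d3⟩
  simp only [h2]
  simp [avgThree, avg]

theorem cubicMean_eq_avgThree (α β γ c u : ℤ) (P N : ℕ) :
    cubicMean α β γ c (P * N) u = avgThree P (fun r s t => avgThree N (fun x y z =>
      e (P * N) (u * cubic α β γ c (r + P * x) (s + P * y) (t + P * z)))) := by
  rw [cubicMean, avgThree_residue]

theorem periodicThree_cubicMean (α β γ c u : ℤ) (N : ℕ) :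
    PeriodicThree N (fun x y z => e N (u * cubic α β γ c x y z)) := by
  simpa using periodicThree_e_cubic α β γ c u 1 N 0 0 0

theorem norm_cubicMean_le_one (α β γ c u : ℤ) (N : ℕ) : ‖cubicMean α β γ c N u‖ ≤ 1 :=
  norm_avgThree_le zero_le_one fun _ _ _ => (norm_e _ _).le

/-- If all critical points lie in the class of the origin, the exponential sum reduces to one of
modulus smaller by a factor `p²`. -/
theorem norm_cubicMean_descent {α β γ c u : ℤ} {p h d n : ℕ} (hp : p ≠ 0) (hh : h ≠ 0)
    (hd : d ≠ 0) (hdvd : d ∣ p * h) (hu : IsCoprime u (d : ℤ)) (hn : h * d = p * n)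
    (hcrit : ∀ x y z, CriticalMod α β γ c d x y z → (p : ℤ) ∣ x ∧ (p : ℤ) ∣ y ∧ (p : ℤ) ∣ z) :
    ‖cubicMean α β γ c (p * (p * n)) u‖ = ((p : ℝ) ^ 3)⁻¹ * ‖cubicMean α β γ (p * c) n u‖ := by
  have hn0 : p * n ≠ 0 := hn ▸ mul_ne_zero hh hd
  rw [cubicMean_eq_avgThree, avgThree_eq_single (Nat.pos_of_ne_zero hp)]
  · rw [norm_smul, norm_inv, norm_pow, Real.norm_natCast]
    congr 2
    have : ∀ x y z : ℤ, e (p * (p * n)) (u * cubic α β γ c (0 + p * x) (0 + p * y) (0 + p * z)) =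
        e n (u * cubic α β γ (p * c) x y z) := by
      intro x y z
      rw [← e_mul_mul hp n, ← e_mul_mul hp (p * n)]
      congr 1
      simp only [cubic]
      ring
    simp only [this]
    exact avgThree_of_dvd (periodicThree_cubicMean α β γ (p * c) u n) hn0 ⟨p, mul_comm _ _⟩
  · intro r s t hrst
    rw [← hn]
    refine avgThree_e_cubic_eq_zero hp hh hd hdvd hu fun x y z hc => hrst ?_
    obtain ⟨h1, h2, h3⟩ := hcrit _ _ _ hc
    exact ⟨(dvd_add_left (Dvd.intro _ rfl)).1 h1, (dvd_add_left (Dvd.intro _ rfl)).1 h2,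
      (dvd_add_left (Dvd.intro _ rfl)).1 h3⟩

/-- The quadratic Gauss sum in three variables. -/
theorem norm_sq_cubicMean_prime {α β γ c u : ℤ} {p : ℕ} (hp : p ≠ 0) (hc : (p : ℤ) ∣ c)
    (hu : IsCoprime u (p : ℤ))
    (hcrit : ∀ x y z, CriticalMod α β γ c p x y z → (p : ℤ) ∣ x ∧ (p : ℤ) ∣ y ∧ (p : ℤ) ∣ z) :
    ‖cubicMean α β γ c p u‖ ^ 2 = ((p : ℝ) ^ 3)⁻¹ := by
  set g : ℤ → ℤ → ℤ → ℂ := fun x y z => e p (u * cubic α β γ c x y z) with hg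
  have hper : PeriodicThree p g := periodicThree_cubicMean α β γ c u p
  have hconj : (starRingEnd ℂ) (avgThree p g) = avgThree p (fun x y z => (starRingEnd ℂ) (g x y z)) := by
    simp only [avgThree, avg, map_sum, Complex.real_smul, map_mul, Complex.conj_ofReal]
  have h1 : (starRingEnd ℂ) (avgThree p g) * avgThree p g = (((p : ℝ) ^ 3)⁻¹ : ℝ) := by
    rw [mul_comm, hconj, ← avgThree_const_mul]
    -- Weyl differencing: since `p ∣ c`, the phase is quadratic modulo `p`, the differenced phase is
    -- linear in `v`, and only the zero difference survives.
    have h2 : ∀ v₁ v₂ v₃, avgThree p g * (starRingEnd ℂ) (g v₁ v₂ v₃) =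
        avgThree p (fun x y z => (starRingEnd ℂ) (g v₁ v₂ v₃) * g (x + v₁) (y + v₂) (z + v₃)) := by
      intro v₁ v₂ v₃
      rw [avgThree_const_mul, avgThree_shift hper, mul_comm]
    simp only [h2]
    rw [avgThree_comm]
    have h3 : ∀ x y z v₁ v₂ v₃ : ℤ, (starRingEnd ℂ) (g v₁ v₂ v₃) * g (x + v₁) (y + v₂) (z + v₃) =
        g x y z * (e p (u * (2 * x + 2 * α * y + 2 * γ * z + c * y * z) * v₁) *
          e p (u * (2 * y + 2 * α * x + 2 * β * z + c * x * z) * v₂) *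
          e p (u * (2 * z + 2 * β * y + 2 * γ * x + c * x * y) * v₃)) := by
      intro x y z v₁ v₂ v₃
      obtain ⟨k, rfl⟩ := hc
      simp only [hg]
      rw [← e_neg, ← e_add, ← e_add, ← e_add, ← e_add]
      apply e_eq_of_modEq
      refine Int.ModEq.symm (Int.modEq_iff_dvd.2
        ⟨u * k * (x * v₂ * v₃ + y * v₁ * v₃ + z * v₁ * v₂), ?_⟩)
      simp only [cubic]
      ring
    simp only [h3, avgThree_const_mul]
    rw [avgThree_eq_single (Nat.pos_of_ne_zero hp)]
    · simp [hg, cubic, e_zero, avgThree_const hp]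
    · intro x y z hxyz
      rw [avgThree_e_eq_zero, mul_zero]
      rintro ⟨d1, d2, d3⟩
      exact hxyz (hcrit x y z ⟨dvd_of_dvd_mul_coprime hu d1, dvd_of_dvd_mul_coprime hu d2,
        dvd_of_dvd_mul_coprime hu d3⟩)
  rw [mul_comm, Complex.mul_conj] at h1
  rw [← Complex.normSq_eq_norm_sq]
  exact_mod_cast h1

end Markoff

/-! ### Square-root cancellation for the Markoff cubic at prime powers -/

namespace Markoff

/-- The quadratic forms occurring at the singular points of the Markoff cubic. -/
def SingularSigns (α β γ : ℤ) : Prop :=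
  (α = 0 ∧ β = 0 ∧ γ = 0) ∨
    (α ^ 2 = 1 ∧ β ^ 2 = 1 ∧ γ ^ 2 = 1 ∧ α * β = -γ ∧ β * γ = -α ∧ γ * α = -β)

/-- Modulo `d` the gradient is linear, and in either sign pattern its matrix has an integral inverse
up to the factor `4`. -/
theorem CriticalMod.dvd_four_mul {α β γ c : ℤ} {d : ℕ} (hs : SingularSigns α β γ)
    (hc : (d : ℤ) ∣ c) {x y z : ℤ} (h : CriticalMod α β γ c d x y z) :
    (d : ℤ) ∣ 4 * x ∧ (d : ℤ) ∣ 4 * y ∧ (d : ℤ) ∣ 4 * z := by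
  obtain ⟨⟨k₁, h1⟩, ⟨k₂, h2⟩, ⟨k₃, h3⟩⟩ := h
  obtain ⟨k, rfl⟩ := hc
  rcases hs with ⟨rfl, rfl, rfl⟩ | ⟨ha, hb, hg, hab, hbg, hga⟩
  · exact ⟨⟨2 * k₁ - 2 * k * y * z, by linear_combination 2 * h1⟩,
      ⟨2 * k₂ - 2 * k * x * z, by linear_combination 2 * h2⟩,
      ⟨2 * k₃ - 2 * k * x * y, by linear_combination 2 * h3⟩⟩
  · refine ⟨⟨α * (k₂ - k * x * z - β * (k₃ - k * x * y)), ?_⟩,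
      ⟨α * (k₁ - k * y * z - γ * (k₃ - k * x * y)), ?_⟩,
      ⟨γ * (k₁ - k * y * z - α * (k₂ - k * x * z)), ?_⟩⟩
    · linear_combination α * h2 - α * β * h3 - 4 * x * ha + 2 * α * x * hbg + 2 * α * y * hb
    · linear_combination α * h1 - α * γ * h3 - 4 * y * ha + 2 * α * y * hbg + 2 * α * x * hg
    · linear_combination γ * h1 - γ * α * h2 - 4 * z * hg + 2 * γ * z * hab + 2 * γ * x * ha

/-- The origin is the only critical point modulo `p`. Each descent lowers `k` by `2`, gains `p^(-3)`
and replaces `c` by `p c`, which is why `c` is quantified inside the induction. It ends in a trivial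
sum or a Gauss sum. -/
theorem norm_cubicMean_le_of_odd {p : ℕ} (hp : p.Prime) (hp2 : p ≠ 2) {u : ℤ}
    (hu : IsCoprime u (p : ℤ)) {α β γ : ℤ} (hs : SingularSigns α β γ) (k : ℕ) :
    ∀ c : ℤ, (p : ℤ) ∣ c → ‖cubicMean α β γ c (p ^ k) u‖ ≤ (1 / √p) ^ (3 * k) := by
  have hp0 : (0 : ℝ) < p := by exact_mod_cast hp.pos
  have hsq : (1 / √(p : ℝ)) ^ 2 = (p : ℝ)⁻¹ := by
    rw [div_pow, Real.sq_sqrt hp0.le, one_pow, one_div]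
  have hcrit : ∀ c : ℤ, (p : ℤ) ∣ c → ∀ x y z, CriticalMod α β γ c p x y z →
      (p : ℤ) ∣ x ∧ (p : ℤ) ∣ y ∧ (p : ℤ) ∣ z := by
    intro c hc x y z h
    have hcop : IsCoprime (p : ℤ) 4 := by
      rw [show (4 : ℤ) = 2 ^ 2 by norm_num]
      refine IsCoprime.pow_right ?_
      exact_mod_cast Nat.isCoprime_iff_coprime.2 ((Nat.coprime_primes hp Nat.prime_two).2 hp2)
    obtain ⟨h1, h2, h3⟩ := h.dvd_four_mul hs hc
    exact ⟨hcop.dvd_of_dvd_mul_left h1, hcop.dvd_of_dvd_mul_left h2, hcop.dvd_of_dvd_mul_left h3⟩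
  induction k using Nat.twoStepInduction with
  | zero => intro c _; simpa using norm_cubicMean_le_one α β γ c u 1
  | one =>
    intro c hc
    have h := norm_sq_cubicMean_prime hp.ne_zero hc hu (hcrit c hc)
    rw [pow_one]
    refine abs_le_of_sq_le_sq' ?_ (by positivity) |>.2
    rw [h, ← pow_mul, mul_comm, pow_mul, hsq, inv_pow]
  | more k ih _ =>
    intro c hc
    have h := norm_cubicMean_descent (α := α) (β := β) (γ := γ) (c := c) (u := u) (p := p)
      (h := p ^ k) (d := p) (n := p ^ k) hp.ne_zero (pow_ne_zero _ hp.ne_zero) hp.ne_zero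
      ⟨_, rfl⟩ hu (mul_comm _ _) (hcrit c hc)
    rw [show p ^ (k + 2) = p * (p * p ^ k) by ring, h]
    calc _ ≤ ((p : ℝ) ^ 3)⁻¹ * (1 / √p) ^ (3 * k) := by
          gcongr
          exact ih _ (hc.mul_left _)
      _ = ((1 / √p) ^ 2) ^ 3 * (1 / √p) ^ (3 * k) := by rw [hsq, inv_pow]
      _ = _ := by ring

/-- The factor `4` in the inverse gradient costs two powers of `2`: criticality modulo `8` is needed
to force even coordinates. The descent thus has room only for larger exponents, and `512 = 2^9` pays
for the trivial bound when `k ≤ 6`. -/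
theorem norm_cubicMean_le_of_two {u : ℤ} (hu : IsCoprime u 2) {α β γ : ℤ}
    (hs : SingularSigns α β γ) (k : ℕ) :
    ∀ c : ℤ, 8 ∣ c → ‖cubicMean α β γ c (2 ^ k) u‖ ≤ 512 * (1 / √2) ^ (3 * k) := by
  have hsq : (1 / √(2 : ℝ)) ^ 2 = 1 / 2 := by rw [div_pow, Real.sq_sqrt zero_le_two, one_pow]
  have hs1 : (1 / √(2 : ℝ)) ≤ 1 := by
    rw [div_le_one (by positivity)]
    exact Real.one_le_sqrt.2 one_le_two
  have hsmall : ∀ k ≤ 6, (1 : ℝ) ≤ 512 * (1 / √2) ^ (3 * k) := by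
    intro k hk
    calc (1 : ℝ) = 512 * ((1 / √2) ^ 2) ^ 9 := by rw [hsq]; norm_num
      _ = 512 * (1 / √2) ^ (3 * 6) := by ring
      _ ≤ _ := by
        gcongr ?_ * ?_
        exact pow_le_pow_of_le_one (by positivity) hs1 (by omega)
  induction k using Nat.twoStepInduction with
  | zero => exact fun c _ => (norm_cubicMean_le_one α β γ c u _).trans (hsmall _ (by norm_num))
  | one => exact fun c _ => (norm_cubicMean_le_one α β γ c u _).trans (hsmall _ (by norm_num))
  | more k ih _ =>
    intro c hc
    rcases le_or_gt (k + 2) 6 with hk | hk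
    · exact (norm_cubicMean_le_one α β γ c u _).trans (hsmall _ hk)
    obtain ⟨j, rfl⟩ : ∃ j, k = j + 4 := ⟨k - 4, by omega⟩
    have h := norm_cubicMean_descent (α := α) (β := β) (γ := γ) (c := c) (u := u) (p := 2)
      (h := 2 ^ (j + 2)) (d := 8) (n := 2 ^ (j + 4)) two_ne_zero (by positivity) (by norm_num)
      ⟨2 ^ j, by ring⟩ (by
        rw [show ((8 : ℕ) : ℤ) = 2 ^ 3 by norm_num]
        exact hu.pow_right) (by ring) (by
        intro x y z hcr
        obtain ⟨h1, h2, h3⟩ := hcr.dvd_four_mul hs hc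
        push_cast at h1 h2 h3 ⊢
        omega)
    rw [show (2 : ℕ) ^ (j + 4 + 2) = 2 * (2 * 2 ^ (j + 4)) by ring, h]
    calc _ ≤ (((2 : ℕ) : ℝ) ^ 3)⁻¹ * (512 * (1 / √2) ^ (3 * (j + 4))) := by
          gcongr
          exact ih _ (hc.mul_left _)
      _ = ((1 / √2) ^ 2) ^ 3 * (512 * (1 / √2) ^ (3 * (j + 4))) := by rw [hsq]; norm_num
      _ = _ := by ring

/-- The critical points of the Markoff cubic. -/
def criticalPoints : Finset (ℤ × ℤ × ℤ) :=
  {(0, 0, 0), (2, 2, 2), (2, -2, -2), (-2, 2, -2), (-2, -2, 2)}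

/-- At a critical point the Taylor expansion has no linear term. The value is `0` at the origin and
`4` at the other four points, and `α, β, γ` are minus half the coordinates `z, x, y` of the point.
-/
theorem markoff_expand_at_critical (P : ℤ) {q : ℤ × ℤ × ℤ} (hq : q ∈ criticalPoints) :
    ∃ α β γ m : ℤ, SingularSigns α β γ ∧ ∀ x y z : ℤ,
      cubic 0 0 0 (-1) (q.1 + P * x) (q.2.1 + P * y) (q.2.2 + P * z) =
        m + P ^ 2 * cubic α β γ (-P) x y z := by
  simp only [criticalPoints, Finset.mem_insert, Finset.mem_singleton] at hq
  rcases hq with rfl | rfl | rfl | rfl | rfl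
  · exact ⟨0, 0, 0, 0, Or.inl ⟨rfl, rfl, rfl⟩, fun x y z => by simp only [cubic]; ring⟩
  · exact ⟨-1, -1, -1, 4, Or.inr (by norm_num), fun x y z => by simp only [cubic]; ring⟩
  · exact ⟨1, -1, 1, 4, Or.inr (by norm_num), fun x y z => by simp only [cubic]; ring⟩
  · exact ⟨1, 1, -1, 4, Or.inr (by norm_num), fun x y z => by simp only [cubic]; ring⟩
  · exact ⟨-1, 1, 1, 4, Or.inr (by norm_num), fun x y z => by simp only [cubic]; ring⟩

/-- The residue class of `q`. -/
def SameResidue (P : ℕ) (q : ℤ × ℤ × ℤ) (x y z : ℤ) : Prop :=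
  (P : ℤ) ∣ x - q.1 ∧ (P : ℤ) ∣ y - q.2.1 ∧ (P : ℤ) ∣ z - q.2.2

open Classical in
theorem avgThree_sameResidue {P : ℕ} (hP : P ≠ 0) (q : ℤ × ℤ × ℤ) (B : ℝ) :
    avgThree P (fun x y z => if SameResidue P q x y z then B else 0) = ((P : ℝ) ^ 3)⁻¹ * B := by
  set f : ℤ → ℤ → ℤ → ℝ := fun x y z => if (P : ℤ) ∣ x ∧ (P : ℤ) ∣ y ∧ (P : ℤ) ∣ z then B else 0
    with hf
  have hper : PeriodicThree P f := by
    intro x y z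
    simp [hf]
  have h1 := avgThree_shift hper (-q.1) (-q.2.1) (-q.2.2)
  have h2 : avgThree P f = ((P : ℝ) ^ 3)⁻¹ * B := by
    rw [avgThree_eq_single (Nat.pos_of_ne_zero hP)]
    · simp [hf]
    · intro x y z h
      simp only [hf, if_neg h]
  rw [← h2, ← h1]
  refine avgThree_congr fun x y z => ?_
  simp only [SameResidue, hf, sub_eq_add_neg]

/-- Stationary phase leaves at most five residue classes modulo `P`, each of density `P^(-3)`. On
each the phase is a constant plus `P²` times a cubic close to a quadratic form. -/
theorem norm_markoff_descent {P h d n : ℕ} {u : ℤ} {B : ℝ} (hP : P ≠ 0) (hh : h ≠ 0) (hd : d ≠ 0)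
    (hdvd : d ∣ P * h) (hn : h * d = P * n) (hu : IsCoprime u (d : ℤ))
    (hcrit : ∀ x y z, CriticalMod 0 0 0 (-1) d x y z → ∃ q ∈ criticalPoints, SameResidue P q x y z)
    (hB : ∀ α β γ, SingularSigns α β γ → ‖cubicMean α β γ (-P) n u‖ ≤ B) :
    ‖cubicMean 0 0 0 (-1) (P * (P * n)) u‖ ≤ 5 * (((P : ℝ) ^ 3)⁻¹ * B) := by
  classical
  have hn0 : P * n ≠ 0 := hn ▸ mul_ne_zero hh hd
  have hB0 : 0 ≤ B := (norm_nonneg _).trans (hB 0 0 0 (Or.inl ⟨rfl, rfl, rfl⟩))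
  rw [cubicMean_eq_avgThree]
  set G : ℤ → ℤ → ℤ → ℂ := fun r s t => avgThree (P * n) (fun x y z =>
      e (P * (P * n)) (u * cubic 0 0 0 (-1) (r + P * x) (s + P * y) (t + P * z))) with hG
  have hpt : ∀ r s t, ‖G r s t‖ ≤
      ∑ q ∈ criticalPoints, if SameResidue P q r s t then B else 0 := by
    intro r s t
    have hnn : ∀ q ∈ criticalPoints, (0 : ℝ) ≤ if SameResidue P q r s t then B else 0 := by
      intro q _; split_ifs <;> simp [hB0]
    by_cases hex : ∃ q ∈ criticalPoints, SameResidue P q r s t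
    · obtain ⟨q, hq, hr⟩ := hex
      refine le_trans ?_ (Finset.single_le_sum hnn hq)
      rw [if_pos hr]
      obtain ⟨⟨a, ha⟩, ⟨b, hb⟩, ⟨c, hc⟩⟩ := hr
      have hshift := avgThree_shift (periodicThree_e_cubic 0 0 0 (-1) u P (P * n) q.1 q.2.1 q.2.2)
        a b c
      have h1 : G r s t = G q.1 q.2.1 q.2.2 := by
        simp only [hG]
        rw [← hshift]
        refine avgThree_congr fun x y z => ?_
        rw [show r + P * x = q.1 + P * (x + a) by linear_combination ha,
          show s + P * y = q.2.1 + P * (y + b) by linear_combination hb,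
          show t + P * z = q.2.2 + P * (z + c) by linear_combination hc]
      obtain ⟨α, β, γ, m, hs, hexp⟩ := markoff_expand_at_critical P hq
      have h2 : ∀ x y z : ℤ, e (P * (P * n)) (u * cubic 0 0 0 (-1) (q.1 + P * x) (q.2.1 + P * y)
          (q.2.2 + P * z)) = e (P * (P * n)) (u * m) * e n (u * cubic α β γ (-P) x y z) := by
        intro x y z
        rw [hexp, ← e_mul_mul hP n, ← e_mul_mul hP (P * n), ← e_add]
        congr 1
        ring
      rw [h1]
      simp only [hG, h2, avgThree_const_mul]
      rw [norm_mul, norm_e, one_mul,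
        avgThree_of_dvd (periodicThree_cubicMean α β γ (-P) u n) hn0 ⟨P, mul_comm _ _⟩]
      exact hB α β γ hs
    · have h0 : G r s t = 0 := by
        simp only [hG]
        rw [← hn]
        refine avgThree_e_cubic_eq_zero hP hh hd hdvd hu fun x y z hc => hex ?_
        obtain ⟨q, hq, h1, h2, h3⟩ := hcrit _ _ _ hc
        refine ⟨q, hq, ?_, ?_, ?_⟩
        · rw [add_sub_right_comm] at h1; exact (dvd_add_left (Dvd.intro _ rfl)).1 h1
        · rw [add_sub_right_comm] at h2; exact (dvd_add_left (Dvd.intro _ rfl)).1 h2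
        · rw [add_sub_right_comm] at h3; exact (dvd_add_left (Dvd.intro _ rfl)).1 h3
      rw [h0, norm_zero]
      exact Finset.sum_nonneg hnn
  refine (norm_avgThree_le_avgThree hpt).trans ?_
  rw [avgThree_sum]
  simp only [avgThree_sameResidue hP]
  rw [Finset.sum_const, nsmul_eq_mul]
  gcongr
  exact_mod_cast (by decide : criticalPoints.card ≤ 5)

/-- The equations `2a = bc`, `2b = ac`, `2c = ab` over a field of odd characteristic force either `a
= b = c = 0` or `a² = b² = 4`, with `c` then determined by `ab`. -/
theorem exists_criticalPoint_of_odd {p : ℕ} (hp : p.Prime) (hp2 : p ≠ 2) {x y z : ℤ}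
    (h : CriticalMod 0 0 0 (-1) p x y z) : ∃ q ∈ criticalPoints, SameResidue p q x y z := by
  have := Fact.mk hp
  have h2 : (2 : ZMod p) ≠ 0 := by
    intro h0
    have : p ∣ 2 := (ZMod.natCast_eq_zero_iff 2 p).1 (by exact_mod_cast h0)
    exact hp2 ((Nat.prime_dvd_prime_iff_eq hp Nat.prime_two).1 this)
  have conv : ∀ t q : ℤ, (p : ℤ) ∣ t - q ↔ (t : ZMod p) = q := fun t q => by
    rw [eq_comm, ZMod.intCast_eq_intCast_iff_dvd_sub]
  obtain ⟨h₁, h₂, h₃⟩ := h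
  simp only [← ZMod.intCast_zmod_eq_zero_iff_dvd, Int.cast_add, Int.cast_mul] at h₁ h₂ h₃
  push_cast at h₁ h₂ h₃
  simp only [SameResidue, conv]
  generalize (x : ZMod p) = a at *
  generalize (y : ZMod p) = b at *
  generalize (z : ZMod p) = c at *
  have e1 : 2 * a = b * c := by linear_combination h₁
  have e2 : 2 * b = a * c := by linear_combination h₂
  have e3 : 2 * c = a * b := by linear_combination h₃
  have hz : ∀ t : ZMod p, 2 * t = 0 → t = 0 := fun t ht => (mul_eq_zero.1 ht).resolve_left h2
  by_cases ha : a = 0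
  · have hb : b = 0 := hz b (by rw [e2, ha, zero_mul])
    have hc : c = 0 := hz c (by rw [e3, ha, zero_mul])
    exact ⟨(0, 0, 0), by simp [criticalPoints], by simp [ha, hb, hc]⟩
  by_cases hc : c = 0
  · exact absurd (hz a (by rw [e1, hc, mul_zero])) ha
  have hb : b ≠ 0 := by
    intro hb
    exact ha (hz a (by rw [e1, hb, zero_mul]))
  have ha2 : (a - 2) * (a + 2) = 0 := by
    apply mul_left_cancel₀ (mul_ne_zero hb hc)
    linear_combination (-1 : ZMod p) * e2 * (2 * c) - a * c * e3
  have hb2 : (b - 2) * (b + 2) = 0 := by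
    apply mul_left_cancel₀ (mul_ne_zero ha hc)
    linear_combination (-1 : ZMod p) * e1 * (2 * c) - b * c * e3
  have ha' : a = 2 ∨ a = -2 := (mul_eq_zero.1 ha2).imp sub_eq_zero.1 eq_neg_of_add_eq_zero_left
  have hb' : b = 2 ∨ b = -2 := (mul_eq_zero.1 hb2).imp sub_eq_zero.1 eq_neg_of_add_eq_zero_left
  have hc' : ∀ t : ZMod p, a * b = 2 * t → c = t := fun t ht => by
    have := e3.trans ht
    exact mul_left_cancel₀ h2 this
  rcases ha' with rfl | rfl <;> rcases hb' with rfl | rfl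
  · exact ⟨(2, 2, 2), by simp [criticalPoints], by simpa using hc' 2 (by ring)⟩
  · exact ⟨(2, -2, -2), by simp [criticalPoints], by simpa using hc' (-2) (by ring)⟩
  · exact ⟨(-2, 2, -2), by simp [criticalPoints], by simpa using hc' (-2) (by ring)⟩
  · exact ⟨(-2, -2, 2), by simp [criticalPoints], by simpa using hc' 2 (by ring)⟩

theorem exists_criticalPoint_of_two {x y z : ℤ} (h : CriticalMod 0 0 0 (-1) 16 x y z) :
    ∃ q ∈ criticalPoints, SameResidue 8 q x y z := by
  -- Here `15` stands for `-1` modulo `16`, which keeps the finite check in the natural numbers.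
  have key : ∀ a b c : Fin 16, (2 * a.1 + 15 * (b.1 * c.1)) % 16 = 0 →
      (2 * b.1 + 15 * (a.1 * c.1)) % 16 = 0 → (2 * c.1 + 15 * (a.1 * b.1)) % 16 = 0 →
      (a.1 % 8 = 0 ∧ b.1 % 8 = 0 ∧ c.1 % 8 = 0) ∨ (a.1 % 8 = 2 ∧ b.1 % 8 = 2 ∧ c.1 % 8 = 2) ∨
      (a.1 % 8 = 2 ∧ b.1 % 8 = 6 ∧ c.1 % 8 = 6) ∨ (a.1 % 8 = 6 ∧ b.1 % 8 = 2 ∧ c.1 % 8 = 6) ∨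
      (a.1 % 8 = 6 ∧ b.1 % 8 = 6 ∧ c.1 % 8 = 2) := by decide +kernel
  have hrep : ∀ t : ℤ, ∃ a : Fin 16, ∃ k : ℤ, t = (a.1 : ℤ) + 16 * k := fun t =>
    ⟨⟨(t % 16).toNat, by omega⟩, t / 16, by simp only; omega⟩
  obtain ⟨a, i, rfl⟩ := hrep x
  obtain ⟨b, j, rfl⟩ := hrep y
  obtain ⟨c, k, rfl⟩ := hrep z
  obtain ⟨⟨u, hu⟩, ⟨v, hv⟩, ⟨w, hw⟩⟩ := h
  have hmod : ∀ (t : ℕ) (s : ℤ), (t : ℤ) = 16 * s → t % 16 = 0 := fun t s h => by omega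
  have h1 := hmod (2 * a.1 + 15 * (b.1 * c.1))
    (u - 2 * i + b.1 * k + c.1 * j + 16 * j * k + b.1 * c.1) (by push_cast at hu ⊢; linear_combination hu)
  have h2 := hmod (2 * b.1 + 15 * (a.1 * c.1))
    (v - 2 * j + a.1 * k + c.1 * i + 16 * i * k + a.1 * c.1) (by push_cast at hv ⊢; linear_combination hv)
  have h3 := hmod (2 * c.1 + 15 * (a.1 * b.1))
    (w - 2 * k + a.1 * j + b.1 * i + 16 * i * j + a.1 * b.1) (by push_cast at hw ⊢; linear_combination hw)
  simp only [SameResidue]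
  rcases key a b c h1 h2 h3 with h | h | h | h | h
  · exact ⟨(0, 0, 0), by simp [criticalPoints], by push_cast; omega⟩
  · exact ⟨(2, 2, 2), by simp [criticalPoints], by push_cast; omega⟩
  · exact ⟨(2, -2, -2), by simp [criticalPoints], by push_cast; omega⟩
  · exact ⟨(-2, 2, -2), by simp [criticalPoints], by push_cast; omega⟩
  · exact ⟨(-2, -2, 2), by simp [criticalPoints], by push_cast; omega⟩

theorem norm_markoffMean_le_of_odd {p : ℕ} (hp : p.Prime) (hp2 : p ≠ 2) {u : ℤ}
    (hu : IsCoprime u (p : ℤ)) {k : ℕ} (hk : 2 ≤ k) :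
    ‖cubicMean 0 0 0 (-1) (p ^ k) u‖ ≤ 5 * (1 / √p) ^ (3 * k) := by
  obtain ⟨j, rfl⟩ := Nat.exists_eq_add_of_le' hk
  have hp0 : (0 : ℝ) < p := by exact_mod_cast hp.pos
  have hsq : (1 / √(p : ℝ)) ^ 2 = (p : ℝ)⁻¹ := by
    rw [div_pow, Real.sq_sqrt hp0.le, one_pow, one_div]
  have h := norm_markoff_descent (P := p) (h := p ^ j) (d := p) (n := p ^ j) (u := u)
    (B := (1 / √p) ^ (3 * j)) hp.ne_zero (pow_ne_zero _ hp.ne_zero) hp.ne_zero ⟨_, rfl⟩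
    (mul_comm _ _) hu (fun x y z => exists_criticalPoint_of_odd hp hp2)
    fun α β γ hs => norm_cubicMean_le_of_odd hp hp2 hu hs j _ (by simp)
  rw [show p ^ (j + 2) = p * (p * p ^ j) by ring]
  refine h.trans_eq ?_
  rw [← inv_pow, ← hsq]
  ring

/-- Critical points modulo `16` are located modulo `8`, so one descent with `P = 8` leaves `c = -8`,
as the quadratic stage needs. The constant `4096 = 2^12` covers `k ≤ 8` trivially, and dominates `5
· 512` beyond. -/
theorem norm_markoffMean_le_of_two {u : ℤ} (hu : IsCoprime u 2) (k : ℕ) :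
    ‖cubicMean 0 0 0 (-1) (2 ^ k) u‖ ≤ 4096 * (1 / √2) ^ (3 * k) := by
  have hsq : (1 / √(2 : ℝ)) ^ 2 = 1 / 2 := by rw [div_pow, Real.sq_sqrt zero_le_two, one_pow]
  have hs1 : (1 / √(2 : ℝ)) ≤ 1 := by
    rw [div_le_one (by positivity)]
    exact Real.one_le_sqrt.2 one_le_two
  rcases le_or_gt k 8 with hk | hk
  · refine (norm_cubicMean_le_one 0 0 0 (-1) u _).trans ?_
    calc (1 : ℝ) = 4096 * ((1 / √2) ^ 2) ^ 12 := by rw [hsq]; norm_num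
      _ = 4096 * (1 / √2) ^ (3 * 8) := by ring
      _ ≤ _ := by
        gcongr ?_ * ?_
        exact pow_le_pow_of_le_one (by positivity) hs1 (by omega)
  obtain ⟨j, rfl⟩ : ∃ j, k = j + 8 := ⟨k - 8, by omega⟩
  have hpow : ∀ i : ℕ, IsCoprime u (2 ^ i) := fun i => hu.pow_right
  have h := norm_markoff_descent (P := 8) (h := 2 ^ (j + 1)) (d := 16) (n := 2 ^ (j + 2)) (u := u)
    (B := 512 * (1 / √2) ^ (3 * (j + 2))) (by norm_num) (by positivity) (by norm_num)
    ⟨2 ^ j, by ring⟩ (by ring) (by exact_mod_cast hpow 4)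
    (fun x y z => exists_criticalPoint_of_two)
    fun α β γ hs => norm_cubicMean_le_of_two hu hs _ _ (by norm_num)
  rw [show (2 : ℕ) ^ (j + 8) = 8 * (8 * 2 ^ (j + 2)) by ring]
  refine h.trans ?_
  have h8 : ((8 : ℕ) : ℝ) ^ 3 = 512 := by norm_num
  have h18 : (1 / √(2 : ℝ)) ^ 18 = 1 / 512 := by
    rw [show (18 : ℕ) = 2 * 9 by norm_num, pow_mul, hsq]; norm_num
  have : (1 / √(2 : ℝ)) ^ (3 * (j + 8)) = 1 / 512 * (1 / √2) ^ (3 * (j + 2)) := by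
    rw [← h18]; ring
  rw [h8, this]
  have h0 : (0 : ℝ) ≤ (1 / √2) ^ (3 * (j + 2)) := by positivity
  linarith

end Markoff

/-! ### Local densities of the Markoff cubic and the coefficients of the singular series -/

theorem avg_ofReal (q : ℕ) (f : ℤ → ℝ) : ((avg q f : ℝ) : ℂ) = avg q (fun x => (f x : ℂ)) := by
  simp [avg]

theorem avgThree_ofReal (q : ℕ) (f : ℤ → ℤ → ℤ → ℝ) :
    ((avgThree q f : ℝ) : ℂ) = avgThree q (fun x y z => (f x y z : ℂ)) := by
  simp only [avgThree, avg_ofReal]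

theorem avgThree_mul_left (q : ℕ) (c : ℝ) (f : ℤ → ℤ → ℤ → ℝ) :
    avgThree q (fun x y z => c * f x y z) = c * avgThree q f :=
  avgThree_smul q c f

theorem sum_Icc_one_eq {E : Type*} [AddCommGroup E] {N : ℕ} {f : ℤ → E}
    (hf : Function.Periodic f N) :
    ∑ x ∈ Finset.Icc (1 : ℤ) N, f x = ∑ x ∈ Finset.range N, f x := by
  rw [← sum_range_shift hf 1]
  symm
  refine Finset.sum_nbij' (fun x : ℕ => (x : ℤ) + 1) (fun x : ℤ => (x - 1).toNat) ?_ ?_ ?_ ?_ ?_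
  · intro x hx
    rw [Finset.mem_range] at hx
    rw [Finset.mem_Icc]
    omega
  · intro x hx
    rw [Finset.mem_Icc] at hx
    rw [Finset.mem_range]
    omega
  · intro x _
    simp
  · intro x hx
    rw [Finset.mem_Icc] at hx
    omega
  · intro x _
    rfl

namespace Markoff

/-- Ramanujan's sum. -/
noncomputable def ramanujan (d : ℕ) (t : ℤ) : ℂ :=
  ∑ u ∈ (Finset.Icc 1 d).filter (fun u : ℕ => Nat.gcd u d = 1), e d (u * t)

/-- Sort the fractions `v/m` by their denominator `d` in lowest terms, then use orthogonality. -/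
theorem sum_ramanujan {m : ℕ} (hm : m ≠ 0) (t : ℤ) :
    ∑ d ∈ m.divisors, ramanujan d t = if (m : ℤ) ∣ t then (m : ℂ) else 0 := by
  rw [← sum_e_mul hm]
  have hper : Function.Periodic (fun x : ℤ => e m (t * x)) m := fun x => by
    simp only
    rw [mul_add, e_add, mul_comm t m, e_mul_self, mul_one]
  rw [← sum_range_shift hper 1]
  have h1 : ∑ x ∈ Finset.range m, e m (t * ((x : ℤ) + 1)) =
      ∑ v ∈ Finset.Icc 1 m, e m (t * (v : ℕ)) := by
    have h2 := Finset.sum_Ico_add' (fun x : ℕ => e m (t * (x : ℤ))) 0 m 1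
    push_cast at h2
    rw [Finset.range_eq_Ico, h2]
    refine Finset.sum_congr ?_ fun _ _ => rfl
    ext v
    simp only [Finset.mem_Ico, Finset.mem_Icc]
    omega
  rw [h1]
  simp only [ramanujan]
  rw [Finset.sum_sigma']
  refine Finset.sum_bij' (fun x _ => x.2 * (m / x.1))
    (fun v _ => ⟨m / Nat.gcd v m, v / Nat.gcd v m⟩) ?_ ?_ ?_ ?_ ?_
  · rintro ⟨d, u⟩ h
    simp only [Finset.mem_sigma, Nat.mem_divisors, Finset.mem_filter, Finset.mem_Icc] at h ⊢
    obtain ⟨⟨hd, _⟩, ⟨hu1, hu2⟩, _⟩ := h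
    obtain ⟨n, rfl⟩ := hd
    have hd0 : 0 < d := by omega
    have hn0 : 0 < n := Nat.pos_of_ne_zero (right_ne_zero_of_mul hm)
    rw [Nat.mul_div_cancel_left _ hd0]
    exact ⟨Nat.mul_pos hu1 hn0, Nat.mul_le_mul_right _ hu2⟩
  · intro v hv
    simp only [Finset.mem_sigma, Nat.mem_divisors, Finset.mem_filter, Finset.mem_Icc] at hv ⊢
    have hg : 0 < Nat.gcd v m := Nat.gcd_pos_of_pos_right _ (Nat.pos_of_ne_zero hm)
    refine ⟨⟨Nat.div_dvd_of_dvd (Nat.gcd_dvd_right v m), hm⟩, ⟨?_, Nat.div_le_div_right hv.2⟩, ?_⟩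
    · exact Nat.div_pos (Nat.le_of_dvd (by omega) (Nat.gcd_dvd_left v m)) hg
    · exact Nat.coprime_div_gcd_div_gcd hg
  · rintro ⟨d, u⟩ h
    simp only [Finset.mem_sigma, Nat.mem_divisors, Finset.mem_filter, Finset.mem_Icc] at h
    obtain ⟨⟨hd, _⟩, ⟨hu1, hu2⟩, hcop⟩ := h
    obtain ⟨n, rfl⟩ := hd
    have hd0 : 0 < d := by omega
    have hn0 : 0 < n := Nat.pos_of_ne_zero (right_ne_zero_of_mul hm)
    have hg : Nat.gcd (u * n) (d * n) = n := by rw [Nat.gcd_mul_right, hcop, one_mul]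
    simp only [Nat.mul_div_cancel_left _ hd0, hg, Nat.mul_div_cancel _ hn0]
  · intro v hv
    have hg : 0 < Nat.gcd v m := Nat.gcd_pos_of_pos_right _ (Nat.pos_of_ne_zero hm)
    simp only
    rw [Nat.div_div_self (Nat.gcd_dvd_right v m) hm, Nat.div_mul_cancel (Nat.gcd_dvd_left v m)]
  · rintro ⟨d, u⟩ h
    simp only [Finset.mem_sigma, Nat.mem_divisors, Finset.mem_filter, Finset.mem_Icc] at h
    obtain ⟨⟨hd, _⟩, ⟨hu1, hu2⟩, hcop⟩ := h
    obtain ⟨n, rfl⟩ := hd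
    have hd0 : 0 < d := by omega
    have hn0 : n ≠ 0 := right_ne_zero_of_mul hm
    simp only [Nat.mul_div_cancel_left _ hd0]
    rw [← e_mul_mul hn0, mul_comm n d]
    congr 1
    push_cast
    ring

open Classical in
/-- The density of solutions of `M = a` modulo `m`. -/
noncomputable def density (a : ℤ) (m : ℕ) : ℝ :=
  m * avgThree m (fun x y z => if (m : ℤ) ∣ M x y z - a then (1 : ℝ) else 0)

theorem M_modEq {N : ℕ} {x x' y y' z z' : ℤ} (hx : x ≡ x' [ZMOD N])
    (hy : y ≡ y' [ZMOD N]) (hz : z ≡ z' [ZMOD N]) : M x y z ≡ M x' y' z' [ZMOD N] := by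
  unfold M
  gcongr

theorem periodicThree_M {E : Type*} (N : ℕ) {f : ℤ → E} (hf : Function.Periodic f N) :
    PeriodicThree N (fun x y z => f (M x y z)) := by
  intro x y z
  refine ⟨?_, ?_, ?_⟩ <;> refine periodic_eq_of_modEq hf (M_modEq ?_ ?_ ?_)
  all_goals simp [Int.ModEq]

open Classical in
theorem periodic_dvd_sub {E : Type*} (N : ℕ) (a : ℤ) (s t : E) :
    Function.Periodic (fun x : ℤ => if (N : ℤ) ∣ x - a then s else t) N := by
  intro x
  simp only [add_sub_right_comm, dvd_add_self_right]

theorem periodic_ramanujan (d : ℕ) : Function.Periodic (ramanujan d) d := by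
  intro t
  simp only [ramanujan]
  refine Finset.sum_congr rfl fun u _ => ?_
  rw [mul_add, e_add, mul_comm (u : ℤ) d, e_mul_self, mul_one]

/-- The local densities as an arithmetic function. -/
noncomputable def densityFun (a : ℤ) : ArithmeticFunction ℝ :=
  ⟨fun m => density a m, by simp [density]⟩

/-- The coefficients of the singular series. -/
noncomputable def coeff (a : ℤ) : ArithmeticFunction ℝ :=
  ((ArithmeticFunction.moebius : ArithmeticFunction ℤ) : ArithmeticFunction ℝ) * densityFun a

theorem sum_divisors_coeff (a : ℤ) (m : ℕ) : ∑ d ∈ m.divisors, coeff a d = density a m := by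
  rw [← ArithmeticFunction.coe_zeta_mul_apply, coeff, ← mul_assoc,
    ArithmeticFunction.coe_zeta_mul_coe_moebius, one_mul]
  rfl

theorem isMultiplicative_densityFun (a : ℤ) : (densityFun a).IsMultiplicative := by
  classical
  refine ⟨by simp [densityFun, density, avgThree_const], fun {m n} h => ?_⟩
  change density a (m * n) = density a m * density a n
  simp only [density]
  have h1 := avgThree_mul_of_coprime h
    (periodicThree_M m (periodic_dvd_sub m a (1 : ℝ) 0))
    (periodicThree_M n (periodic_dvd_sub n a (1 : ℝ) 0))
  have h2 : ∀ x y z : ℤ, (if ((m * n : ℕ) : ℤ) ∣ M x y z - a then (1 : ℝ) else 0) =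
      (if (m : ℤ) ∣ M x y z - a then (1 : ℝ) else 0) * (if (n : ℤ) ∣ M x y z - a then (1 : ℝ) else 0) := by
    intro x y z
    have : ((m * n : ℕ) : ℤ) ∣ M x y z - a ↔ (m : ℤ) ∣ M x y z - a ∧ (n : ℤ) ∣ M x y z - a := by
      push_cast
      exact ⟨fun hd => ⟨dvd_of_mul_right_dvd hd, dvd_of_mul_left_dvd hd⟩, fun hd =>
        IsCoprime.mul_dvd (Nat.isCoprime_iff_coprime.2 h) hd.1 hd.2⟩
    rw [if_congr this rfl rfl, ite_and]
    split_ifs <;> simp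
  simp only [h2, h1]
  push_cast
  ring

theorem isMultiplicative_coeff (a : ℤ) : (coeff a).IsMultiplicative :=
  ArithmeticFunction.isMultiplicative_moebius.intCast.mul (isMultiplicative_densityFun a)

theorem coeff_prime_pow_succ {p : ℕ} (hp : p.Prime) (a : ℤ) (k : ℕ) :
    coeff a (p ^ (k + 1)) = density a (p ^ (k + 1)) - density a (p ^ k) := by
  rw [← sum_divisors_coeff, ← sum_divisors_coeff, Nat.sum_divisors_prime_pow hp,
    Nat.sum_divisors_prime_pow hp, Finset.sum_range_succ _ (k + 1)]
  ring

theorem periodic_density (m : ℕ) : Function.Periodic (fun a => density a m) m := by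
  intro a
  simp only [density]
  congr 1
  refine avgThree_congr fun x y z => ?_
  simp only [← sub_sub, dvd_sub_self_right]

theorem periodic_coeff {p : ℕ} (hp : p.Prime) (k : ℕ) :
    Function.Periodic (fun a => coeff a (p ^ k)) (p ^ k : ℕ) := by
  cases k with
  | zero => intro a; simp [(isMultiplicative_coeff _).map_one]
  | succ k =>
    intro a
    simp only [coeff_prime_pow_succ hp]
    congr 1
    · exact periodic_density _ a
    · exact periodic_of_dvd (periodic_density (p ^ k)) ⟨p, pow_succ _ _⟩ a

/-- The mean value of a shifted Ramanujan sum is a coefficient of the singular series. -/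
theorem avgThree_ramanujan {m : ℕ} (hm : m ≠ 0) (a : ℤ) :
    avgThree m (fun x y z => ramanujan m (M x y z - a)) = (coeff a m : ℂ) := by
  classical
  induction m using Nat.strong_induction_on with
  | _ m ih =>
    have hper : ∀ d ∈ m.divisors, PeriodicThree d (fun x y z => ramanujan d (M x y z - a)) := by
      intro d _
      refine periodicThree_M d (f := fun t => ramanujan d (t - a)) fun t => ?_
      simp only
      rw [add_sub_right_comm, periodic_ramanujan]
    have h1 : ∑ d ∈ m.divisors, avgThree d (fun x y z => ramanujan d (M x y z - a)) =
        (density a m : ℂ) := by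
      have h2 : ∀ d ∈ m.divisors, avgThree d (fun x y z => ramanujan d (M x y z - a)) =
          avgThree m (fun x y z => ramanujan d (M x y z - a)) := fun d hd =>
        (avgThree_of_dvd (hper d hd) hm (Nat.dvd_of_mem_divisors hd)).symm
      rw [Finset.sum_congr rfl h2, ← avgThree_sum]
      simp only [sum_ramanujan hm, density]
      rw [Complex.ofReal_mul, avgThree_ofReal, Complex.ofReal_natCast, ← avgThree_const_mul]
      refine avgThree_congr fun x y z => ?_
      split_ifs <;> simp
    rw [← sum_divisors_coeff, ← Nat.insert_self_properDivisors hm,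
      Finset.sum_insert Nat.self_notMem_properDivisors,
      Finset.sum_insert Nat.self_notMem_properDivisors, Complex.ofReal_add, Complex.ofReal_sum] at h1
    rw [Finset.sum_congr rfl fun d hd => ih d (Nat.mem_properDivisors.1 hd).2 (by
      rintro rfl
      exact hm (zero_dvd_iff.1 (Nat.mem_properDivisors.1 hd).1))] at h1
    exact add_right_cancel h1

theorem T_eq_coeff {m : ℕ} (hm : m ≠ 0) (a : ℤ) : ((m : ℂ) ^ 3)⁻¹ * T a m = (coeff a m : ℂ) := by
  rw [← avgThree_ramanujan hm a]
  simp only [ramanujan]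
  rw [avgThree_sum, T, Finset.mul_sum]
  refine Finset.sum_congr rfl fun u _ => ?_
  have hper : PeriodicThree m (fun x y z => e m ((u : ℤ) * (M x y z - a))) := by
    refine periodicThree_M m (f := fun t => e m (u * (t - a))) fun t => ?_
    simp only
    rw [add_sub_right_comm, mul_add, e_add, mul_comm (u : ℤ) m, e_mul_self, mul_one]
  have h1 : ∀ x y : ℤ, ∑ z ∈ Finset.Icc (1 : ℤ) m, e m ((u : ℤ) * (M x y z - a)) =
      ∑ z ∈ Finset.range m, e m ((u : ℤ) * (M x y z - a)) := fun x y =>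
    sum_Icc_one_eq (hper.periodic_last x y)
  have h2 : ∀ x : ℤ, ∑ y ∈ Finset.Icc (1 : ℤ) m, ∑ z ∈ Finset.range m, e m ((u : ℤ) * (M x y z - a))
      = ∑ y ∈ Finset.range m, ∑ z ∈ Finset.range m, e m ((u : ℤ) * (M x y z - a)) := fun x =>
    sum_Icc_one_eq fun y => Finset.sum_congr rfl fun z _ => (hper x y z).2.1
  have h3 : ∑ x ∈ Finset.Icc (1 : ℤ) m, ∑ y ∈ Finset.range m, ∑ z ∈ Finset.range m,
      e m ((u : ℤ) * (M x y z - a)) = ∑ x ∈ Finset.range m, ∑ y ∈ Finset.range m,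
      ∑ z ∈ Finset.range m, e m ((u : ℤ) * (M x y z - a)) :=
    sum_Icc_one_eq fun x => Finset.sum_congr rfl fun y _ => Finset.sum_congr rfl fun z _ =>
      (hper x y z).1
  simp only [h1, h2, h3, avgThree, avg, Complex.real_smul, ← Finset.mul_sum, ← mul_assoc]
  congr 1
  push_cast
  rw [← mul_inv, ← mul_inv]
  ring

theorem s_eq_sum_coeff (a : ℤ) (K : ℕ) : s a K = ((∑ m ∈ Finset.Icc 1 K, coeff a m : ℝ) : ℂ) := by
  rw [s, Complex.ofReal_sum]
  refine Finset.sum_congr rfl fun m hm => T_eq_coeff ?_ a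
  have := Finset.mem_Icc.1 hm
  omega

theorem M_eq_cubic (x y z : ℤ) : M x y z = cubic 0 0 0 (-1) x y z := by
  simp only [M, cubic]; ring

/-- This is the finite Fourier expansion in `a`: the Fourier coefficients are the exponential sums
already bounded, so suprema follow from the triangle inequality and mean squares from Parseval. -/
theorem coeff_eq_sum_cubicMean {m : ℕ} (hm : m ≠ 0) (a : ℤ) :
    (coeff a m : ℂ) = ∑ u ∈ (Finset.Icc 1 m).filter (fun u : ℕ => Nat.gcd u m = 1),
      e m (-(u * a)) * cubicMean 0 0 0 (-1) m u := by
  rw [← avgThree_ramanujan hm]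
  simp only [ramanujan]
  rw [avgThree_sum]
  refine Finset.sum_congr rfl fun u _ => ?_
  rw [cubicMean, ← avgThree_const_mul]
  refine avgThree_congr fun x y z => ?_
  rw [← e_add, M_eq_cubic]
  congr 1
  ring

theorem abs_coeff_le {m : ℕ} (hm : m ≠ 0) {B : ℝ} (hB0 : 0 ≤ B)
    (hB : ∀ u : ℕ, Nat.gcd u m = 1 → ‖cubicMean 0 0 0 (-1) m u‖ ≤ B) (a : ℤ) :
    |coeff a m| ≤ m * B := by
  rw [← Real.norm_eq_abs, ← Complex.norm_real, coeff_eq_sum_cubicMean hm]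
  refine (norm_sum_le _ _).trans ?_
  calc _ ≤ ∑ u ∈ (Finset.Icc 1 m).filter (fun u : ℕ => Nat.gcd u m = 1), B := by
        refine Finset.sum_le_sum fun u hu => ?_
        rw [norm_mul, norm_e, one_mul]
        exact hB u (Finset.mem_filter.1 hu).2
    _ ≤ ∑ u ∈ Finset.Icc 1 m, B :=
        Finset.sum_le_sum_of_subset_of_nonneg (Finset.filter_subset _ _) fun _ _ _ => hB0
    _ = m * B := by simp

/-- Parseval: the frequencies `u` are distinct modulo `m`, so off-diagonal terms average to zero.
This saves a factor `m` over squaring the pointwise bound. -/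
theorem avg_coeff_sq_le {m : ℕ} (hm : m ≠ 0) {B : ℝ}
    (hB : ∀ u : ℕ, Nat.gcd u m = 1 → ‖cubicMean 0 0 0 (-1) m u‖ ≤ B) :
    avg m (fun a => coeff a m ^ 2) ≤ m * B ^ 2 := by
  set U := (Finset.Icc 1 m).filter (fun u : ℕ => Nat.gcd u m = 1) with hU
  have h1 : ∀ a : ℤ, ((coeff a m ^ 2 : ℝ) : ℂ) = ∑ u ∈ U, ∑ v ∈ U,
      (cubicMean 0 0 0 (-1) m u * (starRingEnd ℂ) (cubicMean 0 0 0 (-1) m v)) *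
        e m (((v : ℤ) - u) * a) := by
    intro a
    have h2 : (starRingEnd ℂ) (coeff a m : ℂ) = (coeff a m : ℂ) := Complex.conj_ofReal _
    rw [Complex.ofReal_pow, sq]
    nth_rewrite 2 [← h2]
    rw [coeff_eq_sum_cubicMean hm, map_sum, Finset.sum_mul_sum]
    refine Finset.sum_congr rfl fun u _ => Finset.sum_congr rfl fun v _ => ?_
    rw [map_mul, ← e_neg, neg_neg, show ((v : ℤ) - u) * a = -(u * a) + v * a by ring, e_add]
    ring
  have h3 : ((avg m (fun a => coeff a m ^ 2) : ℝ) : ℂ) =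
      ((∑ u ∈ U, ‖cubicMean 0 0 0 (-1) m u‖ ^ 2 : ℝ) : ℂ) := by
    rw [avg_ofReal]
    simp only [h1]
    rw [avg_sum, Complex.ofReal_sum]
    refine Finset.sum_congr rfl fun u hu => ?_
    rw [avg_sum, Finset.sum_eq_single_of_mem u hu]
    · rw [avg_const_mul]
      simp only [sub_self, zero_mul, e_zero, avg_const hm, mul_one]
      rw [Complex.mul_conj, Complex.normSq_eq_norm_sq]
    · intro v hv hvu
      rw [avg_const_mul, avg_e_mul, mul_zero]
      intro hd
      have hu' := Finset.mem_Icc.1 (Finset.mem_filter.1 hu).1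
      have hv' := Finset.mem_Icc.1 (Finset.mem_filter.1 hv).1
      have : |(v : ℤ) - u| < m := by rw [abs_lt]; omega
      have := Int.eq_zero_of_abs_lt_dvd hd this
      omega
  rw [Complex.ofReal_inj.1 h3]
  calc _ ≤ ∑ u ∈ U, B ^ 2 := by
        refine Finset.sum_le_sum fun u hu => ?_
        gcongr
        exact hB u (Finset.mem_filter.1 hu).2
    _ ≤ ∑ u ∈ Finset.Icc 1 m, B ^ 2 :=
        Finset.sum_le_sum_of_subset_of_nonneg (Finset.filter_subset _ _) fun _ _ _ => by positivity
    _ = m * B ^ 2 := by simp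

/-- Every triple solves the congruence for exactly one residue class of `a`. -/
theorem avg_density {m : ℕ} (hm : m ≠ 0) : avg m (fun a => density a m) = 1 := by
  classical
  have hm' : (m : ℝ) ≠ 0 := by exact_mod_cast hm
  simp only [density]
  rw [avg_mul_left, avg_avgThree_comm]
  have h1 : ∀ t : ℤ, avg m (fun a => if (m : ℤ) ∣ t - a then (1 : ℝ) else 0) = (m : ℝ)⁻¹ := by
    intro t
    rw [← avg_shift (f := fun a => if (m : ℤ) ∣ t - a then (1 : ℝ) else 0) (fun a => by
      simp only [← sub_sub, dvd_sub_self_right]) t, avg_eq_single (Nat.pos_of_ne_zero hm)]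
    · simp
    · intro x hx
      simp [hx]
  simp only [h1]
  rw [avgThree_const hm, mul_inv_cancel₀ hm']

theorem avg_coeff_eq_zero {p : ℕ} (hp : p.Prime) (k : ℕ) :
    avg (p ^ (k + 1)) (fun a => coeff a (p ^ (k + 1))) = 0 := by
  have hp1 := pow_ne_zero (k + 1) hp.ne_zero
  simp only [coeff_prime_pow_succ hp, sub_eq_add_neg]
  rw [avg_add, avg_neg, avg_density hp1,
    avg_of_dvd (periodic_density (p ^ k)) hp1 ⟨p, pow_succ _ _⟩,
    avg_density (pow_ne_zero k hp.ne_zero), add_neg_cancel]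

end Markoff

/-! ### Quadratic character sums -/

section

variable {p : ℕ} [Fact p.Prime]

theorem ringChar_zmod_ne_two (hp2 : p ≠ 2) : ringChar (ZMod p) ≠ 2 := by
  rwa [ZMod.ringChar_zmod_n]

theorem abs_quadraticChar_le_one (t : ZMod p) : |quadraticChar (ZMod p) t| ≤ 1 := by
  rcases quadraticChar_isQuadratic (ZMod p) t with h | h | h <;> simp [h]

theorem sum_ite_sq_eq (hp2 : p ≠ 2) (b : ZMod p) :
    ∑ x : ZMod p, (if x ^ 2 = b then (1 : ℤ) else 0) = quadraticChar (ZMod p) b + 1 := by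
  rw [← quadraticChar_card_sqrts (ringChar_zmod_ne_two hp2) b, Finset.sum_boole]
  congr 2
  ext x
  simp

/-- The number of roots of a monic quadratic polynomial. -/
theorem sum_ite_quadratic_eq (hp2 : p ≠ 2) (b c : ZMod p) :
    ∑ z : ZMod p, (if z ^ 2 - b * z + c = 0 then (1 : ℤ) else 0) =
      quadraticChar (ZMod p) (b ^ 2 - 4 * c) + 1 := by
  have h2 : (2 : ZMod p) ≠ 0 := by
    intro h0
    have : p ∣ 2 := (ZMod.natCast_eq_zero_iff 2 p).1 (by exact_mod_cast h0)
    exact hp2 ((Nat.prime_dvd_prime_iff_eq Fact.out Nat.prime_two).1 this)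
  have h4 : (4 : ZMod p) ≠ 0 := by
    rw [show (4 : ZMod p) = 2 * 2 by norm_num]; exact mul_ne_zero h2 h2
  rw [← sum_ite_sq_eq hp2]
  refine Fintype.sum_bijective (fun z => 2 * z - b) ⟨?_, ?_⟩ _ _ fun z => ?_
  · intro z w h
    exact mul_left_cancel₀ h2 (sub_left_inj.1 h)
  · intro w
    refine ⟨(w + b) / 2, ?_⟩
    field_simp
    ring
  · have : z ^ 2 - b * z + c = 0 ↔ (2 * z - b) ^ 2 = b ^ 2 - 4 * c := by
      rw [← sub_eq_zero (a := (2 * z - b) ^ 2), show (2 * z - b) ^ 2 - (b ^ 2 - 4 * c) =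
        4 * (z ^ 2 - b * z + c) by ring, mul_eq_zero]
      simp [h4]
    rw [if_congr this rfl rfl]

/-- Substituting `t = y²`, which is attained `χ(t) + 1` times, reduces the sum to the Jacobi sum
`J(χ, χ) = -χ(-1)`. -/
theorem abs_sum_quadraticChar_quadratic_le (hp2 : p ≠ 2) {D n : ZMod p} (hD : D ≠ 0) (hn : n ≠ 0) :
    |∑ y : ZMod p, quadraticChar (ZMod p) (D * y ^ 2 + n)| ≤ 1 := by
  set χ := quadraticChar (ZMod p) with hχ
  have hχ1 : χ ≠ 1 := quadraticChar_ne_one (ringChar_zmod_ne_two hp2)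
  have h1 : ∑ y : ZMod p, χ (D * y ^ 2 + n) = ∑ t : ZMod p, χ (D * t + n) * (χ t + 1) := by
    simp only [hχ, ← sum_ite_sq_eq hp2, Finset.mul_sum]
    rw [Finset.sum_comm]
    refine Finset.sum_congr rfl fun y _ => ?_
    simp
  have h2 : ∑ t : ZMod p, χ (D * t + n) = 0 := by
    rw [← MulChar.sum_eq_zero_of_ne_one hχ1]
    refine Fintype.sum_bijective (fun t => D * t + n) ⟨?_, ?_⟩ _ _ fun z => rfl
    · intro z w h
      exact mul_left_cancel₀ hD (add_right_cancel h)
    · intro w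
      refine ⟨(w - n) / D, ?_⟩
      simp only
      rw [mul_div_cancel₀ _ hD]
      ring
  have h3 : ∑ t : ZMod p, χ (D * t + n) * χ t = χ (-(n / D)) * χ n * jacobiSum χ χ := by
    have hq : -(n / D) ≠ 0 := neg_ne_zero.2 (div_ne_zero hn hD)
    rw [jacobiSum, Finset.mul_sum]
    symm
    refine Fintype.sum_bijective (fun t => -(n / D) * t) ⟨?_, ?_⟩ _ _ fun t => ?_
    · intro z w h
      exact mul_left_cancel₀ hq h
    · intro w
      exact ⟨w / -(n / D), mul_div_cancel₀ _ hq⟩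
    · have : D * (-(n / D) * t) + n = n * (1 - t) := by field_simp; ring
      rw [this, map_mul, map_mul]
      ring
  have h4 : jacobiSum χ χ = -χ (-1) := by
    have := jacobiSum_nontrivial_inv hχ1
    rwa [(quadraticChar_isQuadratic (ZMod p)).inv] at this
  have h5 : ∑ y : ZMod p, χ (D * y ^ 2 + n) = χ (-(n / D)) * χ n * -χ (-1) := by
    rw [h1]
    simp only [mul_add, mul_one]
    rw [Finset.sum_add_distrib, h2, add_zero, h3, h4]
  rw [h5, abs_mul, abs_mul, abs_neg]
  exact mul_le_one₀ (mul_le_one₀ (abs_quadraticChar_le_one _) (abs_nonneg _)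
    (abs_quadraticChar_le_one _)) (abs_nonneg _) (abs_quadraticChar_le_one _)

theorem avg_zmod (g : ZMod p → ℝ) : avg p (fun x : ℤ => g x) = (p : ℝ)⁻¹ * ∑ t : ZMod p, g t := by
  rw [avg, smul_eq_mul]
  congr 1
  refine Finset.sum_bij' (fun x _ => (x : ZMod p)) (fun t _ => t.val) ?_ ?_ ?_ ?_ ?_
  · simp
  · intro t _
    simpa using ZMod.val_lt t
  · intro x hx
    exact ZMod.val_natCast_of_lt (Finset.mem_range.1 hx)
  · intro t _
    exact ZMod.natCast_zmod_val t
  · simp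

/-- The number of points on a plane section of the Markoff cubic. -/
theorem sum_sum_ite_markoff (hp2 : p ≠ 2) (a x : ZMod p) :
    ∑ y : ZMod p, ∑ z : ZMod p, (if x ^ 2 + y ^ 2 + z ^ 2 - x * y * z - a = 0 then (1 : ℤ) else 0) =
      p + ∑ y : ZMod p, quadraticChar (ZMod p) ((x ^ 2 - 4) * y ^ 2 + 4 * (a - x ^ 2)) := by
  have h : ∀ y : ZMod p, ∑ z : ZMod p,
      (if x ^ 2 + y ^ 2 + z ^ 2 - x * y * z - a = 0 then (1 : ℤ) else 0) =
      quadraticChar (ZMod p) ((x ^ 2 - 4) * y ^ 2 + 4 * (a - x ^ 2)) + 1 := by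
    intro y
    -- The equation is monic quadratic in `z`; this is its discriminant.
    rw [show (x ^ 2 - 4) * y ^ 2 + 4 * (a - x ^ 2) = (x * y) ^ 2 - 4 * (x ^ 2 + y ^ 2 - a) by ring,
      ← sum_ite_quadratic_eq hp2]
    refine Finset.sum_congr rfl fun z _ => ?_
    rw [show x ^ 2 + y ^ 2 + z ^ 2 - x * y * z - a = z ^ 2 - x * y * z + (x ^ 2 + y ^ 2 - a) by ring]
  simp only [h, Finset.sum_add_distrib]
  simp [add_comm]

end

namespace Markoff

theorem dvd_M_sub_iff (p : ℕ) (x y z a : ℤ) : (p : ℤ) ∣ M x y z - a ↔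
    (x : ZMod p) ^ 2 + (y : ZMod p) ^ 2 + (z : ZMod p) ^ 2 - x * y * z - a = 0 := by
  rw [← ZMod.intCast_zmod_eq_zero_iff_dvd, M]
  push_cast
  rfl

/-- Fibre over `x`. The number of points of the fibre deviates from `p` by at most `1`, unless `x² =
4` or `x² = a`; these at most four values of `x` deviate by at most `p`. Averaging gives `1/p +
4/p`. -/
theorem abs_coeff_prime_le {p : ℕ} (hp : p.Prime) (hp2 : p ≠ 2) (a : ℤ) : |coeff a p| ≤ 5 / p := by
  classical
  have := Fact.mk hp
  have hp0 : (0 : ℝ) < p := by exact_mod_cast hp.pos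
  have h4 : (4 : ZMod p) ≠ 0 := by
    have h2 : (2 : ZMod p) ≠ 0 := by
      intro h0
      have : p ∣ 2 := (ZMod.natCast_eq_zero_iff 2 p).1 (by exact_mod_cast h0)
      exact hp2 ((Nat.prime_dvd_prime_iff_eq hp Nat.prime_two).1 this)
    rw [show (4 : ZMod p) = 2 * 2 by norm_num]; exact mul_ne_zero h2 h2
  set J : ZMod p → ℤ := fun x =>
    ∑ y : ZMod p, quadraticChar (ZMod p) ((x ^ 2 - 4) * y ^ 2 + 4 * (a - x ^ 2)) with hJ
  have hJp : ∀ x, |J x| ≤ p := by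
    intro x
    refine (Finset.abs_sum_le_sum_abs _ _).trans ?_
    refine (Finset.sum_le_sum fun y _ => abs_quadraticChar_le_one _).trans ?_
    simp
  have hJ1 : ∀ x : ZMod p, x ^ 2 ≠ 4 → x ^ 2 ≠ a → |J x| ≤ 1 := fun x h1 h2 =>
    abs_sum_quadraticChar_quadratic_le hp2 (sub_ne_zero.2 h1) (mul_ne_zero h4 (sub_ne_zero.2 h2.symm))
  have hcoeff : coeff a p = avg p (fun x : ℤ => (p : ℝ)⁻¹ * J x) := by
    have h1 := coeff_prime_pow_succ hp a 0
    rw [zero_add, pow_one, pow_zero] at h1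
    have h2 : density a 1 = 1 := by simp [density, avgThree_const]
    have h3 : ∀ x : ℤ, (p : ℝ) * avg p (fun y : ℤ => avg p (fun z : ℤ =>
        if (p : ℤ) ∣ M x y z - a then (1 : ℝ) else 0)) = 1 + (p : ℝ)⁻¹ * J x := by
      intro x
      have h4 : ∀ y : ℤ, avg p (fun z : ℤ => if (p : ℤ) ∣ M x y z - a then (1 : ℝ) else 0) =
          (p : ℝ)⁻¹ * ∑ z : ZMod p, if (x : ZMod p) ^ 2 + (y : ZMod p) ^ 2 + z ^ 2 - x * y * z - a = 0
            then (1 : ℝ) else 0 := by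
        intro y
        rw [← avg_zmod]
        refine avg_congr fun z => ?_
        rw [if_congr (dvd_M_sub_iff p x y z a) rfl rfl]
      simp only [h4]
      rw [avg_zmod (fun y : ZMod p => (p : ℝ)⁻¹ * ∑ z : ZMod p,
        if (x : ZMod p) ^ 2 + y ^ 2 + z ^ 2 - x * y * z - a = 0 then (1 : ℝ) else 0),
        ← Finset.mul_sum]
      have h5 : ∑ y : ZMod p, ∑ z : ZMod p,
          (if (x : ZMod p) ^ 2 + y ^ 2 + z ^ 2 - x * y * z - a = 0 then (1 : ℤ) else 0) = p + J x :=
        sum_sum_ite_markoff hp2 (a : ZMod p) (x : ZMod p)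
      have h6 : ∑ y : ZMod p, ∑ z : ZMod p,
          (if (x : ZMod p) ^ 2 + y ^ 2 + z ^ 2 - x * y * z - a = 0 then (1 : ℝ) else 0) = p + J x := by
        exact_mod_cast congrArg (fun t : ℤ => (t : ℝ)) h5
      rw [h6]
      field_simp
    rw [h1, h2, density, avgThree, ← avg_mul_left]
    simp only [h3]
    rw [avg_add, avg_const hp.ne_zero]
    ring
  have hsq : ∀ b : ZMod p, avg p (fun x : ℤ => if (x : ZMod p) ^ 2 = b then (1 : ℝ) else 0) ≤ 2 / p := by
    intro b
    rw [avg_zmod (fun x : ZMod p => if x ^ 2 = b then (1 : ℝ) else 0)]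
    have h1 : ∑ x : ZMod p, (if x ^ 2 = b then (1 : ℝ) else 0) =
        ((quadraticChar (ZMod p) b + 1 : ℤ) : ℝ) := by
      rw [← sum_ite_sq_eq hp2]
      push_cast
      rfl
    have h2 : ((quadraticChar (ZMod p) b + 1 : ℤ) : ℝ) ≤ 2 := by
      have := (abs_le.1 (abs_quadraticChar_le_one b)).2
      exact_mod_cast (by omega : quadraticChar (ZMod p) b + 1 ≤ 2)
    rw [h1, div_eq_inv_mul]
    gcongr
  have hpt : ∀ x : ℤ, |(p : ℝ)⁻¹ * J x| ≤ (p : ℝ)⁻¹ +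
      ((if (x : ZMod p) ^ 2 = 4 then (1 : ℝ) else 0) +
        (if (x : ZMod p) ^ 2 = a then (1 : ℝ) else 0)) := by
    intro x
    rw [abs_mul, abs_of_pos (inv_pos.2 hp0)]
    have h1 : (p : ℝ)⁻¹ * |(J x : ℝ)| ≤ 1 := by
      rw [inv_mul_le_iff₀ hp0, mul_one]
      exact_mod_cast hJp x
    have h0 : 0 < (p : ℝ)⁻¹ := inv_pos.2 hp0
    by_cases hx4 : (x : ZMod p) ^ 2 = 4
    · rw [if_pos hx4]
      split_ifs <;> linarith
    · by_cases hxa : (x : ZMod p) ^ 2 = a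
      · rw [if_pos hxa]
        split_ifs <;> linarith
      · rw [if_neg hx4, if_neg hxa, add_zero, add_zero]
        refine mul_le_of_le_one_right h0.le ?_
        exact_mod_cast hJ1 x hx4 hxa
  rw [hcoeff]
  refine (abs_avg_le _ _).trans ((avg_mono hpt).trans ?_)
  rw [avg_add, avg_add, avg_const hp.ne_zero]
  have e1 := hsq 4
  have e2 := hsq a
  have e3 : (p : ℝ)⁻¹ = 1 / p := (one_div _).symm
  rw [e3]
  have e4 : (5 : ℝ) / p = 1 / p + (2 / p + 2 / p) := by ring
  rw [e4]
  linarith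

/-! ### Lower bounds for local densities -/

theorem le_avg_single {q : ℕ} (hq : 0 < q) {f : ℤ → ℝ} (hf : ∀ x, 0 ≤ f x) :
    (q : ℝ)⁻¹ * f 0 ≤ avg q f := by
  rw [avg, smul_eq_mul]
  gcongr
  exact Finset.single_le_sum (f := fun x : ℕ => f x) (fun x _ => hf x)
    (Finset.mem_range.2 hq)

theorem le_avgThree_single {q : ℕ} (hq : 0 < q) {f : ℤ → ℤ → ℤ → ℝ} (hf : ∀ x y z, 0 ≤ f x y z) :
    ((q : ℝ) ^ 3)⁻¹ * f 0 0 0 ≤ avgThree q f := by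
  have h1 := le_avg_single hq (f := fun x => avg q (fun y => avg q (fun z => f x y z)))
    fun x => avg_nonneg fun y => avg_nonneg fun z => hf x y z
  have h2 := le_avg_single hq (f := fun y => avg q (fun z => f 0 y z))
    fun y => avg_nonneg fun z => hf 0 y z
  have h3 := le_avg_single hq (f := fun z => f 0 0 z) fun z => hf 0 0 z
  have hq' : (0 : ℝ) < (q : ℝ)⁻¹ := by positivity
  calc ((q : ℝ) ^ 3)⁻¹ * f 0 0 0 = (q : ℝ)⁻¹ * ((q : ℝ)⁻¹ * ((q : ℝ)⁻¹ * f 0 0 0)) := by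
        rw [← inv_pow]; ring
    _ ≤ (q : ℝ)⁻¹ * ((q : ℝ)⁻¹ * avg q (fun z => f 0 0 z)) := by gcongr
    _ ≤ (q : ℝ)⁻¹ * avg q (fun y => avg q (fun z => f 0 y z)) := by gcongr
    _ ≤ _ := h1

theorem ramanujan_prime_pow {p : ℕ} (hp : p.Prime) (k : ℕ) (t : ℤ) :
    ramanujan (p ^ (k + 1)) t = (if ((p ^ (k + 1) : ℕ) : ℤ) ∣ t then ((p ^ (k + 1) : ℕ) : ℂ) else 0) -
      (if ((p ^ k : ℕ) : ℤ) ∣ t then ((p ^ k : ℕ) : ℂ) else 0) := by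
  rw [← sum_ramanujan (pow_ne_zero _ hp.ne_zero), ← sum_ramanujan (pow_ne_zero _ hp.ne_zero),
    Nat.sum_divisors_prime_pow hp, Nat.sum_divisors_prime_pow hp, Finset.sum_range_succ _ (k + 1)]
  ring

theorem CriticalMod.of_add {α β γ c : ℤ} {d : ℕ} {r s t x y z : ℤ}
    (h : CriticalMod α β γ c d (r + d * x) (s + d * y) (t + d * z)) :
    CriticalMod α β γ c d r s t := by
  obtain ⟨⟨i, hi⟩, ⟨j, hj⟩, ⟨k, hk⟩⟩ := h
  exact ⟨⟨i - (2 * x + 2 * α * y + 2 * γ * z + c * (y * t + s * z + d * y * z)), by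
      linear_combination hi⟩,
    ⟨j - (2 * y + 2 * α * x + 2 * β * z + c * (x * t + r * z + d * x * z)), by
      linear_combination hj⟩,
    ⟨k - (2 * z + 2 * β * y + 2 * γ * x + c * (x * s + r * y + d * x * y)), by
      linear_combination hk⟩⟩

open Classical in
/-- The indicator of `n ≡ a mod m`, normalized to mean value `1`. -/
noncomputable def congrWeight (m : ℕ) (a n : ℤ) : ℝ := if (m : ℤ) ∣ n - a then (m : ℝ) else 0

theorem congrWeight_nonneg (m : ℕ) (a n : ℤ) : 0 ≤ congrWeight m a n := by
  unfold congrWeight; split_ifs <;> positivity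

theorem periodic_congrWeight (m : ℕ) (a : ℤ) : Function.Periodic (congrWeight m a) m :=
  periodic_dvd_sub m a _ _

theorem ramanujan_eq_congrWeight_sub {p : ℕ} (hp : p.Prime) (k : ℕ) (a n : ℤ) :
    ramanujan (p ^ (k + 1)) (n - a) =
      ((congrWeight (p ^ (k + 1)) a n - congrWeight (p ^ k) a n : ℝ) : ℂ) := by
  have h : ∀ m : ℕ, ((congrWeight m a n : ℝ) : ℂ) = if (m : ℤ) ∣ n - a then (m : ℂ) else 0 := by
    intro m
    unfold congrWeight
    split_ifs <;> simp
  rw [ramanujan_prime_pow hp, Complex.ofReal_sub, h, h]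

theorem density_eq_avgThree_congrWeight (a : ℤ) (m : ℕ) :
    density a m = avgThree m (fun x y z => congrWeight m a (M x y z)) := by
  rw [density, ← avgThree_mul_left]
  refine avgThree_congr fun x y z => ?_
  unfold congrWeight
  split_ifs <;> simp

theorem avgThree_sub (q : ℕ) (f g : ℤ → ℤ → ℤ → ℝ) :
    avgThree q (fun x y z => f x y z - g x y z) = avgThree q f - avgThree q g := by
  simp only [avgThree, sub_eq_add_neg, avg_add, avg_neg]

theorem periodicThree_M_residue {E : Type*} (P N : ℕ) (r s t : ℤ) {f : ℤ → E}
    (hf : Function.Periodic f (P * N : ℕ)) :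
    PeriodicThree N (fun x y z => f (M (r + P * x) (s + P * y) (t + P * z))) := by
  intro x y z
  refine ⟨?_, ?_, ?_⟩ <;> refine periodic_eq_of_modEq hf (M_modEq ?_ ?_ ?_)
  all_goals first | exact add_mul_modEq _ _ _ _ | exact Int.ModEq.refl _

/-- In a residue class modulo `d = p ^ (v + 1)` without critical points modulo `d`, densities
modulo powers of `p` stabilize. -/
theorem avgThree_congrWeight_succ {p : ℕ} (hp : p.Prime) {v : ℕ} {a r s t : ℤ}
    (hcrit : ¬ CriticalMod 0 0 0 (-1) (p ^ (v + 1)) r s t) (i : ℕ) {d : ℕ} (hd : d = p ^ (v + 1)) :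
    avgThree (p ^ i * d) (fun x y z => congrWeight (d * (p ^ i * d)) a
      (M (r + d * x) (s + d * y) (t + d * z))) =
    avgThree (p ^ (v + i)) (fun x y z => congrWeight (d * p ^ (v + i)) a
      (M (r + d * x) (s + d * y) (t + d * z))) := by
  have hpi : p ^ i ≠ 0 := pow_ne_zero _ hp.ne_zero
  have hd0 : d ≠ 0 := hd ▸ pow_ne_zero _ hp.ne_zero
  have hper : PeriodicThree (p ^ (v + i)) (fun x y z => congrWeight (d * p ^ (v + i)) a
      (M (r + d * x) (s + d * y) (t + d * z))) :=
    periodicThree_M_residue d (p ^ (v + i)) r s t (periodic_congrWeight _ a)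
  have hdvd : p ^ (v + i) ∣ p ^ i * d := ⟨p, by rw [hd]; ring⟩
  rw [← avgThree_of_dvd hper (mul_ne_zero hpi hd0) hdvd]
  set k := 2 * v + 1 + i with hk
  have e1 : d * (p ^ i * d) = p ^ (k + 1) := by rw [hd, hk]; ring
  have e2 : d * p ^ (v + i) = p ^ k := by rw [hd, hk]; ring
  -- The difference of the weights at consecutive powers is a Ramanujan sum, and stationary phase
  -- kills each of its characters on a class without critical points.
  have h1 : avgThree (p ^ i * d) (fun x y z => ramanujan (p ^ (k + 1))
      (M (r + d * x) (s + d * y) (t + d * z) - a)) = 0 := by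
    simp only [ramanujan]
    rw [avgThree_sum]
    refine Finset.sum_eq_zero fun u hu => ?_
    have hcop : IsCoprime (u : ℤ) (d : ℤ) := by
      refine Nat.isCoprime_iff_coprime.2 ?_
      have : Nat.Coprime u (p ^ (k + 1)) := (Finset.mem_filter.1 hu).2
      exact Nat.Coprime.coprime_dvd_right ⟨_, e1.symm⟩ this
    have h2 := avgThree_e_cubic_eq_zero (α := 0) (β := 0) (γ := 0) (c := -1) (u := u)
      (P := d) (h := p ^ i) (d := d) hd0 hpi hd0 (Dvd.intro _ rfl) hcop (r := r) (s := s) (t := t)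
      (fun x y z hc => hcrit (hd ▸ hc.of_add))
    rw [e1] at h2
    have h3 : ∀ x y z : ℤ, e (p ^ (k + 1)) (u * (M (r + d * x) (s + d * y) (t + d * z) - a)) =
        e (p ^ (k + 1)) (-(u * a)) * e (p ^ (k + 1)) (u * cubic 0 0 0 (-1)
          (r + d * x) (s + d * y) (t + d * z)) := by
      intro x y z
      rw [← e_add, M_eq_cubic]
      congr 1
      ring
    simp only [h3]
    rw [avgThree_const_mul, h2, mul_zero]
  simp only [ramanujan_eq_congrWeight_sub hp] at h1
  rw [← avgThree_ofReal, Complex.ofReal_eq_zero, avgThree_sub] at h1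
  rw [e1, e2]
  exact sub_eq_zero.1 h1

/-- Hensel's lemma for the Markoff cubic, in terms of densities. -/
theorem le_density_prime_pow {p : ℕ} (hp : p.Prime) {v : ℕ} {a r s t : ℤ}
    (hcrit : ¬ CriticalMod 0 0 0 (-1) (p ^ (v + 1)) r s t)
    (hsol : ((p ^ (2 * v + 1) : ℕ) : ℤ) ∣ M r s t - a) (j : ℕ) :
    ((p : ℝ) ^ (4 * v + 2))⁻¹ ≤ density a (p ^ (2 * v + 1 + j)) := by
  have hp0 : (0 : ℝ) < p := by exact_mod_cast hp.pos
  have hpn : ∀ k, p ^ k ≠ 0 := fun k => pow_ne_zero k hp.ne_zero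
  obtain ⟨d, hd⟩ : ∃ d, d = p ^ (v + 1) := ⟨_, rfl⟩
  have hd0 : d ≠ 0 := hd ▸ hpn _
  let f : ℕ → ℤ → ℤ → ℤ → ℝ := fun q x y z =>
    congrWeight (d * q) a (M (r + d * x) (s + d * y) (t + d * z))
  have hf0 : ∀ q x y z, 0 ≤ f q x y z := fun q x y z => congrWeight_nonneg _ _ _
  have hconst : ∀ i, avgThree (p ^ (v + i)) (f (p ^ (v + i))) = avgThree (p ^ v) (f (p ^ v)) := by
    intro i
    induction i with
    | zero => rfl
    | succ i ih =>
      have h := avgThree_congrWeight_succ hp (a := a) hcrit i hd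
      rw [← ih, ← h, show p ^ (v + (i + 1)) = p ^ i * d by rw [hd]; ring]
  -- The given solution modulo `d p^v = p^(2v+1)` contributes at least its own term.
  have hbase : (((p ^ v : ℕ) : ℝ) ^ 3)⁻¹ * ((d * p ^ v : ℕ) : ℝ) ≤ avgThree (p ^ v) (f (p ^ v)) := by
    have h1 := le_avgThree_single (Nat.pos_of_ne_zero (hpn v)) (f := f (p ^ v)) (hf0 _)
    refine le_trans (le_of_eq ?_) h1
    congr 1
    simp only [f, mul_zero, add_zero, congrWeight]
    rw [if_pos]
    rwa [hd, ← pow_add, show v + 1 + v = 2 * v + 1 by ring]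
  have hsplit : p ^ (2 * v + 1 + j) = d * p ^ (v + j) := by rw [hd]; ring
  rw [density_eq_avgThree_congrWeight, hsplit,
    ← avgThree_shift (periodicThree_M _ (periodic_congrWeight _ a)) r s t, avgThree_residue]
  have h1 := le_avgThree_single (Nat.pos_of_ne_zero hd0)
    (f := fun b c g => avgThree (p ^ (v + j)) (fun x y z => congrWeight (d * p ^ (v + j)) a
      (M (b + d * x + r) (c + d * y + s) (g + d * z + t))))
    fun b c g => avg_nonneg fun x => avg_nonneg fun y => avg_nonneg fun z => congrWeight_nonneg _ _ _
  refine le_trans ?_ h1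
  have h2 : avgThree (p ^ (v + j)) (fun x y z => congrWeight (d * p ^ (v + j)) a
      (M (0 + d * x + r) (0 + d * y + s) (0 + d * z + t))) = avgThree (p ^ (v + j)) (f (p ^ (v + j))) := by
    refine avgThree_congr fun x y z => ?_
    simp only [f, zero_add]
    rw [add_comm r, add_comm s, add_comm t]
  rw [h2, hconst]
  have h3 : ((d : ℝ) ^ 3)⁻¹ * ((((p ^ v : ℕ) : ℝ) ^ 3)⁻¹ * ((d * p ^ v : ℕ) : ℝ)) =
      ((p : ℝ) ^ (4 * v + 2))⁻¹ := by
    rw [hd]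
    push_cast
    field_simp
    ring
  rw [← h3]
  gcongr

/-- Admissible `a` are represented by the Markoff cubic at a nonsingular point modulo every prime
power. -/
theorem exists_nonsingular {p : ℕ} (hp : p.Prime) {a : ℤ} (ha : Admissible a) :
    ∃ v ≤ 1, ∃ r s t : ℤ, ¬ CriticalMod 0 0 0 (-1) (p ^ (v + 1)) r s t ∧
      ((p ^ (2 * v + 1) : ℕ) : ℤ) ∣ M r s t - a := by
  obtain ⟨ha4, ha9, ha9'⟩ := ha
  rcases eq_or_ne p 2 with rfl | hp2
  · rcases Int.even_or_odd' a with ⟨b, rfl | rfl⟩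
    -- For even `a` a solution modulo `2` with odd `yz` suffices. For `a ≡ 1 mod 4` the values
    -- `M(1,0,0) = 1` and `M(1,2,0) = 5` cover the classes modulo `8`, with gradient nonzero modulo
    -- `4`.
    · exact ⟨0, zero_le_one, 0, 1, 1, by simp [CriticalMod], by simp [M]⟩
    · have hb : b % 2 = 0 := by
        by_contra hb
        apply ha4
        rw [Int.ModEq]
        omega
      rcases (by omega : b % 4 = 0 ∨ b % 4 = 2) with h | h
      · exact ⟨1, le_rfl, 1, 0, 0, by simp [CriticalMod], by simp [M]; omega⟩
      · exact ⟨1, le_rfl, 1, 2, 0, by simp [CriticalMod], by simp [M]; omega⟩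
  rcases eq_or_ne p 3 with rfl | hp3
  · rcases (by omega : a % 3 = 1 ∨ a % 3 = 2 ∨ a % 3 = 0) with h | h | h
    · exact ⟨0, zero_le_one, 1, 0, 0, by simp [CriticalMod], by simp [M]; omega⟩
    · exact ⟨0, zero_le_one, 1, 1, 0, by simp [CriticalMod], by simp [M]; omega⟩
    · have h9 : a % 9 = 0 := by
        rw [Int.ModEq] at ha9 ha9'
        omega
      -- All coordinates are divisible by `3`, and the gradient vanishes modulo `3` but not modulo
      -- `9`; hence `v = 1` and a congruence modulo `27`.
      rcases (by omega : a % 27 = 0 ∨ a % 27 = 9 ∨ a % 27 = 18) with h | h | h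
      · exact ⟨1, le_rfl, 3, 3, 3, by simp [CriticalMod], by simp [M]; omega⟩
      · exact ⟨1, le_rfl, 3, 0, 0, by simp [CriticalMod], by simp [M]; omega⟩
      · exact ⟨1, le_rfl, 3, 3, 0, by simp [CriticalMod], by simp [M]; omega⟩
  have := Fact.mk hp
  have hp5 : 5 ≤ p := by
    have h2 := hp.two_le
    have h4 : p ≠ 4 := by rintro rfl; norm_num at hp
    omega
  have h2 : (2 : ZMod p) ≠ 0 := by
    intro h0
    have : p ∣ 2 := (ZMod.natCast_eq_zero_iff 2 p).1 (by exact_mod_cast h0)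
    exact hp2 ((Nat.prime_dvd_prime_iff_eq hp Nat.prime_two).1 this)
  have h4 : (4 : ZMod p) ≠ 0 := by
    rw [show (4 : ZMod p) = 2 * 2 by norm_num]; exact mul_ne_zero h2 h2
  -- At most four values of `x` are excluded and `p ≥ 5`. The fibre over such an `x` has at least `p
  -- - 1` points, all nonsingular: vanishing `y`- and `z`-derivatives would give `y = z = 0` and
  -- then `x² = a`.
  obtain ⟨x, hx4, hxa⟩ : ∃ x : ZMod p, x ^ 2 ≠ 4 ∧ x ^ 2 ≠ a := by
    by_contra! hcon
    have h1 : ∑ x : ZMod p, (1 : ℤ) ≤ ∑ x : ZMod p, ((if x ^ 2 = 4 then (1 : ℤ) else 0) +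
        (if x ^ 2 = (a : ZMod p) then (1 : ℤ) else 0)) := by
      refine Finset.sum_le_sum fun x _ => ?_
      by_cases h : x ^ 2 = 4
      · rw [if_pos h]; split_ifs <;> norm_num
      · rw [if_neg h, if_pos (hcon x h)]; norm_num
    rw [Finset.sum_add_distrib, sum_ite_sq_eq hp2, sum_ite_sq_eq hp2] at h1
    have h5 := (abs_le.1 (abs_quadraticChar_le_one (4 : ZMod p))).2
    have h6 := (abs_le.1 (abs_quadraticChar_le_one (a : ZMod p))).2
    simp only [Finset.sum_const, Finset.card_univ, ZMod.card, nsmul_eq_mul, mul_one] at h1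
    omega
  obtain ⟨y, z, hyz⟩ : ∃ y z : ZMod p, x ^ 2 + y ^ 2 + z ^ 2 - x * y * z - a = 0 := by
    by_contra! hcon
    have h1 := sum_sum_ite_markoff hp2 (a : ZMod p) x
    simp only [hcon, if_false, Finset.sum_const_zero] at h1
    have h5 := (abs_le.1 (abs_sum_quadraticChar_quadratic_le hp2 (sub_ne_zero.2 hx4)
      (mul_ne_zero h4 (sub_ne_zero.2 hxa.symm)))).1
    omega
  obtain ⟨r, rfl⟩ := ZMod.intCast_surjective x
  obtain ⟨s, rfl⟩ := ZMod.intCast_surjective y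
  obtain ⟨t, rfl⟩ := ZMod.intCast_surjective z
  refine ⟨0, zero_le_one, r, s, t, ?_, by simpa using (dvd_M_sub_iff p r s t a).2 hyz⟩
  rw [zero_add, pow_one]
  rintro ⟨_, h₂, h₃⟩
  simp only [← ZMod.intCast_zmod_eq_zero_iff_dvd] at h₂ h₃
  push_cast at h₂ h₃
  have hs : (s : ZMod p) = 0 := by
    have : ((r : ZMod p) ^ 2 - 4) * s = 0 := by linear_combination -2 * h₂ - r * h₃
    exact (mul_eq_zero.1 this).resolve_left (sub_ne_zero.2 hx4)
  have ht : (t : ZMod p) = 0 := by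
    have : (2 : ZMod p) * t = 0 := by
      rw [hs] at h₃
      linear_combination h₃
    exact (mul_eq_zero.1 this).resolve_left h2
  apply hxa
  rw [hs, ht] at hyz
  linear_combination hyz

/-- With `v ≤ 1`, the exponents `2v + 1` and `4v + 2` of the Hensel bound are at most `3` and `6`.
-/
theorem le_density_of_admissible {p : ℕ} (hp : p.Prime) {a : ℤ} (ha : Admissible a) {k : ℕ}
    (hk : 3 ≤ k) : ((p : ℝ) ^ 6)⁻¹ ≤ density a (p ^ k) := by
  obtain ⟨v, hv, r, s, t, h1, h2⟩ := exists_nonsingular hp ha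
  have h3 := le_density_prime_pow hp h1 h2 (k - (2 * v + 1))
  rw [show 2 * v + 1 + (k - (2 * v + 1)) = k by omega] at h3
  refine le_trans ?_ h3
  have hp1 : (1 : ℝ) ≤ p := by exact_mod_cast hp.one_lt.le
  have hp0 : (0 : ℝ) < p := by linarith
  gcongr
  omega

end Markoff

/-! ### Multiplicative functions with prescribed local inverses -/

/-- The coefficients of the power series inverse to `1 + ∑ c k X ^ k`. -/
noncomputable def invCoeff (c : ℕ → ℝ) : ℕ → ℝ
  | 0 => 1
  | n + 1 => -∑ k : Fin (n + 1), c (n + 1 - k) * invCoeff c k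
decreasing_by exact k.2

theorem invCoeff_zero (c : ℕ → ℝ) : invCoeff c 0 = 1 := by rw [invCoeff]

theorem invCoeff_succ (c : ℕ → ℝ) (n : ℕ) :
    invCoeff c (n + 1) = -∑ k ∈ Finset.range (n + 1), c (n + 1 - k) * invCoeff c k := by
  rw [invCoeff, Finset.sum_range (fun k => c (n + 1 - k) * invCoeff c k)]

theorem sum_mul_invCoeff {c : ℕ → ℝ} (h0 : c 0 = 1) {n : ℕ} (hn : n ≠ 0) :
    ∑ k ∈ Finset.range (n + 1), c (n - k) * invCoeff c k = 0 := by
  obtain ⟨n, rfl⟩ := Nat.exists_eq_succ_of_ne_zero hn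
  rw [Finset.sum_range_succ, Nat.succ_eq_add_one, Nat.sub_self, h0, one_mul, invCoeff_succ,
    add_neg_cancel]

/-- Minkowski's inequality in mean square, obtained by applying Cauchy–Schwarz to each cross term.
-/
theorem avg_sum_sq_le {ι : Type*} (s : Finset ι) (q : ℕ) {f : ι → ℤ → ℝ} {b : ι → ℝ}
    (hb : ∀ i ∈ s, 0 ≤ b i) (hf : ∀ i ∈ s, avg q (fun x => f i x ^ 2) ≤ b i ^ 2) :
    avg q (fun x => (∑ i ∈ s, f i x) ^ 2) ≤ (∑ i ∈ s, b i) ^ 2 := by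
  have h1 : ∀ x : ℤ, (∑ i ∈ s, f i x) ^ 2 = ∑ i ∈ s, ∑ j ∈ s, f i x * f j x := fun x => by
    rw [sq, Finset.sum_mul_sum]
  rw [avg_congr h1, avg_sum, sq, Finset.sum_mul_sum]
  refine Finset.sum_le_sum fun i hi => ?_
  rw [avg_sum]
  refine Finset.sum_le_sum fun j hj => ?_
  refine le_of_sq_le_sq ?_ (mul_nonneg (hb i hi) (hb j hj))
  rw [mul_pow]
  exact (avg_mul_sq_le q _ _).trans (mul_le_mul (hf i hi) (hf j hj)
    (avg_nonneg fun x => sq_nonneg _) (sq_nonneg _))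

theorem abs_avg_mul_le (q : ℕ) {f g : ℤ → ℝ} {b d : ℝ} (hb : 0 ≤ b) (hd : 0 ≤ d)
    (hf : avg q (fun x => f x ^ 2) ≤ b ^ 2) (hg : avg q (fun x => g x ^ 2) ≤ d ^ 2) :
    |avg q (fun x => f x * g x)| ≤ b * d := by
  refine abs_le_of_sq_le_sq ?_ (mul_nonneg hb hd)
  rw [mul_pow]
  exact (avg_mul_sq_le q _ _).trans (mul_le_mul hf hg (avg_nonneg fun x => sq_nonneg _)
    (sq_nonneg _))

/-- This closes the recursion for inverse series: coefficients bounded by `5 x^l` have inverse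
coefficients bounded by `(6x)^l`. -/
theorem sum_geom_six_le (n : ℕ) : 5 * ∑ k ∈ Finset.range n, (6 : ℝ) ^ k ≤ 6 ^ n := by
  rw [geom_sum_eq (by norm_num)]
  have : (0 : ℝ) < 6 ^ n := by positivity
  linarith

/-- Bounds for the inverse coefficients of a family of power series, in the supremum norm, the mean
square and the mean. -/
theorem invCoeff_bounds {q N : ℕ} {x : ℝ} (hx : 0 ≤ x) {c : ℕ → ℤ → ℝ}
    (hsup : ∀ l, 1 ≤ l → l ≤ N → ∀ a, |c l a| ≤ 5 * x ^ l)
    (hsq : ∀ l, 1 ≤ l → l ≤ N → avg q (fun a => c l a ^ 2) ≤ (5 * x ^ (l + 1)) ^ 2)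
    (hmean : ∀ l, 1 ≤ l → l ≤ N → avg q (c l) = 0) (n : ℕ) (hn : n ≤ N) :
    (∀ a, |invCoeff (fun l => c l a) n| ≤ (6 * x) ^ n) ∧
    (1 ≤ n → avg q (fun a => invCoeff (fun l => c l a) n ^ 2) ≤ ((6 * x) ^ n * x) ^ 2 ∧
      |avg q (fun a => invCoeff (fun l => c l a) n)| ≤ (6 * x) ^ n * x ^ 2) := by
  induction n using Nat.strong_induction_on with
  | _ n ih =>
  rcases n with _ | n
  · exact ⟨fun a => by simp [invCoeff_zero], fun h => by omega⟩
  refine ⟨fun a => ?_, fun _ => ⟨?_, ?_⟩⟩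
  · rw [invCoeff_succ, abs_neg]
    calc _ ≤ ∑ k ∈ Finset.range (n + 1), 5 * x ^ (n + 1 - k) * (6 * x) ^ k := by
          refine (Finset.abs_sum_le_sum_abs _ _).trans (Finset.sum_le_sum fun k hk => ?_)
          rw [Finset.mem_range] at hk
          rw [abs_mul]
          exact mul_le_mul (hsup _ (by omega) (by omega) a) ((ih k hk (by omega)).1 a)
            (abs_nonneg _) (by positivity)
      _ = x ^ (n + 1) * (5 * ∑ k ∈ Finset.range (n + 1), (6 : ℝ) ^ k) := by
          rw [Finset.mul_sum, Finset.mul_sum]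
          refine Finset.sum_congr rfl fun k hk => ?_
          rw [Finset.mem_range] at hk
          rw [← Nat.sub_add_cancel hk.le, pow_add x, mul_pow, Nat.add_sub_cancel]
          ring
      _ ≤ x ^ (n + 1) * 6 ^ (n + 1) := by gcongr; exact sum_geom_six_le _
      _ = _ := by rw [mul_pow, mul_comm]
  · simp only [invCoeff_succ, neg_sq]
    calc _ ≤ (∑ k ∈ Finset.range (n + 1), 5 * x ^ (n + 2 - k) * (6 * x) ^ k) ^ 2 := by
          refine avg_sum_sq_le _ _ (fun k _ => by positivity) fun k hk => ?_
          rw [Finset.mem_range] at hk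
          -- One extra factor `x` must come out of every term: from `c` when `k = 0`, otherwise from
          -- the inverse coefficient, with `c` bounded by its supremum.
          rcases Nat.eq_zero_or_pos k with rfl | hk0
          · simpa [invCoeff_zero] using hsq (n + 1) (by omega) hn
          calc _ ≤ avg q (fun a => (5 * x ^ (n + 1 - k)) ^ 2 *
                invCoeff (fun l => c l a) k ^ 2) := by
                refine avg_mono fun a => ?_
                rw [mul_pow, ← sq_abs (c _ a)]
                gcongr
                exact hsup _ (by omega) (by omega) a
            _ ≤ (5 * x ^ (n + 1 - k)) ^ 2 * ((6 * x) ^ k * x) ^ 2 := by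
                rw [avg_mul_left]
                gcongr
                exact ((ih k hk (by omega)).2 hk0).1
            _ = _ := by
                rw [show n + 2 - k = n + 1 - k + 1 by omega]
                ring
      _ = (x ^ (n + 2) * (5 * ∑ k ∈ Finset.range (n + 1), (6 : ℝ) ^ k)) ^ 2 := by
          rw [Finset.mul_sum, Finset.mul_sum]
          congr 1
          refine Finset.sum_congr rfl fun k hk => ?_
          rw [Finset.mem_range] at hk
          rw [show n + 2 = n + 2 - k + k by omega, pow_add x, mul_pow, Nat.add_sub_cancel]
          ring
      _ ≤ (x ^ (n + 2) * 6 ^ (n + 1)) ^ 2 := by gcongr; exact sum_geom_six_le _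
      _ = _ := by ring
  · have h1 : ∀ a, invCoeff (fun l => c l a) (n + 1) = -(∑ k ∈ Finset.range n,
        c (n - k) a * invCoeff (fun l => c l a) (k + 1) + c (n + 1) a) := fun a => by
      rw [invCoeff_succ, Finset.sum_range_succ', invCoeff_zero]
      simp
    rw [avg_congr h1, avg_neg, abs_neg, avg_add, avg_sum, hmean (n + 1) (by omega) hn, add_zero]
    calc _ ≤ ∑ k ∈ Finset.range n, 5 * x ^ (n - k + 1) * ((6 * x) ^ (k + 1) * x) := by
          refine (Finset.abs_sum_le_sum_abs _ _).trans (Finset.sum_le_sum fun k hk => ?_)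
          rw [Finset.mem_range] at hk
          exact abs_avg_mul_le _ (by positivity) (by positivity) (hsq _ (by omega) (by omega))
            ((ih (k + 1) (by omega) (by omega)).2 (by omega)).1
      _ = 6 * x ^ (n + 3) * (5 * ∑ k ∈ Finset.range n, (6 : ℝ) ^ k) := by
          rw [Finset.mul_sum, Finset.mul_sum]
          refine Finset.sum_congr rfl fun k hk => ?_
          rw [Finset.mem_range] at hk
          rw [show n + 3 = n - k + 1 + (k + 2) by omega, pow_add x, mul_pow]
          ring
      _ ≤ 6 * x ^ (n + 3) * 6 ^ n := by gcongr; exact sum_geom_six_le _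
      _ = _ := by ring

namespace ArithmeticFunction

/-- The multiplicative function with prescribed values `g p k` at the prime powers `p ^ k`. -/
noncomputable def ofPrimePow (g : ℕ → ℕ → ℝ) : ArithmeticFunction ℝ :=
  ⟨fun n => if n = 0 then 0 else n.factorization.prod g, by simp⟩

theorem isMultiplicative_ofPrimePow (g : ℕ → ℕ → ℝ) : (ofPrimePow g).IsMultiplicative := by
  refine IsMultiplicative.iff_ne_zero.2 ⟨by simp [ofPrimePow], fun {m n} hm hn h => ?_⟩
  simp only [ofPrimePow, coe_mk, hm, hn, mul_eq_zero, or_self, if_false]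
  rw [Nat.factorization_mul_of_coprime h, Finsupp.prod_add_index_of_disjoint]
  simpa using h.disjoint_primeFactors

theorem ofPrimePow_prime_pow {g : ℕ → ℕ → ℝ} (hg : ∀ p, g p 0 = 1) {p : ℕ} (hp : p.Prime) (k : ℕ) :
    ofPrimePow g (p ^ k) = g p k := by
  simp only [ofPrimePow, coe_mk, pow_eq_zero_iff', hp.ne_zero, false_and, if_false]
  rw [hp.factorization_pow, Finsupp.prod_single_index (hg p)]

theorem mul_prime_pow (f g : ArithmeticFunction ℝ) {p : ℕ} (hp : p.Prime) (n : ℕ) :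
    (f * g) (p ^ n) = ∑ k ∈ Finset.range (n + 1), f (p ^ (n - k)) * g (p ^ k) := by
  rw [mul_comm, mul_apply, Nat.sum_divisorsAntidiagonal (fun x y => g x * f y),
    Nat.sum_divisors_prime_pow hp]
  refine Finset.sum_congr rfl fun k hk => ?_
  rw [Nat.pow_div (Nat.lt_succ_iff.1 (Finset.mem_range.1 hk)) hp.pos, mul_comm]

theorem IsMultiplicative.abs_le {f g : ArithmeticFunction ℝ} (hf : f.IsMultiplicative)
    (hg : g.IsMultiplicative) (h : ∀ p k, p.Prime → |f (p ^ k)| ≤ g (p ^ k)) (n : ℕ) :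
    |f n| ≤ g n := by
  rcases eq_or_ne n 0 with rfl | hn
  · simp
  rw [hf.multiplicative_factorization f hn, hg.multiplicative_factorization g hn, Finsupp.prod,
    Finsupp.prod, Finset.abs_prod]
  exact Finset.prod_le_prod (fun _ _ => abs_nonneg _) fun p hp =>
    h p _ (Nat.prime_of_mem_primeFactors (by simpa using hp))

open Classical in
/-- The restriction of an arithmetic function to the integers without prime factors `≥ N`. -/
noncomputable def smoothPart (N : ℕ) (f : ArithmeticFunction ℝ) : ArithmeticFunction ℝ :=
  ⟨fun n => if n ∈ N.smoothNumbers then f n else 0, by simp⟩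

theorem smoothPart_apply_of_mem {N n : ℕ} (h : n ∈ N.smoothNumbers) (f : ArithmeticFunction ℝ) :
    smoothPart N f n = f n := if_pos h

theorem smoothPart_apply_of_notMem {N n : ℕ} (h : n ∉ N.smoothNumbers) (f : ArithmeticFunction ℝ) :
    smoothPart N f n = 0 := if_neg h

theorem IsMultiplicative.smoothPart {f : ArithmeticFunction ℝ} (hf : f.IsMultiplicative) (N : ℕ) :
    (smoothPart N f).IsMultiplicative := by
  refine ⟨?_, fun {m n} h => ?_⟩
  · rw [smoothPart_apply_of_mem (Nat.mem_smoothNumbers.2 ⟨one_ne_zero, by simp⟩), hf.map_one]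
  · by_cases hm : m ∈ N.smoothNumbers
    · by_cases hn : n ∈ N.smoothNumbers
      · rw [smoothPart_apply_of_mem hm, smoothPart_apply_of_mem hn,
          smoothPart_apply_of_mem (Nat.mul_mem_smoothNumbers hm hn), hf.map_mul_of_coprime h]
      · rw [smoothPart_apply_of_notMem hn, mul_zero, smoothPart_apply_of_notMem fun hmn =>
          hn (Nat.mem_smoothNumbers_of_dvd hmn (dvd_mul_left n m))]
    · rw [smoothPart_apply_of_notMem hm, zero_mul, smoothPart_apply_of_notMem fun hmn =>
        hm (Nat.mem_smoothNumbers_of_dvd hmn (dvd_mul_right m n))]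

theorem _root_.Nat.prime_pow_mem_smoothNumbers {p : ℕ} (hp : p.Prime) {N k : ℕ} :
    p ^ k ∈ N.smoothNumbers ↔ k = 0 ∨ p < N := by
  rw [Nat.mem_smoothNumbers']
  constructor
  · intro h
    by_contra! hk
    exact absurd (h p hp (dvd_pow_self p hk.1)) (by omega)
  · rintro (rfl | h) q hq hqk
    · exact absurd (Nat.dvd_one.1 (by simpa using hqk)) hq.ne_one
    · rwa [(Nat.prime_dvd_prime_iff_eq hq hp).1 (hq.dvd_of_dvd_pow hqk)]

/-- The multiplicative function whose Euler factors at primes `p ≥ N` are inverse to those of `f`,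
and trivial at the primes `p < N`. -/
noncomputable def roughInverse (N : ℕ) (f : ArithmeticFunction ℝ) : ArithmeticFunction ℝ :=
  ofPrimePow fun p k => if p < N then (if k = 0 then 1 else 0) else invCoeff (fun l => f (p ^ l)) k

theorem roughInverse_prime_pow (N : ℕ) (f : ArithmeticFunction ℝ) {p : ℕ} (hp : p.Prime) (k : ℕ) :
    roughInverse N f (p ^ k) =
      if p < N then (if k = 0 then 1 else 0) else invCoeff (fun l => f (p ^ l)) k :=
  ofPrimePow_prime_pow (fun p => by simp [invCoeff_zero]) hp k

theorem isMultiplicative_roughInverse (N : ℕ) (f : ArithmeticFunction ℝ) :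
    (roughInverse N f).IsMultiplicative := isMultiplicative_ofPrimePow _

/-- Both sides are multiplicative, so it suffices to compare Euler factors: at `p < N` the second
factor is trivial, and at `p ≥ N` the two local series multiply to `1`. -/
theorem IsMultiplicative.mul_roughInverse {f : ArithmeticFunction ℝ} (hf : f.IsMultiplicative)
    (N : ℕ) : f * roughInverse N f = ArithmeticFunction.smoothPart N f := by
  refine (IsMultiplicative.eq_iff_eq_on_prime_powers _ (hf.mul (isMultiplicative_roughInverse N f)) _
    (hf.smoothPart N)).2 fun p k hp => ?_
  rw [mul_prime_pow _ _ hp]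
  simp only [roughInverse_prime_pow N f hp]
  by_cases hpN : p < N
  · rw [smoothPart_apply_of_mem ((Nat.prime_pow_mem_smoothNumbers hp).2 (Or.inr hpN))]
    simp [hpN]
  rcases eq_or_ne k 0 with rfl | hk
  · rw [pow_zero, smoothPart_apply_of_mem (Nat.mem_smoothNumbers.2 ⟨one_ne_zero, by simp⟩)]
    simp [hpN, invCoeff_zero]
  rw [smoothPart_apply_of_notMem (by rw [Nat.prime_pow_mem_smoothNumbers hp]; omega)]
  simp only [hpN, if_false]
  exact sum_mul_invCoeff (c := fun l => f (p ^ l)) (by simp [hf.map_one]) hk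

end ArithmeticFunction

/-! ### Tameness of the Markoff coefficients and of their rough inverses -/

namespace Markoff

open ArithmeticFunction (roughInverse smoothPart ofPrimePow)

theorem isCoprime_of_gcd_pow {p l u : ℕ} (hl : 1 ≤ l) (h : Nat.gcd u (p ^ l) = 1) :
    IsCoprime (u : ℤ) (p : ℤ) :=
  Nat.isCoprime_iff_coprime.2 (Nat.Coprime.coprime_dvd_right (dvd_pow_self p (by omega)) h)

theorem pow_mul_inv_sqrt {p : ℕ} (hp : 0 < p) (l : ℕ) :
    ((p ^ l : ℕ) : ℝ) * (1 / √p) ^ (2 * l) = 1 := by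
  have hp0 : (0 : ℝ) < p := by exact_mod_cast hp
  rw [pow_mul, div_pow, Real.sq_sqrt hp0.le, Nat.cast_pow, ← mul_pow, one_pow,
    mul_one_div_cancel hp0.ne', one_pow]

theorem one_div_eq_inv_sqrt_sq (p : ℕ) : 1 / (p : ℝ) = (1 / √p) ^ 2 := by
  rw [div_pow, Real.sq_sqrt (Nat.cast_nonneg p), one_pow]

theorem inv_sqrt_le_one {p : ℕ} (hp : 0 < p) : 1 / √(p : ℝ) ≤ 1 :=
  (div_le_one₀ (by positivity)).2 (Real.one_le_sqrt.2 (by exact_mod_cast hp))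

theorem abs_coeff_prime_pow_le {p : ℕ} (hp : p.Prime) (hp2 : p ≠ 2) {l : ℕ} (hl : 1 ≤ l) (a : ℤ) :
    |coeff a (p ^ l)| ≤ 5 * (1 / √p) ^ l := by
  rcases hl.eq_or_lt with rfl | hl'
  · have h := abs_coeff_prime_le hp hp2 a
    have h1 := inv_sqrt_le_one hp.pos
    have h0 : 0 ≤ 1 / √(p : ℝ) := by positivity
    rw [div_eq_mul_one_div, one_div_eq_inv_sqrt_sq] at h
    rw [pow_one, pow_one]
    refine h.trans ?_
    nlinarith
  · refine (abs_coeff_le (pow_ne_zero l hp.ne_zero) (by positivity) (fun u hu =>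
      norm_markoffMean_le_of_odd hp hp2 (isCoprime_of_gcd_pow hl hu) hl') a).trans_eq ?_
    have := pow_mul_inv_sqrt hp.pos l
    rw [show 3 * l = 2 * l + l by ring, pow_add]
    linear_combination 5 * (1 / √(p : ℝ)) ^ l * this

theorem abs_coeff_two_pow_le (l : ℕ) (a : ℤ) : |coeff a (2 ^ l)| ≤ 4096 * (1 / √2) ^ l := by
  rcases Nat.eq_zero_or_pos l with rfl | hl
  · simp [(isMultiplicative_coeff a).map_one]
  refine (abs_coeff_le (pow_ne_zero l two_ne_zero) (by positivity) (fun u hu =>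
    norm_markoffMean_le_of_two (isCoprime_of_gcd_pow hl hu) l) a).trans_eq ?_
  have := pow_mul_inv_sqrt two_pos l
  rw [show 3 * l = 2 * l + l by ring, pow_add]
  push_cast at this ⊢
  linear_combination 4096 * (1 / √(2 : ℝ)) ^ l * this

theorem abs_coeff_prime_pow_le' {p : ℕ} (hp : p.Prime) (l : ℕ) (a : ℤ) :
    |coeff a (p ^ l)| ≤ 4096 * (1 / √p) ^ l := by
  rcases eq_or_ne p 2 with rfl | hp2
  · exact_mod_cast abs_coeff_two_pow_le l a
  rcases Nat.eq_zero_or_pos l with rfl | hl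
  · simp [(isMultiplicative_coeff a).map_one]
  refine (abs_coeff_prime_pow_le hp hp2 hl a).trans ?_
  gcongr
  norm_num

/-- For `l = 1` the pointwise bound `5/p` already suffices. For `l ≥ 2` Parseval gives `25 p^(-2l)`,
and `2l ≥ l + 1`. -/
theorem avg_coeff_prime_pow_sq_le {p : ℕ} (hp : p.Prime) (hp2 : p ≠ 2) {l : ℕ} (hl : 1 ≤ l) :
    avg (p ^ l) (fun a => coeff a (p ^ l) ^ 2) ≤ (5 * (1 / √p) ^ (l + 1)) ^ 2 := by
  rcases hl.eq_or_lt with rfl | hl'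
  · refine (avg_mono fun a => ?_).trans_eq (avg_const (pow_ne_zero 1 hp.ne_zero) _)
    have h := abs_coeff_prime_le hp hp2 a
    rw [div_eq_mul_one_div, one_div_eq_inv_sqrt_sq] at h
    rw [pow_one, ← sq_abs]
    gcongr
  · refine (avg_coeff_sq_le (pow_ne_zero l hp.ne_zero) fun u hu =>
      norm_markoffMean_le_of_odd hp hp2 (isCoprime_of_gcd_pow hl hu) hl').trans ?_
    have := pow_mul_inv_sqrt hp.pos l
    have h0 : 0 ≤ 1 / √(p : ℝ) := by positivity
    have h1 := pow_le_pow_of_le_one h0 (inv_sqrt_le_one hp.pos)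
      (show 2 * (l + 1) ≤ 4 * l by omega)
    rw [show (5 * (1 / √(p : ℝ)) ^ (3 * l)) ^ 2 = 25 * ((1 / √(p : ℝ)) ^ (2 * l) *
      (1 / √(p : ℝ)) ^ (4 * l)) by ring]
    rw [show (5 * (1 / √(p : ℝ)) ^ (l + 1)) ^ 2 = 25 * (1 / √(p : ℝ)) ^ (2 * (l + 1)) by ring]
    calc _ = 25 * ((((p ^ l : ℕ) : ℝ) * (1 / √p) ^ (2 * l)) * (1 / √(p : ℝ)) ^ (4 * l)) := by ring
      _ ≤ _ := by rw [this, one_mul]; gcongr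

theorem five_mul_pow_le {x : ℝ} (hx : 0 ≤ x) {l : ℕ} (hl : 1 ≤ l) : 5 * x ^ l ≤ (6 * x) ^ l := by
  rw [mul_pow]
  gcongr
  calc (5 : ℝ) ≤ 6 ^ 1 := by norm_num
    _ ≤ 6 ^ l := pow_le_pow_right₀ (by norm_num) hl

theorem tameFamily_coeff {P : ℕ} (hP : 3 ≤ P) : TameFamily P 4096 6 coeff := by
  refine ⟨isMultiplicative_coeff, fun p k hp => periodic_coeff hp k, fun p l hp _ _ a =>
    abs_coeff_prime_pow_le' hp l a, fun p l hp hpP hl a => ?_, fun p l hp hpP hl => ?_,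
    fun p l hp hpP hl => ?_⟩
  · refine (abs_coeff_prime_pow_le hp (by omega) hl a).trans ?_
    rw [div_eq_mul_one_div 6 √(p : ℝ)]
    exact five_mul_pow_le (by positivity) hl
  · refine (avg_coeff_prime_pow_sq_le hp (by omega) hl).trans ?_
    rw [div_eq_mul_one_div 6 √(p : ℝ), div_eq_mul_one_div _ (p : ℝ), one_div_eq_inv_sqrt_sq,
      ← mul_pow]
    have h0 : 0 ≤ 1 / √(p : ℝ) := by positivity
    refine pow_le_pow_left₀ (by positivity) ?_ 2
    rw [pow_succ (1 / √(p : ℝ)) l, ← mul_assoc]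
    exact mul_le_mul_of_nonneg_right (five_mul_pow_le h0 hl) h0
  · obtain ⟨k, rfl⟩ : ∃ k, l = k + 1 := ⟨l - 1, by omega⟩
    rw [avg_coeff_eq_zero hp, abs_zero]
    positivity

theorem periodic_invCoeff {p : ℕ} (hp : p.Prime) (k : ℕ) :
    Function.Periodic (fun a => invCoeff (fun l => coeff a (p ^ l)) k) (p ^ k : ℕ) := by
  induction k using Nat.strong_induction_on with
  | _ n ih =>
  rcases n with _ | n
  · intro a; simp [invCoeff_zero]
  intro a
  simp only [invCoeff_succ]
  refine congr_arg Neg.neg (Finset.sum_congr rfl fun k hk => ?_)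
  rw [Finset.mem_range] at hk
  have h1 := periodic_of_dvd (periodic_coeff hp (n + 1 - k))
    (pow_dvd_pow p (Nat.sub_le (n + 1) k)) a
  have h2 := periodic_of_dvd (ih k hk) (pow_dvd_pow p hk.le) a
  exact congr_arg₂ (· * ·) h1 h2

theorem tameFamily_roughInverse {P : ℕ} (hP : 3 ≤ P) :
    TameFamily P 4096 6 (fun a => roughInverse P (coeff a)) := by
  -- All estimates for the inverse use `x = 1/√p`; the means over smaller powers of `p` are first
  -- lifted to the common period `p ^ l`.
  have key : ∀ p l : ℕ, p.Prime → P ≤ p →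
      (∀ a, |invCoeff (fun l => coeff a (p ^ l)) l| ≤ (6 * (1 / √(p : ℝ))) ^ l) ∧ (1 ≤ l →
      avg (p ^ l) (fun a => invCoeff (fun l => coeff a (p ^ l)) l ^ 2) ≤
        ((6 * (1 / √(p : ℝ))) ^ l * (1 / √p)) ^ 2 ∧
      |avg (p ^ l) (fun a => invCoeff (fun l => coeff a (p ^ l)) l)| ≤
        (6 * (1 / √(p : ℝ))) ^ l * (1 / √p) ^ 2) := by
    intro p l hp hpP
    refine invCoeff_bounds (N := l) (c := fun l a => coeff a (p ^ l)) (by positivity)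
      (fun k hk _ a => abs_coeff_prime_pow_le hp (by omega) hk a) (fun k hk hkl => ?_)
      (fun k hk hkl => ?_) l le_rfl
    · rw [avg_of_dvd (q := p ^ k) (fun a => by
        have := periodic_coeff hp k a
        simp only at this ⊢
        rw [this]) (pow_ne_zero l hp.ne_zero) (pow_dvd_pow p hkl)]
      exact avg_coeff_prime_pow_sq_le hp (by omega) hk
    · rw [avg_of_dvd (periodic_coeff hp k) (pow_ne_zero l hp.ne_zero) (pow_dvd_pow p hkl)]
      obtain ⟨k, rfl⟩ : ∃ m, k = m + 1 := ⟨k - 1, by omega⟩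
      exact avg_coeff_eq_zero hp k
  refine ⟨fun a => ArithmeticFunction.isMultiplicative_roughInverse _ _, fun p k hp => ?_,
    fun p l hp hpP hl a => ?_, fun p l hp hpP hl a => ?_, fun p l hp hpP hl => ?_,
    fun p l hp hpP hl => ?_⟩
  · simp only [ArithmeticFunction.roughInverse_prime_pow _ _ hp]
    split_ifs
    · exact fun _ => rfl
    · exact fun _ => rfl
    · exact periodic_invCoeff hp k
  · simp only [ArithmeticFunction.roughInverse_prime_pow _ _ hp]
    rw [if_pos hpP, if_neg (by omega), abs_zero]
    positivity
  all_goals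
    simp only [ArithmeticFunction.roughInverse_prime_pow _ _ hp, hpP.not_gt, if_false]
    rw [div_eq_mul_one_div 6 √(p : ℝ)]
  · exact (key p l hp hpP).1 a
  · rw [div_eq_mul_one_div _ (p : ℝ), one_div_eq_inv_sqrt_sq, ← mul_pow]
    exact ((key p l hp hpP).2 hl).1
  · rw [div_eq_mul_one_div _ (p : ℝ), one_div_eq_inv_sqrt_sq]
    exact ((key p l hp hpP).2 hl).2

/-! ### A uniform lower bound for the smooth part of the singular series -/

/-- A multiplicative majorant of the coefficients of the singular series. -/
noncomputable def majorant : ArithmeticFunction ℝ :=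
  ofPrimePow fun p k => if k = 0 then 1 else 4096 * (1 / √p) ^ k

theorem majorant_prime_pow {p : ℕ} (hp : p.Prime) (k : ℕ) :
    majorant (p ^ k) = if k = 0 then 1 else 4096 * (1 / √p) ^ k :=
  ArithmeticFunction.ofPrimePow_prime_pow (fun _ => rfl) hp k

theorem isMultiplicative_majorant : majorant.IsMultiplicative :=
  ArithmeticFunction.isMultiplicative_ofPrimePow _

theorem abs_coeff_le_majorant (a : ℤ) (n : ℕ) : |coeff a n| ≤ majorant n := by
  refine (isMultiplicative_coeff a).abs_le isMultiplicative_majorant (fun p k hp => ?_) n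
  rw [majorant_prime_pow hp]
  split_ifs with hk
  · simp [hk, (isMultiplicative_coeff a).map_one]
  · exact abs_coeff_prime_pow_le' hp k a

theorem summable_majorant_prime_pow {p : ℕ} (hp : p.Prime) :
    Summable fun k => ‖majorant (p ^ k)‖ := by
  have h1 : 1 / √(p : ℝ) < 1 := (div_lt_one (by have := hp.pos; positivity)).2
    (Real.lt_sqrt_of_sq_lt (by rw [one_pow]; exact_mod_cast hp.one_lt))
  refine Summable.of_nonneg_of_le (fun _ => norm_nonneg _) (fun k => ?_)
    ((summable_geometric_of_lt_one (by positivity) h1).mul_left 4096)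
  rw [majorant_prime_pow hp]
  split_ifs with hk
  · simp [hk]
  · rw [Real.norm_of_nonneg (by positivity)]

theorem summable_majorant (P : ℕ) : Summable fun m : P.smoothNumbers => majorant m := by
  refine Summable.of_norm (EulerProduct.summable_and_hasSum_smoothNumbers_prod_primesBelow_tsum
    (f := majorant) isMultiplicative_majorant.map_one
    (fun h => isMultiplicative_majorant.map_mul_of_coprime h)
    (fun hp => summable_majorant_prime_pow hp) P).1

theorem sum_coeff_prime_pow {p : ℕ} (hp : p.Prime) (a : ℤ) (n : ℕ) :
    ∑ k ∈ Finset.range (n + 1), coeff a (p ^ k) = density a (p ^ n) := by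
  rw [← sum_divisors_coeff, Nat.sum_divisors_prime_pow hp]

/-- The partial sums telescope to local densities, which are bounded below from `p^3` on. -/
theorem le_tsum_coeff_prime_pow {p : ℕ} (hp : p.Prime) {a : ℤ} (ha : Admissible a) :
    ((p : ℝ) ^ 6)⁻¹ ≤ ∑' k, coeff a (p ^ k) := by
  have hs : Summable fun k => coeff a (p ^ k) := Summable.of_norm_bounded
    (summable_majorant_prime_pow hp).of_norm fun k => abs_coeff_le_majorant a _
  refine ge_of_tendsto ((Filter.tendsto_add_atTop_iff_nat 1).2 hs.tendsto_sum_tsum_nat) ?_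
  filter_upwards [Filter.eventually_ge_atTop 3] with n hn
  rw [sum_coeff_prime_pow hp]
  exact le_density_of_admissible hp ha hn

/-- The part of the singular series supported on the integers without large prime factors is
bounded below, uniformly in the admissible integers `a`. -/
theorem exists_le_sum_smoothPart_coeff (P : ℕ) : ∃ σ > 0, ∃ K₀ : ℕ, ∀ a, Admissible a →
    ∀ K ≥ K₀, σ ≤ ∑ n ∈ Finset.Ioc 0 K, smoothPart P (coeff a) n := by
  classical
  set σ : ℝ := ∏ p ∈ P.primesBelow, ((p : ℝ) ^ 6)⁻¹ with hσ
  have hσ0 : 0 < σ := Finset.prod_pos fun p hp => by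
    have := (Nat.prime_of_mem_primesBelow hp).pos
    positivity
  have hG : Summable (fun n => smoothPart P majorant n) := by
    refine (summable_subtype_iff_indicator.1 (summable_majorant P)).congr fun n => ?_
    by_cases hn : n ∈ P.smoothNumbers
    · rw [ArithmeticFunction.smoothPart_apply_of_mem hn, Set.indicator_of_mem hn]
    · rw [ArithmeticFunction.smoothPart_apply_of_notMem hn, Set.indicator_of_notMem hn]
  have habs : ∀ a n, |smoothPart P (coeff a) n| ≤ smoothPart P majorant n := by
    intro a n
    by_cases hn : n ∈ P.smoothNumbers
    · rw [ArithmeticFunction.smoothPart_apply_of_mem hn,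
        ArithmeticFunction.smoothPart_apply_of_mem hn]
      exact abs_coeff_le_majorant a n
    · rw [ArithmeticFunction.smoothPart_apply_of_notMem hn,
        ArithmeticFunction.smoothPart_apply_of_notMem hn, abs_zero]
  -- The majorant does not depend on `a`, so its tail provides a threshold uniform in `a`.
  obtain ⟨K₀, hK₀⟩ := Filter.eventually_atTop.1
    ((tendsto_order.1 (tendsto_sum_nat_add fun n => smoothPart P majorant n)).2 (σ / 2)
      (half_pos hσ0))
  refine ⟨σ / 2, half_pos hσ0, K₀, fun a ha K hK => ?_⟩
  have hsum : Summable fun n => smoothPart P (coeff a) n :=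
    Summable.of_norm_bounded hG (habs a)
  have htot : σ ≤ ∑' n, smoothPart P (coeff a) n := by
    have h1 := (EulerProduct.summable_and_hasSum_smoothNumbers_prod_primesBelow_tsum
      (f := coeff a) (isMultiplicative_coeff a).map_one
      (fun h => (isMultiplicative_coeff a).map_mul_of_coprime h)
      (fun hp => Summable.of_nonneg_of_le (fun _ => norm_nonneg _)
        (fun k => abs_coeff_le_majorant a _) (summable_majorant_prime_pow hp).of_norm) P).2
    have h2 : ∑' n, smoothPart P (coeff a) n = ∏ p ∈ P.primesBelow, ∑' k, coeff a (p ^ k) := by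
      rw [← h1.tsum_eq, tsum_subtype P.smoothNumbers (fun n => coeff a n)]
      refine tsum_congr fun n => ?_
      by_cases hn : n ∈ P.smoothNumbers
      · rw [ArithmeticFunction.smoothPart_apply_of_mem hn, Set.indicator_of_mem hn]
      · rw [ArithmeticFunction.smoothPart_apply_of_notMem hn, Set.indicator_of_notMem hn]
    rw [h2]
    exact Finset.prod_le_prod (fun p _ => by positivity) fun p hp =>
      le_tsum_coeff_prime_pow (Nat.prime_of_mem_primesBelow hp) ha
  have h3 := hsum.sum_add_tsum_nat_add (K + 1)
  have h4 : |∑' n, smoothPart P (coeff a) (n + (K + 1))| ≤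
      ∑' n, smoothPart P majorant (n + (K + 1)) :=
    tsum_of_norm_bounded (f := fun n => smoothPart P (coeff a) (n + (K + 1)))
      ((summable_nat_add_iff (K + 1)).2 hG).hasSum fun n => habs a _
  have h5 := hK₀ (K + 1) (by omega)
  have h6 : ∑ n ∈ Finset.Ioc 0 K, smoothPart P (coeff a) n =
      ∑ n ∈ Finset.range (K + 1), smoothPart P (coeff a) n := by
    rw [Finset.range_eq_Ico, Finset.sum_eq_sum_Ico_succ_bot (by omega), ArithmeticFunction.map_zero,
      zero_add]
    rfl
  rw [h6]
  have := (abs_le.1 h4).2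
  linarith

end Markoff

/-! ### Counting small values by moments -/

namespace Markoff

open ArithmeticFunction (roughInverse smoothPart)

theorem ncard_smallValueSet_le_sum {A K : ℕ} {η : ℝ} {f : ℤ → ℝ} (h0 : ∀ a, 0 ≤ f a)
    (h1 : ∀ a ∈ smallValueSet A K η, 1 ≤ f a) :
    ((smallValueSet A K η).ncard : ℝ) ≤ ∑ a ∈ Finset.Icc (-(A : ℤ)) A, f a := by
  rw [Set.ncard_eq_toFinset_card _ (smallValueSet_finite A K η)]
  calc _ = ∑ a ∈ (smallValueSet_finite A K η).toFinset, (1 : ℝ) := by simp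
    _ ≤ ∑ a ∈ (smallValueSet_finite A K η).toFinset, f a :=
        Finset.sum_le_sum fun a ha => h1 a ((smallValueSet_finite A K η).mem_toFinset.1 ha)
    _ ≤ _ := Finset.sum_le_sum_of_subset_of_nonneg (fun a ha =>
        Finset.mem_Icc.2 (abs_le.1 ((smallValueSet_finite A K η).mem_toFinset.1 ha).1))
        fun a _ _ => h0 a

theorem ncard_smallValueSet_le {A : ℕ} (hA : 1 ≤ A) (K : ℕ) (η : ℝ) :
    ((smallValueSet A K η).ncard : ℝ) / A ≤ 3 := by
  have hA' : (1 : ℝ) ≤ A := by exact_mod_cast hA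
  rw [div_le_iff₀ (by linarith)]
  refine (ncard_smallValueSet_le_sum (f := fun _ => 1) (fun _ => zero_le_one)
    fun _ _ => le_rfl).trans ?_
  have h : (((A : ℤ) + 1 - -(A : ℤ)).toNat : ℝ) = 2 * A + 1 := by
    rw [show (A : ℤ) + 1 - -(A : ℤ) = ((2 * A + 1 : ℕ) : ℤ) by push_cast; ring, Int.toNat_natCast]
    push_cast
    ring
  simp only [Finset.sum_const, Int.card_Icc, nsmul_eq_mul, mul_one, h]
  linarith

/-- The pairs `(m, n)` in `[1, K]²` with `K < m n ≤ K ^ (3 / 2)`. -/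
def middlePairs (K : ℕ) : Finset (ℕ × ℕ) :=
  {x ∈ Finset.Ioc 0 K ×ˢ Finset.Ioc 0 K | K < x.1 * x.2 ∧ (x.1 * x.2) ^ 2 ≤ K ^ 3}

/-- The pairs `(m, n)` in `[1, K]²` with `m n > K ^ (3 / 2)`. -/
def outerPairs (K : ℕ) : Finset (ℕ × ℕ) :=
  {x ∈ Finset.Ioc 0 K ×ˢ Finset.Ioc 0 K | K ^ 3 < (x.1 * x.2) ^ 2}

theorem sum_mul_sum_eq (f g : ArithmeticFunction ℝ) {K : ℕ} (hK : 1 ≤ K) :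
    (∑ m ∈ Finset.Ioc 0 K, f m) * ∑ n ∈ Finset.Ioc 0 K, g n =
      ∑ n ∈ Finset.Ioc 0 K, (f * g) n + ∑ x ∈ middlePairs K, f x.1 * g x.2 +
        ∑ x ∈ outerPairs K, f x.1 * g x.2 := by
  rw [ArithmeticFunction.sum_Ioc_mul_eq_sum_prod_filter, Finset.sum_mul_sum, ← Finset.sum_product',
    middlePairs, outerPairs, Finset.sum_filter, Finset.sum_filter, Finset.sum_filter,
    ← Finset.sum_add_distrib, ← Finset.sum_add_distrib]
  refine Finset.sum_congr rfl fun x _ => ?_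
  by_cases h1 : x.1 * x.2 ≤ K
  · have h2 : (x.1 * x.2) ^ 2 ≤ K ^ 3 := (Nat.pow_le_pow_left h1 2).trans
      (Nat.pow_le_pow_right hK (by norm_num))
    simp [h1, h1.not_gt, h2.not_gt]
  · by_cases h2 : (x.1 * x.2) ^ 2 ≤ K ^ 3
    · simp [h1, not_le.1 h1, h2, h2.not_gt]
    · simp [h1, h2, not_le.1 h2]

/-- The left side equals `6 p^(-δ)`, which tends to `0`. The choice of `P` decides which Euler
factors get inverted. -/
theorem exists_large_prime_bound {δ : ℝ} (hδ : 0 < δ) : ∃ P : ℕ, 3 ≤ P ∧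
    ∀ p : ℕ, p.Prime → P ≤ p → 6 / √(p : ℝ) * (p : ℝ) ^ (1 / 2 - δ) ≤ 1 / 2 := by
  obtain ⟨P, hP⟩ := Filter.eventually_atTop.1 ((tendsto_order.1
    ((tendsto_rpow_neg_atTop hδ).comp tendsto_natCast_atTop_atTop)).2 (1 / 12 : ℝ) (by norm_num))
  refine ⟨max 3 P, le_max_left _ _, fun p hp hpP => ?_⟩
  have h1 := hP p (le_of_max_le_right hpP)
  have hp0 : (0 : ℝ) < p := by exact_mod_cast hp.pos
  have h2 : (p : ℝ) ^ (1 / 2 - δ) = √p * (p : ℝ) ^ (-δ) := by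
    rw [sub_eq_add_neg, Real.rpow_add hp0, Real.sqrt_eq_rpow]
  have h3 : √(p : ℝ) ≠ 0 := by positivity
  rw [h2, ← mul_assoc, div_mul_cancel₀ _ h3]
  simp only [Function.comp_apply] at h1
  linarith

theorem one_le_three_mul_div_pow {σ x : ℝ} (hσ : 0 < σ) (hx : σ / 3 ≤ |x|) {k : ℕ} (hk : Even k) :
    1 ≤ (3 / σ) ^ k * x ^ k := by
  rw [← mul_pow, ← hk.pow_abs, abs_mul, abs_of_pos (by positivity)]
  refine one_le_pow₀ ?_
  rw [div_mul_eq_mul_div, le_div_iff₀ hσ]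
  linarith

/-- From `σ ≤ η|X| + |Y| + |Z|` one of the three terms is at least `σ/3`, so the corresponding even
power, scaled by `3/σ`, majorizes the indicator of the set. The middle range affords the higher
exponent `4j` because its products are at most `K^(3/2)`; the outer range makes up for the exponent
`2j` by having larger products. -/
theorem exists_ncard_le {j : ℕ} {δ : ℝ} (hδ : 0 < δ) (hδ' : δ ≤ 1 / 2) :
    ∃ B > 0, ∃ K₀ : ℕ, ∀ (η : ℝ) (A K : ℕ), 0 < η → 1 ≤ A → 1 ≤ K → K ^ (6 * j) ≤ A → K₀ ≤ K →
      ((smallValueSet A K η).ncard : ℝ) ≤ B * A * (η ^ (2 * j) +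
        (((K : ℝ) ^ (1 / 2 - δ))⁻¹ ^ (4 * j) +
          ((((K : ℝ) ^ (3 / 2 : ℝ)) ^ (1 / 2 - δ))⁻¹ ^ (2 * j)))) := by
  obtain ⟨P, hP3, hP⟩ := exists_large_prime_bound hδ
  obtain ⟨σ, hσ, K₀, hK₀⟩ := exists_le_sum_smoothPart_coeff P
  have he2 : Even (2 * j) := even_two_mul j
  have he4 : Even (4 * j) := ⟨2 * j, by ring⟩
  obtain ⟨B₁, hB₁, h₁⟩ := TameFamily.exists_moment_le (by norm_num) (by norm_num)
    (tameFamily_coeff hP3) (tameFamily_roughInverse hP3) hδ hδ' hP he2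
  obtain ⟨B₂, hB₂, h₂⟩ := TameFamily.exists_moment_le (by norm_num) (by norm_num)
    (tameFamily_coeff hP3) (tameFamily_roughInverse hP3) hδ hδ' hP he4
  set t : ℝ := 3 / σ with ht
  have ht0 : 0 < t := by positivity
  refine ⟨t ^ (2 * j) * B₁ + t ^ (4 * j) * B₂, by positivity, K₀,
    fun η A K hη hA hK hKA hKK₀ => ?_⟩
  set r : ℤ → ArithmeticFunction ℝ := fun a => roughInverse P (coeff a) with hr
  set X : ℤ → ℝ := fun a => ∑ n ∈ Finset.Ioc 0 K, r a n with hX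
  set Y : ℤ → ℝ := fun a => ∑ x ∈ middlePairs K, coeff a x.1 * r a x.2 with hY
  set Z : ℤ → ℝ := fun a => ∑ x ∈ outerPairs K, coeff a x.1 * r a x.2 with hZ
  have hK1 : (1 : ℝ) ≤ K := by exact_mod_cast hK
  have hK0 : (0 : ℝ) < K := by linarith
  have b₁ : ∑ a ∈ Finset.Icc (-(A : ℤ)) A, X a ^ (2 * j) ≤ B₁ * A := by
    -- Pairs with first entry `1` isolate the inverse sum, since `coeff a 1 = 1`; with `L = 1` there
    -- is no saving.
    have := h₁ A K 1 ({1} ×ˢ Finset.Ioc 0 K) hA one_pos fun x hx => by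
      obtain ⟨m, n⟩ := x
      simp only [Finset.mem_product, Finset.mem_singleton, Finset.mem_Ioc] at hx
      obtain ⟨rfl, hn⟩ := hx
      simp only [Finset.mem_Icc, one_mul, Nat.cast_one]
      refine ⟨⟨le_rfl, hK⟩, hn, by exact_mod_cast hn.1, ?_⟩
      exact (Nat.pow_le_pow_left hn.2 _).trans
        ((Nat.pow_le_pow_right hK (show 2 * j ≤ 6 * j by omega)).trans hKA)
    simpa [Finset.sum_product, (isMultiplicative_coeff _).map_one] using this
  have b₂ : ∑ a ∈ Finset.Icc (-(A : ℤ)) A, Y a ^ (4 * j) ≤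
      B₂ * A * ((K : ℝ) ^ (1 / 2 - δ))⁻¹ ^ (4 * j) := by
    refine h₂ A K K (middlePairs K) hA hK0 fun x hx => ?_
    simp only [middlePairs, Finset.mem_filter, Finset.mem_product, Finset.mem_Ioc] at hx
    obtain ⟨⟨h1, h2⟩, h3, h4⟩ := hx
    refine ⟨Finset.mem_Icc.2 h1, Finset.mem_Icc.2 h2, by exact_mod_cast h3.le, ?_⟩
    calc (x.1 * x.2) ^ (4 * j) = ((x.1 * x.2) ^ 2) ^ (2 * j) := by rw [← pow_mul]; ring_nf
      _ ≤ (K ^ 3) ^ (2 * j) := Nat.pow_le_pow_left h4 _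
      _ = K ^ (6 * j) := by rw [← pow_mul]; ring_nf
      _ ≤ A := hKA
  have b₃ : ∑ a ∈ Finset.Icc (-(A : ℤ)) A, Z a ^ (2 * j) ≤
      B₁ * A * (((K : ℝ) ^ (3 / 2 : ℝ)) ^ (1 / 2 - δ))⁻¹ ^ (2 * j) := by
    refine h₁ A K _ (outerPairs K) hA (by positivity) fun x hx => ?_
    simp only [outerPairs, Finset.mem_filter, Finset.mem_product, Finset.mem_Ioc] at hx
    obtain ⟨⟨h1, h2⟩, h3⟩ := hx
    refine ⟨Finset.mem_Icc.2 h1, Finset.mem_Icc.2 h2, ?_, ?_⟩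
    · refine le_of_sq_le_sq ?_ (by positivity)
      rw [← Real.rpow_natCast, ← Real.rpow_mul hK0.le, show (3 / 2 : ℝ) * (2 : ℕ) = (3 : ℕ) by
        norm_num, Real.rpow_natCast]
      exact_mod_cast h3.le
    · calc (x.1 * x.2) ^ (2 * j) ≤ (K * K) ^ (2 * j) :=
            Nat.pow_le_pow_left (Nat.mul_le_mul h1.2 h2.2) _
        _ = K ^ (4 * j) := by rw [← sq, ← pow_mul]; ring_nf
        _ ≤ K ^ (6 * j) := Nat.pow_le_pow_right hK (by omega)
        _ ≤ A := hKA
  have key : ((smallValueSet A K η).ncard : ℝ) ≤ ∑ a ∈ Finset.Icc (-(A : ℤ)) A,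
      (t ^ (2 * j) * (η * X a) ^ (2 * j) + t ^ (4 * j) * Y a ^ (4 * j) +
        t ^ (2 * j) * Z a ^ (2 * j)) := by
    have n1 : ∀ a, 0 ≤ t ^ (2 * j) * (η * X a) ^ (2 * j) := fun a =>
      mul_nonneg (by positivity) (he2.pow_nonneg _)
    have n2 : ∀ a, 0 ≤ t ^ (4 * j) * Y a ^ (4 * j) := fun a =>
      mul_nonneg (by positivity) (he4.pow_nonneg _)
    have n3 : ∀ a, 0 ≤ t ^ (2 * j) * Z a ^ (2 * j) := fun a =>
      mul_nonneg (by positivity) (he2.pow_nonneg _)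
    refine ncard_smallValueSet_le_sum (fun a => by linarith [n1 a, n2 a, n3 a]) fun a ha => ?_
    have hs := ha.2.2
    rw [s_eq_sum_coeff, Complex.norm_real, Real.norm_eq_abs] at hs
    have h4 := sum_mul_sum_eq (coeff a) (r a) hK
    rw [(isMultiplicative_coeff a).mul_roughInverse P] at h4
    have h5 := hK₀ a ha.2.1 K hKK₀
    have h6 : |(∑ m ∈ Finset.Ioc 0 K, coeff a m) * X a| ≤ |η * X a| := by
      rw [abs_mul, abs_mul, abs_of_pos hη]
      exact mul_le_mul_of_nonneg_right hs (abs_nonneg _)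
    have h7 : σ ≤ |η * X a| + |Y a| + |Z a| := by
      have := le_abs_self ((∑ m ∈ Finset.Ioc 0 K, coeff a m) * X a)
      have := neg_abs_le (Y a)
      have := neg_abs_le (Z a)
      linarith
    by_cases c1 : σ / 3 ≤ |η * X a|
    · linarith [one_le_three_mul_div_pow hσ c1 he2, n2 a, n3 a]
    by_cases c2 : σ / 3 ≤ |Y a|
    · linarith [one_le_three_mul_div_pow hσ c2 he4, n1 a, n3 a]
    have c3 : σ / 3 ≤ |Z a| := by linarith
    linarith [one_le_three_mul_div_pow hσ c3 he2, n1 a, n2 a]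
  refine key.trans ?_
  simp only [mul_pow, Finset.sum_add_distrib, ← Finset.mul_sum]
  set u := ((K : ℝ) ^ (1 / 2 - δ))⁻¹ ^ (4 * j) with hu
  set v := (((K : ℝ) ^ (3 / 2 : ℝ)) ^ (1 / 2 - δ))⁻¹ ^ (2 * j) with hv
  have hu0 : 0 ≤ u := by positivity
  have hv0 : 0 ≤ v := by positivity
  calc _ ≤ t ^ (2 * j) * (η ^ (2 * j) * (B₁ * A)) + t ^ (4 * j) * (B₂ * A * u) +
        t ^ (2 * j) * (B₁ * A * v) := by gcongr
    -- Adding the missing nonnegative cross terms lets everything factor with a single constant.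
    _ ≤ t ^ (2 * j) * (η ^ (2 * j) * (B₁ * A)) + t ^ (4 * j) * (B₂ * A * u) +
        t ^ (2 * j) * (B₁ * A * v) + (t ^ (4 * j) * B₂ * A * (η ^ (2 * j) + v) +
        t ^ (2 * j) * B₁ * A * u) := le_add_of_nonneg_right (by positivity)
    _ = _ := by ring

end Markoff

theorem theorem4p1 (j : ℕ) (hj : 1 ≤ j) (ε : ℝ) (hε : 0 < ε) :
    ∃ C : ℝ, 0 < C ∧
      ∀ (η : ℝ) (A K : ℕ), 0 < η → 1 ≤ A → 1 ≤ K → K ^ (6 * j) ≤ A →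
        ((Markoff.smallValueSet A K η).ncard : ℝ) / (A : ℝ) ≤
          C * (η ^ (1.8 * (j : ℝ)) + (A : ℝ) ^ ε * (K : ℝ) ^ (-(1.5 * (j : ℝ)))
            + η ^ (0.2 * (j : ℝ)) * (K : ℝ) ^ (-(j : ℝ) + ε)) := by
  have hδ : 0 < min (1 / 8) ε := lt_min (by norm_num) hε
  obtain ⟨B, hB, K₀, h⟩ := Markoff.exists_ncard_le (j := j) hδ
    ((min_le_left _ _).trans (by norm_num))
  set δ := min (1 / 8) ε with hδdef
  have hδ8 : δ ≤ 1 / 8 := min_le_left _ _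
  have hδε : δ ≤ ε := min_le_right _ _
  have hj0 : (0 : ℝ) < j := by exact_mod_cast hj
  -- `2 * B` serves the main case. The other two summands turn the trivial density bound `3` into
  -- the claim when `η > 1` and when `K < K₀`.
  refine ⟨2 * B + 3 + 3 * (K₀ : ℝ) ^ (1.5 * (j : ℝ)), by positivity,
    fun η A K hη hA hK hKA => ?_⟩
  have hA1 : (1 : ℝ) ≤ A := by exact_mod_cast hA
  have hK1 : (1 : ℝ) ≤ K := by exact_mod_cast hK
  have hK0 : (0 : ℝ) < K := by linarith
  have hA0 : (0 : ℝ) < A := by linarith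
  have hAε : 1 ≤ (A : ℝ) ^ ε := Real.one_le_rpow hA1 hε.le
  have hc : 0 ≤ (K₀ : ℝ) ^ (1.5 * (j : ℝ)) := by positivity
  set x := η ^ (1.8 * (j : ℝ)) with hx
  set k := (K : ℝ) ^ (-(1.5 * (j : ℝ))) with hk
  set w := η ^ (0.2 * (j : ℝ)) * (K : ℝ) ^ (-(j : ℝ) + ε) with hw
  have hx0 : 0 ≤ x := by positivity
  have hk0 : 0 ≤ k := by positivity
  have hw0 : 0 ≤ w := by positivity
  have hy0 : 0 ≤ (A : ℝ) ^ ε * k := by positivity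
  rcases lt_or_ge 1 η with hη1 | hη1
  · have h1 : 1 ≤ x := Real.one_le_rpow hη1.le (by positivity)
    refine (Markoff.ncard_smallValueSet_le hA K η).trans ?_
    nlinarith [mul_nonneg hc hx0, mul_nonneg hB.le hx0, mul_nonneg hc hy0, mul_nonneg hB.le hy0,
      mul_nonneg hc hw0, mul_nonneg hB.le hw0]
  rcases lt_or_ge K K₀ with hKK | hKK
  · have h1 : 1 ≤ (K₀ : ℝ) ^ (1.5 * (j : ℝ)) * k := by
      rw [hk, Real.rpow_neg hK0.le, ← div_eq_mul_inv, one_le_div (by positivity)]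
      gcongr
    have h2 : k ≤ (A : ℝ) ^ ε * k := le_mul_of_one_le_left hk0 hAε
    refine (Markoff.ncard_smallValueSet_le hA K η).trans ?_
    have h3 := mul_le_mul_of_nonneg_left h2 hc
    nlinarith [mul_nonneg hc hx0, mul_nonneg hB.le hx0, mul_nonneg hB.le hy0,
      mul_nonneg hc hw0, mul_nonneg hB.le hw0]
  have h1 := h η A K hη hA hK hKA hKK
  have h2 : η ^ (2 * j) ≤ x := by
    rw [hx, ← Real.rpow_natCast]
    refine Real.rpow_le_rpow_of_exponent_ge hη hη1 ?_
    push_cast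
    linarith
  -- The exponent is `-(2 - 4δ) j`, at most `-1.5 j` because `δ ≤ 1/8`.
  have h3 : ((K : ℝ) ^ (1 / 2 - δ))⁻¹ ^ (4 * j) ≤ (A : ℝ) ^ ε * k := by
    refine le_trans ?_ (le_mul_of_one_le_left hk0 hAε)
    rw [hk, ← Real.rpow_neg hK0.le, ← Real.rpow_natCast, ← Real.rpow_mul hK0.le]
    refine Real.rpow_le_rpow_of_exponent_le hK1 ?_
    push_cast
    nlinarith
  -- The exponent `-1.5 j + 3 δ j` misses the target slightly; `A^ε ≥ K^(6 j ε)` with `δ ≤ ε` covers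
  -- the loss.
  have h4 : (((K : ℝ) ^ (3 / 2 : ℝ)) ^ (1 / 2 - δ))⁻¹ ^ (2 * j) ≤ (A : ℝ) ^ ε * k := by
    have h5 : (K : ℝ) ^ (6 * (j : ℝ) * ε) ≤ (A : ℝ) ^ ε := by
      rw [Real.rpow_mul hK0.le]
      refine Real.rpow_le_rpow (by positivity) ?_ hε.le
      rw [show 6 * (j : ℝ) = ((6 * j : ℕ) : ℝ) by push_cast; ring, Real.rpow_natCast]
      exact_mod_cast hKA
    refine le_trans ?_ (mul_le_mul_of_nonneg_right h5 hk0)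
    rw [hk, ← Real.rpow_mul hK0.le, ← Real.rpow_neg hK0.le, ← Real.rpow_natCast,
      ← Real.rpow_mul hK0.le, ← Real.rpow_add hK0]
    refine Real.rpow_le_rpow_of_exponent_le hK1 ?_
    push_cast
    nlinarith [mul_le_mul_of_nonneg_left hδε hj0.le, mul_pos hj0 hε]
  rw [div_le_iff₀ hA0]
  refine h1.trans ?_
  rw [mul_right_comm]
  refine mul_le_mul_of_nonneg_right ?_ hA0.le
  calc _ ≤ B * (x + ((A : ℝ) ^ ε * k + (A : ℝ) ^ ε * k)) := by gcongr
    _ ≤ _ := by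
      nlinarith [mul_nonneg hc hx0, mul_nonneg hB.le hx0, mul_nonneg hc hy0, mul_nonneg hB.le hy0,
        mul_nonneg hc hw0, mul_nonneg hB.le hw0]
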